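/- Let $F$ be a field of characteristic $p$ ($p=0$ is allowed; $a\equiv b\pmod 0$ means $a=b$). Let $G$ be an elementary abelian $2$-group of finite order $n=|G|\ge 3$ (so $n\geq 4$). Let $X=\{(x_1,x_2,x_3)\in G^3: x_1x_2=x_3\}$, and consider the relations $R_0=\{(y,y):y\in X\}$, $R_i=\{(y,z)\in X^2: y\ne z,\ y_i=z_i\}$ for $i=1,2,3$, and $R_4=X^2\setminus(R_0\cup R_1\cup R_2\cup R_3)$; they form a symmetric association scheme on $X$ (the scheme induced from the Cayley table of $G$). Let $k_i$ be the valency of $R_i$, that is, $k_i=|\{z:(y,z)\in R_i\}|$ for any $y\in X$. Let $A_i$ be the adjacency matrix of $R_i$ over $F$ and $J$ the all-one matrix, with rows and columns indexed by $X$. Fix $\mathbf x\in X$ and let $E_i^*$ be the diagonal matrix over $F$ whose $(y,y)$-entry is $1$ if $(\mathbf x,y)\in R_i$ and $0$ otherwise. The Terwilliger $F$-algebra $T$ with respect to $\mathbf x$ is the unital $F$-subalgebra of the full matrix algebra $M_X(F)$ generated by all $E_a^*A_bE_c^*$, $0\le a,b,c\le4$. Let $\mathrm{Rad}\,T$ be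 its Jacobson radical. Write $M_m(F)$ for the algebra of $m\times m$ matrices over $F$. For $a,b,c,e,f\in\{0,\dots,4\}$ put $[abc]=E_a^*A_bE_c^*$, $[abcef]=E_a^*A_bE_c^*A_eE_f^*$ and $J_{ab}=E_a^*JE_b^*$. Define - $B_4=\{J_{ab}: 0\le a,b\le 4,\ p\mid k_ak_b\}$; - $C_1=\{J_{44},\ [414]-[424],\ [414]-[434],\ [41234]-E_4^*-[414],\ [41234]-[41324],\ [41234]-[42134],\ [41234]-[42314],\ [41234]-[43124],\ [41234]-[43214]\}$; - $D_1$: the matrices $[124]-[134]$, $[214]-[234]$, $[314]-[324]$, $[12314]-[134]$, $[21324]-[234]$, $[31234]-[324]$ and their transposes; - $C_2=\{J_{44},\ E_4^*+[414]+[42314]+[43214],\ E_4^*+[424]+[41324]+[43124],\ E_4^*+[434]+[41234]+[42134],\ [41234]+[42134]+[43124]+[43214],\ [42314]+[43214]+[41234]+[41324]\}$; - $D_2$: the matrices $[124]+[134]+[12314]$, $[214]+[234]+[21324]$, $[314]+[324]+[31234]$ and their transposes; - $C_3=\{J_{44}-E_4^*-[414]-[42314]-[43214],\ J_{44}-E_4^*-[424]-[41324]-[43124],\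 J_{44}-E_4^*-[434]-[41234]-[42134],\ [41234]+[42134]-[43124]-[43214],\ [42314]+[43214]-[41234]-[41324]\}$; - $D_3$: the matrices $J_{14}-[124]-[134]-[12314]$, $J_{24}-[214]-[234]-[21324]$, $J_{34}-[314]-[324]-[31234]$ and their transposes. Let $V_1$ be the $F$-span of $B_4\cup C_1\cup D_1$. Let $V_2$ be the $F$-span of $B_4$ if $p\ne2$, and of $B_4\cup C_2\cup D_2$ if $p=2$. Let $V_3$ be the $F$-span of $C_3\cup D_3$. Then, as $F$-algebras, \[T/\mathrm{Rad}\,T\cong\begin{cases} M_4(F)\oplus M_1(F)\oplus M_1(F),& n\equiv 1\pmod p,\\ M_6(F)\oplus M_4(F)\oplus M_1(F),& p\neq 2,\ n\equiv 2\pmod p,\\ M_5(F)\oplus M_4(F)\oplus M_1(F),& p=2,\\ M_5(F)\oplus M_5(F)\oplus M_1(F),& p\neq 2,3,\ n\equiv4\pmod p,\\ M_6(F)\oplus M_5(F)\oplus M_1(F),& n\not\equiv 1,2,4\pmod p, \end{cases}\] and \[\mathrm{Rad}\,T=\begin{cases} V_1, & n\equiv 1\pmod p,\\ V_2, & n\equiv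 2\pmod p,\\ V_3, & p\neq 2, 3,\ n\equiv4\pmod p,\\ \{0\}, & n\not\equiv 1,2,4\pmod p. \end{cases}\] -/

import Mathlib

/-- An association scheme of class `d` on a finite set `X`: a partition `R 0, …, R d` of `X × X`
into nonempty relations, where `R 0` is the diagonal, the converse of each relation is one of the
relations, and the numbers of intermediate points depend only on the relations involved. -/
structure AssociationScheme (X : Type*) [Finite X] (d : ℕ) where
  R : Fin (d + 1) → X → X → Prop
  rel_nonempty : ∀ i, ∃ x y, R i x y
  rel_existsUnique : ∀ x y, ∃! i, R i x y
  rel_zero : ∀ x y, R 0 x y ↔ x = y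
  exists_converse : ∀ i, ∃ j, ∀ x y, R j x y ↔ R i y x
  regular : ∀ g h i x y x' y', R i x y → R i x' y' →
    Nat.card {z // R g x z ∧ R h z y} = Nat.card {z // R g x' z ∧ R h z y'}

namespace AssociationScheme

/-- The index `i'` of the converse of the relation `R i`. -/
noncomputable def converse {X : Type*} [Finite X] {d : ℕ} (S : AssociationScheme X d)
    (i : Fin (d + 1)) : Fin (d + 1) :=
  (S.exists_converse i).choose

/-- The intersection number `p_{gh}^i`: the number of `z` with `R g x z` and `R h z y`, for any
pair `x, y` with `R i x y`. -/
noncomputable def intersectionNumber {X : Type*} [Finite X] {d : ℕ} (S : AssociationScheme X d)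
    (g h i : Fin (d + 1)) : ℕ :=
  Nat.card {z // S.R g (S.rel_nonempty i).choose z ∧
    S.R h z (S.rel_nonempty i).choose_spec.choose}

theorem intersectionNumber_eq {X : Type*} [Finite X] {d : ℕ} (S : AssociationScheme X d)
    (g h i : Fin (d + 1)) {x y : X} (hxy : S.R i x y) :
    S.intersectionNumber g h i = Nat.card {z // S.R g x z ∧ S.R h z y} :=
  S.regular g h i _ _ x y (S.rel_nonempty i).choose_spec.choose_spec hxy

/-- The valency `k_i = p_{ii'}^0`. -/
noncomputable def valency {X : Type*} [Finite X] {d : ℕ} (S : AssociationScheme X d)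
    (i : Fin (d + 1)) : ℕ :=
  S.intersectionNumber i (S.converse i) 0

theorem valency_eq {X : Type*} [Finite X] {d : ℕ} (S : AssociationScheme X d)
    (i : Fin (d + 1)) (x : X) : S.valency i = Nat.card {z // S.R i x z} := by
  rw [valency, S.intersectionNumber_eq i _ 0 ((S.rel_zero x x).2 rfl)]
  have h := (S.exists_converse i).choose_spec
  simp only [converse, h, and_self]

open Classical in
/-- The adjacency matrix `A_i` of the relation `R i` over `F`. -/
noncomputable def adj (F : Type*) [Field F] {X : Type*} [Fintype X] {d : ℕ}
    (S : AssociationScheme X d) (i : Fin (d + 1)) : Matrix X X F :=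
  Matrix.of fun y z => if S.R i y z then 1 else 0

open Classical in
/-- The dual idempotent `E_i^*(x)` over `F`: the diagonal matrix that is the indicator of
`{y : (x, y) ∈ R i}`. -/
noncomputable def dualIdem (F : Type*) [Field F] {X : Type*} [Fintype X] {d : ℕ}
    (S : AssociationScheme X d) (x : X) (i : Fin (d + 1)) : Matrix X X F :=
  Matrix.diagonal fun y => if S.R i x y then 1 else 0

/-- The Terwilliger `F`-algebra of the scheme with respect to `x`: the unital subalgebra of the
full matrix algebra generated by all `E_a^*(x) A_b E_c^*(x)`. -/
noncomputable def terwilliger (F : Type*) [Field F] {X : Type*} [Fintype X] [DecidableEq X]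
    {d : ℕ} (S : AssociationScheme X d) (x : X) : Subalgebra F (Matrix X X F) :=
  Algebra.adjoin F
    {M | ∃ a b c : Fin (d + 1), M = S.dualIdem F x a * S.adj F b * S.dualIdem F x c}

/-- The quotient of the Terwilliger algebra by its Jacobson radical. -/
abbrev terwilligerModRad (F : Type*) [Field F] {X : Type*} [Fintype X] [DecidableEq X]
    {d : ℕ} (S : AssociationScheme X d) (x : X) : Type _ :=
  S.terwilliger F x ⧸ Ring.jacobson (S.terwilliger F x)

/-- The Jacobson radical of the Terwilliger algebra, as a space of matrices. -/
noncomputable def radSpace (F : Type*) [Field F] {X : Type*} [Fintype X] [DecidableEq X]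
    {d : ℕ} (S : AssociationScheme X d) (x : X) : Submodule F (Matrix X X F) :=
  ((Ring.jacobson (S.terwilliger F x)).restrictScalars F).map (S.terwilliger F x).val.toLinearMap

/-- `E_a^*(x) A_b E_c^*(x)`. -/
noncomputable def triple (F : Type*) [Field F] {X : Type*} [Fintype X] {d : ℕ}
    (S : AssociationScheme X d) (x : X) (a b c : Fin (d + 1)) : Matrix X X F :=
  S.dualIdem F x a * S.adj F b * S.dualIdem F x c

/-- `E_a^*(x) A_b E_c^*(x) A_e E_f^*(x)`. -/
noncomputable def quintuple (F : Type*) [Field F] {X : Type*} [Fintype X] {d : ℕ}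
    (S : AssociationScheme X d) (x : X) (a b c e f : Fin (d + 1)) : Matrix X X F :=
  S.dualIdem F x a * S.adj F b * S.dualIdem F x c * S.adj F e * S.dualIdem F x f

/-- `E_a^*(x) J E_b^*(x)`, where `J` is the all-one matrix. -/
noncomputable def block (F : Type*) [Field F] {X : Type*} [Fintype X] {d : ℕ}
    (S : AssociationScheme X d) (x : X) (a b : Fin (d + 1)) : Matrix X X F :=
  S.dualIdem F x a * Matrix.of (fun _ _ => 1) * S.dualIdem F x b

/-- The set of all `E_a^*(x) J E_b^*(x)` with `p ∣ k_a k_b`. -/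
def setB4 (F : Type*) [Field F] (p : ℕ) {X : Type*} [Fintype X] (S : AssociationScheme X 4)
    (x : X) : Set (Matrix X X F) :=
  {M | ∃ a b : Fin 5, p ∣ S.valency a * S.valency b ∧ M = S.block F x a b}

/-- The spanning set `C_1`. -/
def setC1 (F : Type*) [Field F] {X : Type*} [Fintype X] (S : AssociationScheme X 4) (x : X) :
    Set (Matrix X X F) :=
  let E := S.dualIdem F x
  let t := S.triple F x
  let q := S.quintuple F x
  {S.block F x 4 4,
    t 4 1 4 - t 4 2 4,
    t 4 1 4 - t 4 3 4,
    q 4 1 2 3 4 - E 4 - t 4 1 4,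
    q 4 1 2 3 4 - q 4 1 3 2 4,
    q 4 1 2 3 4 - q 4 2 1 3 4,
    q 4 1 2 3 4 - q 4 2 3 1 4,
    q 4 1 2 3 4 - q 4 3 1 2 4,
    q 4 1 2 3 4 - q 4 3 2 1 4}

/-- The spanning set `D_1`, closed under transposition. -/
def setD1 (F : Type*) [Field F] {X : Type*} [Fintype X] (S : AssociationScheme X 4) (x : X) :
    Set (Matrix X X F) :=
  let t := S.triple F x
  let q := S.quintuple F x
  let D : Set (Matrix X X F) :=
    {t 1 2 4 - t 1 3 4,
      t 2 1 4 - t 2 3 4,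
      t 3 1 4 - t 3 2 4,
      q 1 2 3 1 4 - t 1 3 4,
      q 2 1 3 2 4 - t 2 3 4,
      q 3 1 2 3 4 - t 3 2 4}
  D ∪ Matrix.transpose '' D

/-- The space `V_1` spanned by `B_4`, `C_1` and `D_1`. -/
noncomputable def spaceV1 (F : Type*) [Field F] (p : ℕ) {X : Type*} [Fintype X]
    (S : AssociationScheme X 4) (x : X) : Submodule F (Matrix X X F) :=
  Submodule.span F (S.setB4 F p x ∪ S.setC1 F x ∪ S.setD1 F x)

/-- The set `C_2` in characteristic two. -/
def setC2 (F : Type*) [Field F] {X : Type*} [Fintype X] (S : AssociationScheme X 4) (x : X) :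
    Set (Matrix X X F) :=
  let E := S.dualIdem F x
  let t := S.triple F x
  let q := S.quintuple F x
  {S.block F x 4 4,
    E 4 + t 4 1 4 + q 4 2 3 1 4 + q 4 3 2 1 4,
    E 4 + t 4 2 4 + q 4 1 3 2 4 + q 4 3 1 2 4,
    E 4 + t 4 3 4 + q 4 1 2 3 4 + q 4 2 1 3 4,
    q 4 1 2 3 4 + q 4 2 1 3 4 + q 4 3 1 2 4 + q 4 3 2 1 4,
    q 4 2 3 1 4 + q 4 3 2 1 4 + q 4 1 2 3 4 + q 4 1 3 2 4}

/-- The spanning set `D_2`, closed under transposition. -/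
def setD2 (F : Type*) [Field F] {X : Type*} [Fintype X] (S : AssociationScheme X 4) (x : X) :
    Set (Matrix X X F) :=
  let t := S.triple F x
  let q := S.quintuple F x
  let D : Set (Matrix X X F) :=
    {t 1 2 4 + t 1 3 4 + q 1 2 3 1 4,
      t 2 1 4 + t 2 3 4 + q 2 1 3 2 4,
      t 3 1 4 + t 3 2 4 + q 3 1 2 3 4}
  D ∪ Matrix.transpose '' D

/-- The space `V_2`: spanned by `B_4`, `C_2` and `D_2` if `p = 2`, and by `B_4` otherwise. -/
noncomputable def spaceV2 (F : Type*) [Field F] (p : ℕ) {X : Type*} [Fintype X]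
    (S : AssociationScheme X 4) (x : X) : Submodule F (Matrix X X F) :=
  if p = 2 then Submodule.span F (S.setB4 F p x ∪ S.setC2 F x ∪ S.setD2 F x)
  else Submodule.span F (S.setB4 F p x)

/-- The spanning set `C_3`. -/
def setC3 (F : Type*) [Field F] {X : Type*} [Fintype X] (S : AssociationScheme X 4) (x : X) :
    Set (Matrix X X F) :=
  let E := S.dualIdem F x
  let t := S.triple F x
  let q := S.quintuple F x
  {S.block F x 4 4 - E 4 - t 4 1 4 - q 4 2 3 1 4 - q 4 3 2 1 4,
    S.block F x 4 4 - E 4 - t 4 2 4 - q 4 1 3 2 4 - q 4 3 1 2 4,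
    S.block F x 4 4 - E 4 - t 4 3 4 - q 4 1 2 3 4 - q 4 2 1 3 4,
    q 4 1 2 3 4 + q 4 2 1 3 4 - q 4 3 1 2 4 - q 4 3 2 1 4,
    q 4 2 3 1 4 + q 4 3 2 1 4 - q 4 1 2 3 4 - q 4 1 3 2 4}

/-- The spanning set `D_3`, closed under transposition. -/
def setD3 (F : Type*) [Field F] {X : Type*} [Fintype X] (S : AssociationScheme X 4) (x : X) :
    Set (Matrix X X F) :=
  let t := S.triple F x
  let q := S.quintuple F x
  let D : Set (Matrix X X F) :=
    {S.block F x 1 4 - t 1 2 4 - t 1 3 4 - q 1 2 3 1 4,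
      S.block F x 2 4 - t 2 1 4 - t 2 3 4 - q 2 1 3 2 4,
      S.block F x 3 4 - t 3 1 4 - t 3 2 4 - q 3 1 2 3 4}
  D ∪ Matrix.transpose '' D

/-- The space `V_3` spanned by `C_3` and `D_3`. -/
noncomputable def spaceV3 (F : Type*) [Field F] {X : Type*} [Fintype X]
    (S : AssociationScheme X 4) (x : X) : Submodule F (Matrix X X F) :=
  Submodule.span F (S.setC3 F x ∪ S.setD3 F x)

end AssociationScheme

/-- The set `X_G` of all triples `(x₁, x₂, x₃)` over `G` with `x₁ x₂ = x₃`. -/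
abbrev CayleyTriple (G : Type*) [Group G] : Type _ := {x : G × G × G // x.1 * x.2.1 = x.2.2}

namespace CayleyTriple

/-- The five relations on `X_G`: equality, equality in exactly the first, second or third
coordinate, and none of these. -/
def rel (G : Type*) [Group G] (i : Fin 5) (x y : CayleyTriple G) : Prop :=
  match i with
  | 0 => x = y
  | 1 => x.1.1 = y.1.1 ∧ x ≠ y
  | 2 => x.1.2.1 = y.1.2.1 ∧ x ≠ y
  | 3 => x.1.2.2 = y.1.2.2 ∧ x ≠ y
  | 4 => ¬ (x = y ∨ (x.1.1 = y.1.1 ∧ x ≠ y) ∨ (x.1.2.1 = y.1.2.1 ∧ x ≠ y) ∨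
      (x.1.2.2 = y.1.2.2 ∧ x ≠ y))

theorem ext_iff' {G : Type*} [Group G] (x y : CayleyTriple G) :
    x = y ↔ x.1.1 = y.1.1 ∧ x.1.2.1 = y.1.2.1 := by
  obtain ⟨⟨a, b, c⟩, h⟩ := x
  obtain ⟨⟨a', b', c'⟩, h'⟩ := y
  simp only at h h'
  subst h h'
  simp only [Subtype.mk.injEq, Prod.mk.injEq]
  grind

/-- The three coordinates of a triple. -/
def coord {G : Type*} [Group G] (i : Fin 3) (x : CayleyTriple G) : G :=
  match i with
  | 0 => x.1.1
  | 1 => x.1.2.1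
  | 2 => x.1.2.2

theorem existsUnique_coord {G : Type*} [Group G] {i j : Fin 3} (hij : i ≠ j) (u v : G) :
    ∃! z : CayleyTriple G, coord i z = u ∧ coord j z = v := by
  have key : ∀ a b : G, ∀ P : CayleyTriple G → Prop,
      (∀ z : CayleyTriple G, P z ↔ z.1.1 = a ∧ z.1.2.1 = b) → ∃! z, P z := by
    intro a b P hP
    refine ⟨⟨(a, b, a * b), rfl⟩, (hP _).2 ⟨rfl, rfl⟩, fun z hz => ?_⟩
    obtain ⟨h1, h2⟩ := (hP z).1 hz
    exact (ext_iff' _ _).2 ⟨h1, h2⟩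
  fin_cases i <;> fin_cases j
  · exact absurd rfl hij
  · exact key u v _ fun z => by simp [coord]
  · refine key u (u⁻¹ * v) _ fun z => ?_
    have := z.2
    simp only [coord]
    constructor
    · rintro ⟨rfl, rfl⟩; simp [← this]
    · rintro ⟨rfl, h⟩; simp [← this, h]
  · exact key v u _ fun z => by simp [coord, and_comm]
  · exact absurd rfl hij
  · refine key (v * u⁻¹) u _ fun z => ?_
    have := z.2
    simp only [coord]
    constructor
    · rintro ⟨rfl, rfl⟩; simp [← this]
    · rintro ⟨h, rfl⟩; simp [← this, h]
  · refine key v (v⁻¹ * u) _ fun z => ?_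
    have := z.2
    simp only [coord]
    constructor
    · rintro ⟨rfl, rfl⟩; simp [← this]
    · rintro ⟨rfl, h⟩; simp [← this, h]
  · refine key (u * v⁻¹) v _ fun z => ?_
    have := z.2
    simp only [coord]
    constructor
    · rintro ⟨rfl, rfl⟩; simp [← this]
    · rintro ⟨h, rfl⟩; simp [← this, h]
  · exact absurd rfl hij

theorem eq_of_coord {G : Type*} [Group G] {i j : Fin 3} (hij : i ≠ j) {x y : CayleyTriple G}
    (h1 : coord i x = coord i y) (h2 : coord j x = coord j y) : x = y :=
  (existsUnique_coord hij (coord i y) (coord j y)).unique ⟨h1, h2⟩ ⟨rfl, rfl⟩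

theorem rel_existsUnique {G : Type*} [Group G] (x y : CayleyTriple G) : ∃! i, rel G i x y := by
  have h01 := @eq_of_coord G _ 0 1 (by decide) x y
  have h02 := @eq_of_coord G _ 0 2 (by decide) x y
  have h12 := @eq_of_coord G _ 1 2 (by decide) x y
  simp only [coord] at h01 h02 h12
  by_cases h : x = y
  · refine ⟨0, h, fun i hi => ?_⟩
    fin_cases i <;> simp_all [rel]
  by_cases h1 : x.1.1 = y.1.1
  · refine ⟨1, ⟨h1, h⟩, fun i hi => ?_⟩
    fin_cases i <;> simp only [rel] at hi <;> first | rfl | (exfalso; tauto)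
  by_cases h2 : x.1.2.1 = y.1.2.1
  · refine ⟨2, ⟨h2, h⟩, fun i hi => ?_⟩
    fin_cases i <;> simp only [rel] at hi <;> first | rfl | (exfalso; tauto)
  by_cases h3 : x.1.2.2 = y.1.2.2
  · refine ⟨3, ⟨h3, h⟩, fun i hi => ?_⟩
    fin_cases i <;> simp only [rel] at hi <;> first | rfl | (exfalso; tauto)
  · refine ⟨4, by simp only [rel]; tauto, fun i hi => ?_⟩
    fin_cases i <;> simp only [rel] at hi <;> first | rfl | (exfalso; tauto)

theorem rel_symm {G : Type*} [Group G] (i : Fin 5) (x y : CayleyTriple G) :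
    rel G i x y ↔ rel G i y x := by
  fin_cases i <;> simp only [rel, eq_comm, ne_eq]

theorem rel_nonempty {G : Type*} [Group G] [Fintype G] (hn : 3 ≤ Fintype.card G) (i : Fin 5) :
    ∃ x y, rel G i x y := by
  classical
  obtain ⟨a, ha⟩ : ∃ a : G, a ∉ ({1} : Finset G) :=
    Finset.exists_mem_notMem_of_card_lt_card (s := {1}) (t := Finset.univ)
      (by simp only [Finset.card_singleton, Finset.card_univ]; omega) |>.imp fun _ h => h.2
  obtain ⟨b, hb⟩ : ∃ b : G, b ∉ ({1, a⁻¹} : Finset G) :=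
    Finset.exists_mem_notMem_of_card_lt_card (s := {1, a⁻¹}) (t := Finset.univ)
      (lt_of_le_of_lt Finset.card_le_two (by simp only [Finset.card_univ]; omega))
      |>.imp fun _ h => h.2
  simp only [Finset.mem_singleton, Finset.mem_insert, not_or] at ha hb
  have hab : a * b ≠ 1 := fun h => hb.2 (eq_inv_of_mul_eq_one_right h)
  let o : CayleyTriple G := ⟨(1, 1, 1), by simp⟩
  fin_cases i
  · exact ⟨o, o, rfl⟩
  · exact ⟨⟨(1, a, a), by simp⟩, o, rfl, by simp [o, ha]⟩
  · exact ⟨⟨(a, 1, a), by simp⟩, o, rfl, by simp [o, ha]⟩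
  · exact ⟨⟨(a, a⁻¹, 1), by simp⟩, o, rfl, by simp [o, ha]⟩
  · exact ⟨⟨(a, b, a * b), rfl⟩, o, by simp [rel, o, ha, hb.1, hab]⟩

open Classical in
/-- The integer matrix of equality in the `i`-th coordinate. -/
noncomputable def lineMatrix (G : Type*) [Group G] (i : Fin 3) :
    Matrix (CayleyTriple G) (CayleyTriple G) ℤ :=
  Matrix.of fun x y => if coord i x = coord i y then 1 else 0

open Classical in
/-- The integer matrix of the `i`-th relation. -/
noncomputable def relMatrix (G : Type*) [Group G] (i : Fin 5) :
    Matrix (CayleyTriple G) (CayleyTriple G) ℤ :=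
  Matrix.of fun x y => if rel G i x y then 1 else 0

/-- The matrices whose entries only depend on the relation that holds. -/
def relSpan (G : Type*) [Group G] : Submodule ℤ (Matrix (CayleyTriple G) (CayleyTriple G) ℤ) where
  carrier := {M | ∀ i x y x' y', rel G i x y → rel G i x' y' → M x y = M x' y'}
  add_mem' := by
    intro M N hM hN i x y x' y' h h'
    simp [hM i x y x' y' h h', hN i x y x' y' h h']
  zero_mem' := by intro i x y x' y' h h'; simp
  smul_mem' := by
    intro c M hM i x y x' y' h h'
    simp [hM i x y x' y' h h']

theorem mem_relSpan_of_iff {G : Type*} [Group G] {P : CayleyTriple G → CayleyTriple G → Prop}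
    [∀ x y, Decidable (P x y)]
    (hP : ∀ i x y x' y', rel G i x y → rel G i x' y' → (P x y ↔ P x' y')) :
    (Matrix.of fun x y => if P x y then (1 : ℤ) else 0) ∈ relSpan G := by
  intro i x y x' y' h h'
  have := hP i x y x' y' h h'
  simp [this]

theorem lineMatrix_mem {G : Type*} [Group G] (k : Fin 3) : lineMatrix G k ∈ relSpan G := by
  classical
  apply mem_relSpan_of_iff
  have aux : ∀ i x y, rel G i x y → (coord k x = coord k y ↔ i = 0 ∨ (i : ℕ) = k + 1) := by
    intro i x y h
    have h01 := @eq_of_coord G _ 0 1 (by decide) x y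
    have h02 := @eq_of_coord G _ 0 2 (by decide) x y
    have h12 := @eq_of_coord G _ 1 2 (by decide) x y
    simp only [coord] at h01 h02 h12
    fin_cases i <;> fin_cases k <;> simp [rel, coord] at h ⊢ <;> tauto
  intro i x y x' y' h h'
  rw [aux i x y h, aux i x' y' h']

theorem relMatrix_mul_apply {G : Type*} [Group G] [Fintype G] [DecidableEq G] (g h : Fin 5)
    (x y : CayleyTriple G) :
    (relMatrix G g * relMatrix G h) x y = Nat.card {z // rel G g x z ∧ rel G h z y} := by
  classical
  simp only [Matrix.mul_apply, relMatrix, Matrix.of_apply, mul_ite, mul_one, mul_zero,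
    ← ite_and]
  rw [Finset.sum_boole, Nat.card_eq_fintype_card, Fintype.card_subtype]
  simp only [and_comm]

open Classical in
theorem sum_coord {G : Type*} [Group G] [Fintype G] [DecidableEq G] (i : Fin 3) (u : G) :
    (∑ z : CayleyTriple G, if coord i z = u then (1 : ℤ) else 0) = Fintype.card G := by
  obtain ⟨j, hij⟩ : ∃ j : Fin 3, i ≠ j := ⟨i + 1, by fin_cases i <;> decide⟩
  rw [Finset.sum_boole, ← Fintype.card_subtype]
  congr 1
  refine Fintype.card_of_bijective (f := fun z : {z // coord i z = u} => coord j z.1)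
    ⟨fun z w h => Subtype.ext (eq_of_coord hij (z.2.trans w.2.symm) h), fun v => ?_⟩
  obtain ⟨z, hz, -⟩ := existsUnique_coord hij u v
  exact ⟨⟨z, hz.1⟩, hz.2⟩

theorem const_mem {G : Type*} [Group G] (c : ℤ) : (Matrix.of fun _ _ => c) ∈ relSpan G :=
  fun _ _ _ _ _ _ _ => rfl

theorem line_mul_line_mem {G : Type*} [Group G] [Fintype G] [DecidableEq G] (i j : Fin 3) :
    lineMatrix G i * lineMatrix G j ∈ relSpan G := by
  classical
  by_cases hij : i = j
  · subst hij
    have : lineMatrix G i * lineMatrix G i = (Fintype.card G : ℤ) • lineMatrix G i := by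
      ext x y
      rw [Matrix.smul_apply, ← sum_coord i (coord i y), Matrix.mul_apply, smul_eq_mul,
        Finset.sum_mul]
      refine Finset.sum_congr rfl fun z _ => ?_
      simp only [lineMatrix, Matrix.of_apply]
      by_cases h : coord i z = coord i y <;> simp [h]
    rw [this]
    exact Submodule.smul_mem _ _ (lineMatrix_mem i)
  · have : lineMatrix G i * lineMatrix G j = Matrix.of fun _ _ => 1 := by
      ext x y
      obtain ⟨z, hz, huz⟩ := existsUnique_coord hij (coord i x) (coord j y)
      rw [Matrix.mul_apply, Finset.sum_eq_single z]
      · simp [lineMatrix, hz]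
      · intro w _ hw
        by_contra hc
        apply hw
        apply huz
        simp only [lineMatrix, Matrix.of_apply, mul_ite, mul_one, mul_zero, ite_eq_right_iff,
          one_ne_zero, imp_false, not_not, not_forall, exists_prop] at hc
        exact ⟨hc.2.symm, hc.1⟩
      · simp
    rw [this]
    exact const_mem 1

theorem const_mul_line_mem {G : Type*} [Group G] [Fintype G] [DecidableEq G] (i : Fin 3) :
    (Matrix.of fun _ _ => (1 : ℤ)) * lineMatrix G i ∈ relSpan G := by
  classical
  convert const_mem (G := G) (Fintype.card G : ℤ)
  ext x y
  simp [Matrix.mul_apply, lineMatrix, ← sum_coord i (coord i y)]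

theorem line_mul_const_mem {G : Type*} [Group G] [Fintype G] [DecidableEq G] (i : Fin 3) :
    lineMatrix G i * (Matrix.of fun _ _ => (1 : ℤ)) ∈ relSpan G := by
  classical
  convert const_mem (G := G) (Fintype.card G : ℤ)
  ext x y
  simp only [Matrix.mul_apply, lineMatrix, Matrix.of_apply, ← sum_coord i (coord i x), mul_one]
  exact Finset.sum_congr rfl fun z _ => by
    simp only [eq_comm]
    congr

theorem const_mul_const_mem {G : Type*} [Group G] [Fintype G] [DecidableEq G] :
    (Matrix.of fun _ _ => (1 : ℤ)) * (Matrix.of fun _ _ => (1 : ℤ)) ∈ relSpan G :=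
  fun _ _ _ _ _ _ _ => rfl

theorem one_mem {G : Type*} [Group G] [DecidableEq G] :
    (1 : Matrix (CayleyTriple G) (CayleyTriple G) ℤ) ∈ relSpan G := by
  have : (1 : Matrix (CayleyTriple G) (CayleyTriple G) ℤ) =
      Matrix.of fun x y => if x = y then (1 : ℤ) else 0 := by
    ext x y
    simp [Matrix.one_apply]
  rw [this]
  apply mem_relSpan_of_iff
  have aux : ∀ i x y, rel G i x y → (x = y ↔ i = 0) := by
    intro i x y h
    fin_cases i <;> simp [rel] at h ⊢ <;> tauto
  intro i x y x' y' h h'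
  rw [aux i x y h, aux i x' y' h']

/-- Matrices that together span all relation matrices. -/
def basic (G : Type*) [Group G] [DecidableEq G] :
    Set (Matrix (CayleyTriple G) (CayleyTriple G) ℤ) :=
  {1, Matrix.of fun _ _ => 1} ∪ Set.range (lineMatrix G)

theorem basic_mul_basic {G : Type*} [Group G] [Fintype G] [DecidableEq G]
    {M N : Matrix (CayleyTriple G) (CayleyTriple G) ℤ} (hM : M ∈ basic G) (hN : N ∈ basic G) :
    M * N ∈ relSpan G := by
  rcases hM with (rfl | rfl) | ⟨i, rfl⟩ <;> rcases hN with (rfl | rfl) | ⟨j, rfl⟩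
  · rw [mul_one]; exact one_mem
  · rw [one_mul]; exact const_mem 1
  · rw [one_mul]; exact lineMatrix_mem j
  · rw [mul_one]; exact const_mem 1
  · exact const_mul_const_mem
  · exact const_mul_line_mem j
  · rw [mul_one]; exact lineMatrix_mem i
  · exact line_mul_const_mem i
  · exact line_mul_line_mem i j

theorem relMatrix_mem_span {G : Type*} [Group G] [DecidableEq G] (i : Fin 5) :
    relMatrix G i ∈ Submodule.span ℤ (basic G) := by
  classical
  have h1 : 1 ∈ Submodule.span ℤ (basic G) := Submodule.subset_span (by simp [basic])
  have hJ : (Matrix.of fun _ _ => 1) ∈ Submodule.span ℤ (basic G) :=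
    Submodule.subset_span (by simp [basic])
  have hL : ∀ k, lineMatrix G k ∈ Submodule.span ℤ (basic G) := fun k =>
    Submodule.subset_span (by simp [basic])
  have key : ∀ M ∈ Submodule.span ℤ (basic G), (∀ x y, relMatrix G i x y = M x y) →
      relMatrix G i ∈ Submodule.span ℤ (basic G) := by
    intro M hM h
    rwa [Matrix.ext h]
  have e01 := fun x y => @eq_of_coord G _ 0 1 (by decide) x y
  have e02 := fun x y => @eq_of_coord G _ 0 2 (by decide) x y
  have e12 := fun x y => @eq_of_coord G _ 1 2 (by decide) x y
  simp only [coord] at e01 e02 e12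
  fin_cases i
  · refine key 1 h1 fun x y => ?_
    simp only [relMatrix, rel, Matrix.one_apply, Matrix.of_apply]
    congr
  · refine key _ (sub_mem (hL 0) h1) fun x y => ?_
    simp only [relMatrix, rel, lineMatrix, coord, Matrix.one_apply, Matrix.sub_apply,
      Matrix.of_apply]
    by_cases h : x = y
    · simp [h]
    · simp only [h, ne_eq, not_false_eq_true, and_true, if_false, sub_zero]
      congr
  · refine key _ (sub_mem (hL 1) h1) fun x y => ?_
    simp only [relMatrix, rel, lineMatrix, coord, Matrix.one_apply, Matrix.sub_apply,
      Matrix.of_apply]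
    by_cases h : x = y
    · simp [h]
    · simp only [h, ne_eq, not_false_eq_true, and_true, if_false, sub_zero]
      congr
  · refine key _ (sub_mem (hL 2) h1) fun x y => ?_
    simp only [relMatrix, rel, lineMatrix, coord, Matrix.one_apply, Matrix.sub_apply,
      Matrix.of_apply]
    by_cases h : x = y
    · simp [h]
    · simp only [h, ne_eq, not_false_eq_true, and_true, if_false, sub_zero]
      congr
  · refine key _ (add_mem (add_mem (sub_mem (sub_mem (sub_mem hJ (hL 0)) (hL 1)) (hL 2)) h1) h1)
      fun x y => ?_
    simp only [relMatrix, rel, lineMatrix, coord, Matrix.one_apply, Matrix.sub_apply,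
      Matrix.add_apply, Matrix.of_apply]
    have e01 := e01 x y
    have e02 := e02 x y
    have e12 := e12 x y
    by_cases h : x = y
    · simp [h]
    · by_cases h1 : x.1.1 = y.1.1 <;> by_cases h2 : x.1.2.1 = y.1.2.1 <;>
        by_cases h3 : x.1.2.2 = y.1.2.2 <;>
        first
        | exact absurd (e01 h1 h2) h
        | exact absurd (e02 h1 h3) h
        | exact absurd (e12 h2 h3) h
        | simp [h, h1, h2, h3]

theorem relMatrix_mul_mem {G : Type*} [Group G] [Fintype G] [DecidableEq G] (g h : Fin 5) :
    relMatrix G g * relMatrix G h ∈ relSpan G := by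
  refine Submodule.span_induction₂ (p := fun M N _ _ => M * N ∈ relSpan G)
    (fun M N hM hN => basic_mul_basic hM hN) ?_ ?_ ?_ ?_ ?_ ?_
    (relMatrix_mem_span g) (relMatrix_mem_span h)
  · intro N _; rw [zero_mul]; exact zero_mem _
  · intro N _; rw [mul_zero]; exact zero_mem _
  · intro A B C _ _ _ h1 h2; rw [add_mul]; exact add_mem h1 h2
  · intro A B C _ _ _ h1 h2; rw [mul_add]; exact add_mem h1 h2
  · intro c A B _ _ h1; rw [Matrix.smul_mul]; exact Submodule.smul_mem _ _ h1
  · intro c A B _ _ h1; rw [Matrix.mul_smul]; exact Submodule.smul_mem _ _ h1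

end CayleyTriple

/-- The association scheme of class four induced from the Cayley table of a finite group with at
least three elements. -/
def cayleyScheme (G : Type*) [Group G] [Fintype G] [DecidableEq G] (hn : 3 ≤ Fintype.card G) :
    AssociationScheme (CayleyTriple G) 4 where
  R := CayleyTriple.rel G
  rel_nonempty := CayleyTriple.rel_nonempty hn
  rel_existsUnique := CayleyTriple.rel_existsUnique
  rel_zero _ _ := Iff.rfl
  exists_converse i := ⟨i, CayleyTriple.rel_symm i⟩
  regular g h i x y x' y' hxy hxy' := by
    have := CayleyTriple.relMatrix_mul_mem g h i x y x' y' hxy hxy'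
    rw [CayleyTriple.relMatrix_mul_apply, CayleyTriple.relMatrix_mul_apply] at this
    exact_mod_cast this

/-- The full algebra of `m × m` matrices over `F`. -/
abbrev FullMatrix (m : ℕ) (F : Type*) : Type _ := Matrix (Fin m) (Fin m) F

/-! Seen from the base point, a point of `X` is given by its three relative coordinates `rd x i y`,
any two of which multiply to the third. Put `H = G \ {1}`. The fibres 1, 2, 3 are copies of `H`, and
the fibre 4 maps to `H` through each of the three coordinates; this makes six copies of `H`. Let `L`
hold the indicators of the fibres, `Q` the incidences of points with the six copies, and `E` the
projection onto the fibre 4. The Terwilliger algebra is exactly the set of matrices `L α Lᵀ + Q (β ⊗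
1) Qᵀ + γ E` with `α` of size 5, `β` of size 6 and `γ` a scalar (`mem_terwilliger_iff`). The
products among `L`, `Q`, `E` depend only on the image `ν` of `n` in `F`, so matrices multiply by a
twisted product of coefficient triples (`Frame.mat_mul_mat`).

Three things can be read off a triple. The scalar `γ` is multiplicative. Up to terms in `γ`, the
`β`-parts multiply as `β g β'` with `g = gram ν`; for a full rank factorization `g = U V`, the map
`V β U + γ · proj` is multiplicative, with values in matrices of size `rank g`. Finally the algebra
acts on the span of the fibre indicators, and this action can be compressed to the fibres of nonzero
valency. Together these form a surjection `Splitting.hom` onto a product of three matrix algebras.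
The valencies are `1`, `ν - 1` (three times) and `(ν - 1)(ν - 2)`, while `g` is `1` plus a block of
determinant `(ν - 1)² (ν - 4)`, of rank 1 at `ν = 1` and of rank 2 at `ν = 4` if `3 ≠ 0`. This gives
the sizes of the factors. In characteristic 2 the order `n` is even, so `ν = 2 = 4` and both
degenerations occur at once.

The kernel consists of nilpotent elements (`Frame.isNilpotent_mat`), so it is the radical. The
triple of a matrix need not be unique, hence `Splitting.hom_eq_zero_of_mat_eq_zero` is needed for
the map to descend to matrices. The radical is made explicit by solving `g β g = 0`
(`Frame.kerImage_eq_spanOne`, `Frame.kerImage_eq_spanFour`, `Frame.kerImage_eq_of_regular`) and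
translating the result into the listed generators. -/

/-- A surjective homomorphism onto a semisimple ring whose kernel consists of nilpotent elements
has the Jacobson radical as its kernel. -/
theorem Ring.jacobson_eq_ker_of_isNilpotent {A S : Type*} [Ring A] [Ring S] [IsSemisimpleRing S]
    (f : A →+* S) (hf : Function.Surjective f) (hker : ∀ a, f a = 0 → IsNilpotent a) :
    Ring.jacobson A = RingHom.ker f := by
  have : RingHomSurjective f := ⟨hf⟩
  refine le_antisymm ?_ fun a ha => ?_
  · have h := Ring.le_comap_jacobson f
    rwa [IsSemisimpleRing.jacobson_eq_bot S] at h
  · rw [← Ideal.jacobson_bot, Ideal.mem_jacobson_iff]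
    intro y
    have hy : f (y * a) = 0 := by rw [map_mul, (RingHom.mem_ker).1 ha, mul_zero]
    -- The product `y * a` lies in the kernel, so it is nilpotent and `1 + y * a` is a unit; its
    -- inverse is the left quasi-inverse.
    obtain ⟨z, hz⟩ := (hker _ hy).isUnit_one_add
    refine ⟨(z⁻¹ : Aˣ), ?_⟩
    have : (↑z⁻¹ : A) * y * a + ↑z⁻¹ = ↑z⁻¹ * (z : A) := by rw [hz]; noncomm_ring
    rw [this]
    simp

section

open Matrix Kronecker

/-! ### Coefficient triples and the matrices they represent -/

namespace CayleyTriple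

/-- Indices of the copies of `G \ {1}`: `inl i` stands for the fibre of index `i + 1`, and `inr i`
for the fibre of index `4` seen through the coordinate `i`. -/
abbrev Idx : Type := Fin 3 ⊕ Fin 3

/-- The fibre in which the copy `s` lives. -/
def fib : Idx → Fin 5 := Sum.elim ![1, 2, 3] fun _ => 4

section Constants

variable {F : Type*} [Field F]

/-- The valencies. -/
def val (ν : F) : Fin 5 → F := ![1, ν - 1, ν - 1, ν - 1, (ν - 1) * (ν - 2)]

/-- The number of points of a fibre over a given point of the copy `s`. -/
def mult (ν : F) : Idx → F := Sum.elim (fun _ => 1) fun _ => ν - 2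

/-- The incidence of fibres and copies. -/
def fibMat (F : Type*) [Field F] : Matrix (Fin 5) Idx F := of fun a s => if a = fib s then 1 else 0

/-- The incidence of copies and fibres, weighted by multiplicities. -/
def multMat (ν : F) : Matrix Idx (Fin 5) F := of fun s a => if a = fib s then mult ν s else 0

/-- The all-one matrix of size three. -/
def ones (F : Type*) [Field F] : Matrix (Fin 3) (Fin 3) F := of fun _ _ => 1

/-- The diagonal part of the Gram matrix of the copies. -/
def gram (ν : F) : Matrix Idx Idx F := fromBlocks 1 0 0 ((ν - 1) • 1 - (ones F))

/-- The constant part of the Gram matrix of the copies. -/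
def gramConst (F : Type*) [Field F] : Matrix Idx Idx F := fromBlocks 0 0 0 ((ones F) - 1)

/-- The projection onto the copies inside the last fibre. -/
def lastIdx (F : Type*) [Field F] : Matrix Idx Idx F := fromBlocks 0 0 0 1

/-- The projection onto the last fibre. -/
def lastFib (F : Type*) [Field F] : Matrix (Fin 5) (Fin 5) F := single 4 4 1

/-- The coefficients `(α, β, γ)` of an element of the Terwilliger algebra. -/
abbrev Coef (F : Type*) : Type _ := Matrix (Fin 5) (Fin 5) F × Matrix Idx Idx F × F

/-- The product of coefficients. -/
def Coef.mul (ν : F) (t t' : Coef F) : Coef F :=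
  (t.1 * diagonal (val ν) * t'.1 + t.1 * (multMat ν)ᵀ * t'.2.1 * (fibMat F)ᵀ
      + (fibMat F) * t.2.1 * multMat ν * t'.1 + (fibMat F) * t.2.1 * (gramConst F) * t'.2.1 * (fibMat F)ᵀ
      + t.2.2 • ((lastFib F) * t'.1) + t'.2.2 • (t.1 * (lastFib F)),
    t.2.1 * gram ν * t'.2.1 + t.2.2 • ((lastIdx F) * t'.2.1) + t'.2.2 • (t.2.1 * (lastIdx F)),
    t.2.2 * t'.2.2)

/-- The action of coefficients on the indicators of the fibres. -/
def Coef.act (ν : F) (t : Coef F) : Matrix (Fin 5) (Fin 5) F :=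
  t.1 * diagonal (val ν) + (fibMat F) * t.2.1 * multMat ν + t.2.2 • (lastFib F)

end Constants

/-- The indicators `L` of the fibres, the incidences `Q` of the points with the copies of
`G \ {1}` and the projection `E` onto the last fibre, with the relations that govern their
products. -/
structure Frame (F : Type*) [Field F] (X H : Type*) [Fintype X] [DecidableEq X] [Fintype H]
    [DecidableEq H] (ν : F) where
  L : Matrix X (Fin 5) F
  Q : Matrix X (Idx × H) F
  E : Matrix X X F
  E_transpose : Eᵀ = E
  E_mul_E : E * E = E
  E_mul_L : E * L = L * (lastFib F)
  E_mul_Q : E * Q = Q * ((lastIdx F) ⊗ₖ (1 : Matrix H H F))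
  L_gram : Lᵀ * L = diagonal (val ν)
  L_mul_Q : Lᵀ * Q = of fun a s => multMat ν s.1 a
  Q_gram : Qᵀ * Q = of fun s t => gram ν s.1 t.1 * (if s.2 = t.2 then 1 else 0)
    + (gramConst F) s.1 t.1
  Q_sum : ∀ y s, ∑ h, Q y (s, h) = L y (fib s)
  L_surj : ∀ a, ∃ y, ∀ b, L y b = if a = b then 1 else 0
  pair : ∃ h h' : H, h ≠ h'
  exists_alternating : ∃ w : X → F, w ≠ 0 ∧ Lᵀ *ᵥ w = 0 ∧ Qᵀ *ᵥ w = 0 ∧ E *ᵥ w = w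

namespace Frame

variable {F : Type*} [Field F] {X H : Type*} [Fintype X] [DecidableEq X] [Fintype H]
    [DecidableEq H] {ν : F} (S : Frame F X H ν)

/-- Summation over the points of a copy. -/
def W (F H : Type*) [Field F] : Matrix (Idx × H) Idx F := of fun s t => if s.1 = t then 1 else 0

theorem kron_mul_W (β : Matrix Idx Idx F) : (β ⊗ₖ (1 : Matrix H H F)) * W F H = W F H * β := by
  ext ⟨s, h⟩ t
  simp [W, Matrix.mul_apply, Fintype.sum_prod_type, Matrix.one_apply]

theorem W_transpose_mul_kron (β : Matrix Idx Idx F) :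
    (W F H)ᵀ * (β ⊗ₖ (1 : Matrix H H F)) = β * (W F H)ᵀ := by
  ext s ⟨t, h⟩
  simp [W, Matrix.mul_apply, Fintype.sum_prod_type, Matrix.one_apply]

theorem kron_mul_kron (β β' : Matrix Idx Idx F) :
    (β ⊗ₖ (1 : Matrix H H F)) * (β' ⊗ₖ (1 : Matrix H H F)) = (β * β') ⊗ₖ (1 : Matrix H H F) := by
  rw [← Matrix.mul_kronecker_mul, one_mul]

theorem Q_mul_W : S.Q * W F H = S.L * (fibMat F) := by
  ext y s
  have h1 : (S.L * fibMat F) y s = S.L y (fib s) := by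
    simp [Matrix.mul_apply, fibMat]
  have h2 : (S.Q * W F H) y s = ∑ h, S.Q y (s, h) := by
    simp only [Matrix.mul_apply, W, Fintype.sum_prod_type, of_apply]
    rw [Finset.sum_comm]
    simp
  rw [h1, h2, S.Q_sum]

theorem W_transpose_mul_Q : (W F H)ᵀ * S.Qᵀ = (fibMat F)ᵀ * S.Lᵀ := by
  rw [← transpose_mul, ← transpose_mul, Q_mul_W]

theorem L_transpose_mul_Q : S.Lᵀ * S.Q = (multMat ν)ᵀ * (W F H)ᵀ := by
  rw [S.L_mul_Q]
  ext a s
  simp [Matrix.mul_apply, W]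

theorem Q_transpose_mul_L : S.Qᵀ * S.L = W F H * multMat ν := by
  rw [← transpose_inj]
  simpa using S.L_transpose_mul_Q

/-- Splits the Gram matrix into a part that compares points of `H` and a part that factors through
summation over the copies. Only the first part survives in the middle factor of the quotient. -/
theorem Q_transpose_mul_Q :
    S.Qᵀ * S.Q = gram ν ⊗ₖ (1 : Matrix H H F) + W F H * (gramConst F) * (W F H)ᵀ := by
  rw [S.Q_gram]
  ext s t
  simp [Matrix.mul_apply, W, Matrix.one_apply]

theorem Q_transpose_mul_E : S.Qᵀ * S.E = ((lastIdx F) ⊗ₖ (1 : Matrix H H F)) * S.Qᵀ := by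
  have := congrArg transpose S.E_mul_Q
  rw [transpose_mul, S.E_transpose, transpose_mul, ← kroneckerMap_transpose, transpose_one]
    at this
  simpa [lastIdx, fromBlocks_transpose] using this

theorem L_transpose_mul_E : S.Lᵀ * S.E = (lastFib F) * S.Lᵀ := by
  have := congrArg transpose S.E_mul_L
  rw [transpose_mul, S.E_transpose, transpose_mul] at this
  simpa [lastFib] using this

/-- The matrix with given coefficients. -/
def mat : Coef F →ₗ[F] Matrix X X F where
  toFun t := S.L * t.1 * S.Lᵀ + S.Q * (t.2.1 ⊗ₖ (1 : Matrix H H F)) * S.Qᵀ + t.2.2 • S.E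
  map_add' t t' := by
    simp only [Prod.fst_add, Prod.snd_add, Matrix.mul_add, Matrix.add_mul, add_kronecker, add_smul]
    abel
  map_smul' c t := by
    simp only [Prod.smul_fst, Prod.smul_snd, smul_kronecker, Matrix.mul_smul, Matrix.smul_mul,
      RingHom.id_apply, smul_add, smul_smul, smul_eq_mul]

theorem mat_apply (t : Coef F) :
    S.mat t = S.L * t.1 * S.Lᵀ + S.Q * (t.2.1 ⊗ₖ (1 : Matrix H H F)) * S.Qᵀ + t.2.2 • S.E := rfl

/-- The span of the fibre indicators is invariant under the algebra, and `Coef.act` is the matrix of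
the action on it. -/
theorem mat_mul_L (t : Coef F) : S.mat t * S.L = S.L * t.act ν := by
  simp only [mat_apply, Coef.act, Matrix.add_mul, Matrix.mul_add, Matrix.mul_assoc, S.L_gram,
    S.Q_transpose_mul_L, Matrix.smul_mul, Matrix.mul_smul, S.E_mul_L]
  rw [← Matrix.mul_assoc (t.2.1 ⊗ₖ 1), kron_mul_W, Matrix.mul_assoc, ← Matrix.mul_assoc S.Q,
    S.Q_mul_W]
  simp only [Matrix.mul_assoc]

/-- Modulo the fibre indicators, the columns of `Q` are permuted linearly among copies, uniformly in
`H`; the correction term is constant on copies. -/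
theorem mat_mul_Q (t : Coef F) : S.mat t * S.Q =
    S.Q * ((t.2.1 * gram ν + t.2.2 • (lastIdx F)) ⊗ₖ (1 : Matrix H H F)) +
      S.L * (t.1 * (multMat ν)ᵀ + (fibMat F) * t.2.1 * (gramConst F)) * (W F H)ᵀ := by
  simp only [mat_apply, Matrix.add_mul, Matrix.mul_add, Matrix.mul_assoc, S.Q_transpose_mul_Q,
    S.L_transpose_mul_Q, Matrix.smul_mul, Matrix.mul_smul, S.E_mul_Q, add_kronecker,
    smul_kronecker, kron_mul_kron]
  rw [← Matrix.mul_assoc (t.2.1 ⊗ₖ 1), kron_mul_W, Matrix.mul_assoc, ← Matrix.mul_assoc S.Q,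
    S.Q_mul_W]
  simp only [Matrix.mul_assoc]
  abel

theorem mat_mul_E (t : Coef F) : S.mat t * S.E =
    S.L * (t.1 * (lastFib F)) * S.Lᵀ + S.Q * ((t.2.1 * (lastIdx F)) ⊗ₖ (1 : Matrix H H F)) * S.Qᵀ
      + t.2.2 • S.E := by
  simp only [mat_apply, Matrix.add_mul, Matrix.mul_assoc, S.Q_transpose_mul_E,
    S.L_transpose_mul_E, Matrix.smul_mul, S.E_mul_E, ← kron_mul_kron]

theorem mat_mul_mat (t t' : Coef F) : S.mat t * S.mat t' = S.mat (t.mul ν t') := by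
  rw [S.mat_apply t']
  simp only [Matrix.mul_add, ← Matrix.mul_assoc, S.mat_mul_L, S.mat_mul_Q, Matrix.mul_smul,
    S.mat_mul_E]
  simp only [mat_apply, Coef.mul, Coef.act]
  simp only [Matrix.add_mul, Matrix.mul_add, Matrix.mul_assoc, add_kronecker, smul_kronecker,
    Matrix.smul_mul, Matrix.mul_smul, ← kron_mul_kron, smul_add, smul_smul]
  rw [← Matrix.mul_assoc (W F H)ᵀ, W_transpose_mul_kron, Matrix.mul_assoc, S.W_transpose_mul_Q]
  simp only [mul_comm t'.2.2]
  abel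

theorem L_mul_injective {m : Type*} {A B : Matrix (Fin 5) m F} (h : S.L * A = S.L * B) :
    A = B := by
  ext a j
  obtain ⟨y, hy⟩ := S.L_surj a
  have := congrFun (congrFun h y) j
  simpa [Matrix.mul_apply, hy] using this

/-- Both sides describe the action of the same product of matrices on the columns of `L`, which are
independent because no fibre is empty. -/
theorem act_mul (S : Frame F X H ν) (t t' : Coef F) : (t.mul ν t').act ν = t.act ν * t'.act ν := by
  apply S.L_mul_injective
  rw [← mat_mul_L, ← mat_mul_mat, Matrix.mul_assoc, mat_mul_L, ← Matrix.mul_assoc, mat_mul_L,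
    Matrix.mul_assoc]

theorem act_eq_zero {t : Coef F} (h : S.mat t = 0) : t.act ν = 0 := by
  apply S.L_mul_injective
  rw [← mat_mul_L, h, Matrix.zero_mul, Matrix.mul_zero]

/-- The alternating vector is killed by `Lᵀ` and `Qᵀ` and fixed by `E`, so it is an eigenvector with
eigenvalue the scalar coefficient. -/
theorem scalar_eq_zero {t : Coef F} (h : S.mat t = 0) : t.2.2 = 0 := by
  obtain ⟨w, hw, hL, hQ, hE⟩ := S.exists_alternating
  have h1 : S.mat t *ᵥ w = t.2.2 • w := by
    simp only [mat_apply, add_mulVec, ← mulVec_mulVec, hL, hQ, smul_mulVec, hE, mulVec_zero,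
      zero_add]
  rw [h, zero_mulVec] at h1
  exact (smul_eq_zero.1 h1.symm).resolve_right hw

/-- Multiply by `Qᵀ` on the left and by `Q` on the right, and discard everything that is constant
over pairs of points of `H`. -/
theorem gram_mul_eq_zero {t : Coef F} (h : S.mat t = 0) :
    gram ν * (t.2.1 * gram ν + t.2.2 • (lastIdx F)) = 0 := by
  have h1 := S.mat_mul_Q t
  rw [h, Matrix.zero_mul] at h1
  generalize t.2.1 * gram ν + t.2.2 • lastIdx F = B at h1 ⊢
  generalize t.1 * (multMat ν)ᵀ + fibMat F * t.2.1 * gramConst F = C at h1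
  have h2 : (gram ν * B) ⊗ₖ (1 : Matrix H H F)
      + W F H * (gramConst F * B + multMat ν * C) * (W F H)ᵀ = 0 := by
    rw [← Matrix.mul_zero S.Qᵀ, h1]
    simp only [Matrix.mul_add, ← Matrix.mul_assoc, S.Q_transpose_mul_Q, S.Q_transpose_mul_L,
      Matrix.add_mul, kron_mul_kron]
    simp only [Matrix.mul_assoc, W_transpose_mul_kron]
    abel
  generalize gramConst F * B + multMat ν * C = A at h2
  -- The `W`-term has the same value at every pair in `H × H`, while the Kronecker term lives on
  -- equal pairs. Subtracting an entry at `(p, q)` from one at `(p, p)` isolates the latter.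
  obtain ⟨p, q, hpq⟩ := S.pair
  ext s u
  have e1 := congrFun (congrFun h2 (s, p)) (u, p)
  have e2 := congrFun (congrFun h2 (s, p)) (u, q)
  simp only [Matrix.add_apply, kroneckerMap_apply, Matrix.one_apply_eq, Matrix.one_apply_ne hpq,
    mul_one, mul_zero, Matrix.zero_apply] at e1 e2
  have key : ∀ i j : H, (W F H * A * (W F H)ᵀ) (s, i) (u, j) = A s u := by
    intro i j
    simp [Matrix.mul_apply, W]
  rw [key] at e1 e2
  rw [Matrix.zero_apply]
  linear_combination e1 - e2

end Frame
-- The semisimple quotient attached to a factorization of the Gram matrix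
/-- A full rank factorization `u * v` of the Gram matrix of the coordinates of the last fibre,
together with an enumeration of the fibres of nonzero valency. -/
structure Splitting (F : Type*) [Field F] (ν : F) (σ ρ : Type*) [Fintype σ] [DecidableEq σ]
    [Fintype ρ] [DecidableEq ρ] where
  u : Matrix (Fin 3) ρ F
  v : Matrix ρ (Fin 3) F
  u' : Matrix ρ (Fin 3) F
  v' : Matrix (Fin 3) ρ F
  u'_mul_u : u' * u = 1
  v_mul_v' : v * v' = 1
  u_mul_v : u * v = (ν - 1) • 1 - ones F
  ι : σ → Fin 5
  ι_inj : Function.Injective ι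
  val_ne : ∀ i, val ν (ι i) ≠ 0
  val_eq : ∀ a, (∀ i, ι i ≠ a) → val ν a = 0
  mult_eq : ∀ i s t, fib s = ι i → (∀ j, ι j ≠ fib t) → mult ν t = 0

namespace Splitting

variable {F : Type*} [Field F] {ν : F} {σ ρ : Type*} [Fintype σ] [DecidableEq σ]
    [Fintype ρ] [DecidableEq ρ] (P : Splitting F ν σ ρ)

/-- The left factor of the Gram matrix of the copies. -/
def U : Matrix Idx (Fin 3 ⊕ ρ) F := fromBlocks 1 0 0 P.u

/-- The right factor of the Gram matrix of the copies. -/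
def V : Matrix (Fin 3 ⊕ ρ) Idx F := fromBlocks 1 0 0 P.v

/-- A left inverse of the left factor. -/
def U' : Matrix (Fin 3 ⊕ ρ) Idx F := fromBlocks 1 0 0 P.u'

/-- A right inverse of the right factor. -/
def V' : Matrix Idx (Fin 3 ⊕ ρ) F := fromBlocks 1 0 0 P.v'

/-- The projection onto the summand from the last fibre. -/
def proj (F ρ : Type*) [Field F] [DecidableEq ρ] : Matrix (Fin 3 ⊕ ρ) (Fin 3 ⊕ ρ) F :=
  fromBlocks 0 0 0 1

theorem U'_mul_U : P.U' * P.U = 1 := by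
  simp [U, U', fromBlocks_multiply, P.u'_mul_u]

theorem V_mul_V' : P.V * P.V' = 1 := by
  simp [V, V', fromBlocks_multiply, P.v_mul_v']

theorem U_mul_V : P.U * P.V = gram ν := by
  simp [U, V, gram, fromBlocks_multiply, P.u_mul_v]

theorem V_mul_lastIdx : P.V * lastIdx F = proj F ρ * P.V := by
  simp [V, lastIdx, proj, fromBlocks_multiply]

theorem lastIdx_mul_U : lastIdx F * P.U = P.U * proj F ρ := by
  simp [U, lastIdx, proj, fromBlocks_multiply]

theorem proj_mul_proj : proj F ρ * proj F ρ = 1 * proj F ρ := by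
  simp [proj, fromBlocks_multiply]

/-- The selection of the fibres of nonzero valency. -/
def sel : Matrix (Fin 5) σ F := of fun a i => if a = P.ι i then 1 else 0

theorem sel_transpose_mul_apply {m : Type*} (A : Matrix (Fin 5) m F) (i : σ) (j : m) :
    (P.selᵀ * A) i j = A (P.ι i) j := by
  simp [Matrix.mul_apply, sel]

theorem mul_sel_apply {m : Type*} (A : Matrix m (Fin 5) F) (i : σ) (j : m) :
    (A * P.sel) j i = A j (P.ι i) := by
  simp [Matrix.mul_apply, sel]

theorem sel_transpose_mul_sel : P.selᵀ * P.sel = 1 := by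
  ext i j
  rw [sel_transpose_mul_apply]
  simp [sel, Matrix.one_apply, P.ι_inj.eq_iff]

/-- Each summand of the action vanishes separately: by the zero valency, by `mult_eq`, and because
`lastFib` is diagonal. The action is thus block triangular with respect to the selected fibres. -/
theorem act_apply_eq_zero (t : Coef F) (i : σ) (a : Fin 5) (ha : ∀ j, P.ι j ≠ a) :
    t.act ν (P.ι i) a = 0 := by
  have h1 : (t.1 * diagonal (val ν)) (P.ι i) a = 0 := by
    rw [mul_diagonal, P.val_eq a ha, mul_zero]
  have h2 : (fibMat F * t.2.1 * multMat ν) (P.ι i) a = 0 := by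
    rw [Matrix.mul_apply]
    refine Finset.sum_eq_zero fun s _ => ?_
    rw [Matrix.mul_apply, Finset.sum_mul]
    refine Finset.sum_eq_zero fun s' _ => ?_
    simp only [fibMat, multMat, of_apply]
    split_ifs with e1 e2
    · rw [P.mult_eq i s' s e1.symm (e2 ▸ ha), mul_zero]
    all_goals simp
  have h3 : lastFib F (P.ι i) a = 0 := by
    simp only [lastFib, single_apply]
    rw [if_neg]
    rintro ⟨h, h'⟩
    exact ha i (h.symm.trans h')
  simp [Coef.act, h1, h2, h3]

/-- Block triangularity in the form that makes compression to the selected fibres multiplicative. -/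
theorem sel_mul_act_mul (t : Coef F) :
    P.selᵀ * t.act ν * (P.sel * P.selᵀ) = P.selᵀ * t.act ν := by
  ext i a
  rw [← Matrix.mul_assoc, Matrix.mul_apply]
  simp only [mul_sel_apply, transpose_apply]
  by_cases h : ∃ j, P.ι j = a
  · obtain ⟨j, rfl⟩ := h
    simp [sel, P.ι_inj.eq_iff]
  · push Not at h
    rw [sel_transpose_mul_apply, P.act_apply_eq_zero t i a h]
    refine Finset.sum_eq_zero fun j _ => ?_
    simp [sel, (h j).symm]

/-- The target of the semisimple quotient. -/
abbrev Target (F : Type*) [Field F] (σ ρ : Type*) [Fintype σ] [DecidableEq σ]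
    [Fintype ρ] [DecidableEq ρ] : Type _ :=
  Matrix σ σ F × Matrix (Fin 3 ⊕ ρ) (Fin 3 ⊕ ρ) F × Matrix (Fin 1) (Fin 1) F

/-- The map of coefficients to the semisimple quotient. -/
def hom : Coef F →ₗ[F] Target F σ ρ where
  toFun t := (P.selᵀ * t.act ν * P.sel, P.V * t.2.1 * P.U + t.2.2 • proj F ρ, of fun _ _ => t.2.2)
  map_add' t t' := by
    refine Prod.ext ?_ (Prod.ext ?_ ?_)
    · simp only [Coef.act, Prod.fst_add, Prod.snd_add, Matrix.mul_add, Matrix.add_mul, add_smul]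
      abel
    · simp only [Prod.fst_add, Prod.snd_add, Matrix.mul_add, Matrix.add_mul, add_smul]
      abel
    · ext; simp
  map_smul' c t := by
    refine Prod.ext ?_ (Prod.ext ?_ ?_)
    · simp [Coef.act, Matrix.mul_add, Matrix.add_mul, smul_smul]
    · simp [smul_smul]
    · ext; simp

theorem hom_apply (t : Coef F) : P.hom t =
    (P.selᵀ * t.act ν * P.sel, P.V * t.2.1 * P.U + t.2.2 • proj F ρ, of fun _ _ => t.2.2) := rfl

theorem hom_mul {X H : Type*} [Fintype X] [DecidableEq X] [Fintype H] [DecidableEq H]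
    (S : Frame F X H ν) (t t' : Coef F) : P.hom (t.mul ν t') = P.hom t * P.hom t' := by
  refine Prod.ext ?_ (Prod.ext ?_ ?_)
  · simp only [hom_apply, Prod.fst_mul, S.act_mul]
    have e := P.sel_mul_act_mul t
    calc P.selᵀ * (t.act ν * t'.act ν) * P.sel
        = P.selᵀ * t.act ν * (t'.act ν * P.sel) := by simp only [Matrix.mul_assoc]
      _ = P.selᵀ * t.act ν * (P.sel * P.selᵀ) * (t'.act ν * P.sel) := by rw [e]
      _ = _ := by simp only [Matrix.mul_assoc]
  · simp only [hom_apply, Prod.fst_mul, Prod.snd_mul, Coef.mul, ← P.U_mul_V]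
    have e1 : ∀ A : Matrix Idx (Fin 3 ⊕ ρ) F, P.V * (lastIdx F * A) = proj F ρ * (P.V * A) := by
      intro A
      rw [← Matrix.mul_assoc, V_mul_lastIdx, Matrix.mul_assoc]
    simp only [Matrix.mul_add, Matrix.add_mul, Matrix.mul_assoc, Matrix.mul_smul,
      Matrix.smul_mul, e1, P.lastIdx_mul_U, proj_mul_proj, Matrix.one_mul]
    rw [smul_add, smul_smul, mul_comm t'.2.2]
    abel
  · ext i j
    simp [hom_apply, Coef.mul, Matrix.mul_apply]

/-- The scalar is prescribed directly, `β` is lifted by the one-sided inverses of `U` and `V`, and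
`α` then corrects the first factor, where the selected valencies can be inverted. -/
theorem hom_surjective : Function.Surjective P.hom := by
  rintro ⟨A, B, C⟩
  set γ := C 0 0
  set β : Matrix Idx Idx F := P.V' * (B - γ • proj F ρ) * P.U'
  -- `R` is what the chosen `β` and `γ` already contribute to the first factor.
  set R := P.selᵀ * (fibMat F * β * multMat ν + γ • lastFib F) * P.sel
  set D' : Matrix σ σ F := diagonal fun i => (val ν (P.ι i))⁻¹
  refine ⟨(P.sel * (A - R) * D' * P.selᵀ, β, γ), ?_⟩
  refine Prod.ext ?_ (Prod.ext ?_ ?_)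
  · have h1 : D' * P.selᵀ * diagonal (val ν) * P.sel = 1 := by
      ext i j
      rw [mul_sel_apply, mul_diagonal, Matrix.diagonal_mul]
      simp only [sel, transpose_apply, of_apply, Matrix.one_apply, P.ι_inj.eq_iff, eq_comm (a := j)]
      split_ifs with h
      · subst h
        rw [mul_one, inv_mul_cancel₀ (P.val_ne i)]
      · simp
    have h2 : P.selᵀ * (P.sel * (A - R) * D' * P.selᵀ * diagonal (val ν)) * P.sel = A - R := by
      calc _ = (P.selᵀ * P.sel) * (A - R) * (D' * P.selᵀ * diagonal (val ν) * P.sel) := by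
            simp only [Matrix.mul_assoc]
        _ = _ := by rw [h1, sel_transpose_mul_sel, Matrix.one_mul, Matrix.mul_one]
    simp only [hom_apply, Coef.act]
    rw [add_assoc, Matrix.mul_add, Matrix.add_mul, h2, sub_add_cancel]
  · have h1 : P.V * β * P.U = B - γ • proj F ρ := by
      calc _ = (P.V * P.V') * (B - γ • proj F ρ) * (P.U' * P.U) := by
            simp only [β, Matrix.mul_assoc]
        _ = _ := by rw [V_mul_V', U'_mul_U, Matrix.one_mul, Matrix.mul_one]
    simp only [hom_apply]
    rw [h1, sub_add_cancel]
  · ext i j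
    rw [Subsingleton.elim i 0, Subsingleton.elim j 0]
    rfl

theorem eq_zero_of_U_mul_mul_V {A : Matrix (Fin 3 ⊕ ρ) (Fin 3 ⊕ ρ) F}
    (h : P.U * A * P.V = 0) : A = 0 := by
  calc A = (P.U' * P.U) * A * (P.V * P.V') := by
        rw [U'_mul_U, V_mul_V', Matrix.one_mul, Matrix.mul_one]
    _ = P.U' * (P.U * A * P.V) * P.V' := by simp only [Matrix.mul_assoc]
    _ = 0 := by rw [h, Matrix.mul_zero, Matrix.zero_mul]

/-- The kernel consists of the coefficients subject to three conditions. -/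
theorem hom_eq_zero_iff (t : Coef F) : P.hom t = 0 ↔
    t.2.2 = 0 ∧ gram ν * t.2.1 * gram ν = 0 ∧ ∀ i j, t.act ν (P.ι i) (P.ι j) = 0 := by
  have h1 : P.selᵀ * t.act ν * P.sel = 0 ↔ ∀ i j, t.act ν (P.ι i) (P.ι j) = 0 := by
    simp only [← Matrix.ext_iff, mul_sel_apply, sel_transpose_mul_apply, Matrix.zero_apply]
  have h2 : P.V * t.2.1 * P.U = 0 ↔ gram ν * t.2.1 * gram ν = 0 := by
    have : gram ν * t.2.1 * gram ν = P.U * (P.V * t.2.1 * P.U) * P.V := by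
      simp only [← P.U_mul_V, Matrix.mul_assoc]
    rw [this]
    exact ⟨fun h => by rw [h, Matrix.mul_zero, Matrix.zero_mul], P.eq_zero_of_U_mul_mul_V⟩
  have h3 : (of fun _ _ => t.2.2 : Matrix (Fin 1) (Fin 1) F) = 0 ↔ t.2.2 = 0 :=
    ⟨fun h => congrFun (congrFun h 0) 0, fun h => by ext; simp [h]⟩
  rw [hom_apply, Prod.mk_eq_zero, Prod.mk_eq_zero, h1, h3]
  constructor
  · rintro ⟨a, b, c⟩
    rw [c, zero_smul, add_zero] at b
    exact ⟨c, h2.1 b, a⟩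
  · rintro ⟨c, b, a⟩
    rw [c, zero_smul, add_zero]
    exact ⟨a, h2.2 b, rfl⟩

/-- Different triples may give the same matrix, so this is what makes `hom` a map on matrices. -/
theorem hom_eq_zero_of_mat_eq_zero {X H : Type*} [Fintype X] [DecidableEq X] [Fintype H]
    [DecidableEq H] (S : Frame F X H ν) {t : Coef F} (h : S.mat t = 0) : P.hom t = 0 := by
  have hγ := S.scalar_eq_zero h
  have hg := S.gram_mul_eq_zero h
  rw [hγ, zero_smul, add_zero, ← Matrix.mul_assoc] at hg
  rw [hom_eq_zero_iff]
  exact ⟨hγ, hg, by simp [S.act_eq_zero h]⟩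

end Splitting

/-- Cubing removes first the `β`-part and then the `α`-part, since each is sandwiched between forms
on which it vanishes. -/
theorem Frame.isNilpotent_mat {F : Type*} [Field F] {ν : F} {σ ρ : Type*} [Fintype σ]
    [DecidableEq σ] [Fintype ρ] [DecidableEq ρ] (P : Splitting F ν σ ρ)
    {X H : Type*} [Fintype X] [DecidableEq X] [Fintype H]
    [DecidableEq H] (S : Frame F X H ν) {t : Coef F} (h : P.hom t = 0) :
    IsNilpotent (S.mat t) := by
  have cube : ∀ t : Coef F, P.hom t = 0 → ∃ t' : Coef F, P.hom t' = 0 ∧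
      S.mat t ^ 3 = S.mat t' ∧ t' = (t.mul ν t).mul ν t := fun t ht =>
    ⟨(t.mul ν t).mul ν t, by rw [P.hom_mul S, ht, mul_zero],
      by rw [pow_succ, pow_two, S.mat_mul_mat, S.mat_mul_mat], rfl⟩
  obtain ⟨s, hs, hts, es⟩ := cube t h
  obtain ⟨r, hr, hsr, er⟩ := cube s hs
  have ht := (P.hom_eq_zero_iff t).1 h
  have hγ : s.2.2 = 0 := ((P.hom_eq_zero_iff s).1 hs).1
  -- With `γ = 0`, the `β`-part of the cube is `β g β g β`, which contains `g β g = 0`.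
  have hβ : s.2.1 = 0 := by
    simp only [es, Coef.mul, ht.1, zero_mul, zero_smul, add_zero]
    calc _ = t.2.1 * (gram ν * t.2.1 * gram ν) * t.2.1 := by simp only [Matrix.mul_assoc]
      _ = 0 := by rw [ht.2.1, Matrix.mul_zero, Matrix.zero_mul]
  have hact : s.act ν = s.1 * diagonal (val ν) := by
    simp [Coef.act, hβ, hγ]
  -- Rows and columns of zero valency vanish trivially; the remaining entries are those on which the
  -- compressed action is zero.
  have hα : diagonal (val ν) * s.1 * diagonal (val ν) = 0 := by
    ext a b
    rw [Matrix.mul_assoc, Matrix.diagonal_mul, ← hact, Matrix.zero_apply]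
    by_cases ha : ∃ i, P.ι i = a
    · obtain ⟨i, rfl⟩ := ha
      by_cases hb : ∃ j, P.ι j = b
      · obtain ⟨j, rfl⟩ := hb
        rw [((P.hom_eq_zero_iff s).1 hs).2.2, mul_zero]
      · push Not at hb
        rw [P.act_apply_eq_zero s i b hb, mul_zero]
    · push Not at ha
      rw [P.val_eq a ha, zero_mul]
  refine ⟨9, ?_⟩
  rw [show 9 = 3 * 3 from rfl, pow_mul, hts, hsr, er]
  have h0 : (s.mul ν s).mul ν s = 0 := by
    refine Prod.ext ?_ (Prod.ext ?_ ?_)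
    · simp only [Coef.mul, hβ, hγ, Matrix.mul_zero, Matrix.zero_mul, zero_smul, add_zero, mul_zero,
        Prod.fst_zero]
      calc _ = s.1 * (diagonal (val ν) * s.1 * diagonal (val ν)) * s.1 := by
            simp only [Matrix.mul_assoc]
        _ = 0 := by rw [hα, Matrix.mul_zero, Matrix.zero_mul]
    · simp [Coef.mul, hβ, hγ]
    · simp [Coef.mul, hγ]
  rw [h0, map_zero]

/-- Choosing any triple for each matrix gives a well-defined algebra map, because two choices differ
by an element that `hom` kills. Its kernel is nil and its target semisimple. -/
theorem Frame.quotient_jacobson {F : Type*} [Field F] {ν : F} {σ ρ : Type*} [Fintype σ]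
    [DecidableEq σ] [Fintype ρ] [DecidableEq ρ] (P : Splitting F ν σ ρ)
    {X H : Type*} [Fintype X] [DecidableEq X] [Fintype H]
    [DecidableEq H] (S : Frame F X H ν) (T : Subalgebra F (Matrix X X F))
    (hT : ∀ M, M ∈ T ↔ ∃ t, S.mat t = M) :
    Nonempty ((T ⧸ Ring.jacobson T) ≃ₐ[F] Splitting.Target F σ ρ) ∧
      ((Ring.jacobson T).restrictScalars F).map T.val.toLinearMap =
        (LinearMap.ker P.hom).map S.mat := by
  choose c hc using fun M : T => (hT M.1).1 M.2
  have key : ∀ t t', S.mat t = S.mat t' → P.hom t = P.hom t' := by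
    intro t t' h
    rw [← sub_eq_zero, ← map_sub]
    exact P.hom_eq_zero_of_mat_eq_zero S (by rw [map_sub, h, sub_self])
  let f₀ : T →ₗ[F] Splitting.Target F σ ρ :=
    { toFun M := P.hom (c M)
      map_add' M N := by
        rw [← map_add]
        exact key _ _ (by rw [map_add, hc, hc, hc]; rfl)
      map_smul' a M := by
        rw [RingHom.id_apply, ← map_smul]
        exact key _ _ (by rw [map_smul, hc, hc]; rfl) }
  have hf₀ : ∀ t (M : T), S.mat t = M → f₀ M = P.hom t := fun t M h =>
    key _ _ (by rw [hc, h])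
  have hmul : ∀ M N, f₀ (M * N) = f₀ M * f₀ N := by
    intro M N
    rw [hf₀ _ M (hc M), hf₀ _ N (hc N), ← P.hom_mul S]
    exact hf₀ _ _ (by rw [← S.mat_mul_mat, hc, hc]; rfl)
  have hsurj : Function.Surjective f₀ := by
    intro A
    obtain ⟨t, rfl⟩ := P.hom_surjective A
    exact ⟨⟨S.mat t, (hT _).2 ⟨t, rfl⟩⟩, hf₀ _ _ rfl⟩
  -- No triple for the identity is needed: a preimage `M` of `1` gives `1 = f₀ (M * 1) = f₀ 1`.
  have hone : f₀ 1 = 1 := by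
    obtain ⟨M, hM⟩ := hsurj 1
    have := hmul M 1
    rw [mul_one, hM, one_mul] at this
    exact this.symm
  let f : T →ₐ[F] Splitting.Target F σ ρ := AlgHom.ofLinearMap f₀ hone hmul
  have hker : Ring.jacobson T = RingHom.ker f := by
    refine Ring.jacobson_eq_ker_of_isNilpotent f.toRingHom hsurj fun M hM => ?_
    obtain ⟨n, hn⟩ := Frame.isNilpotent_mat P S (t := c M) hM
    refine ⟨n, Subtype.ext ?_⟩
    rw [SubmonoidClass.coe_pow, ← hc, hn]
    rfl
  refine ⟨⟨(Ideal.quotientEquivAlgOfEq F hker).trans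
    (Ideal.quotientKerAlgEquivOfSurjective (f := f) hsurj)⟩, ?_⟩
  ext M
  simp only [Submodule.mem_map, Submodule.restrictScalars_mem, hker, RingHom.mem_ker,
    LinearMap.mem_ker]
  constructor
  · rintro ⟨N, hN, rfl⟩
    exact ⟨c N, hN, hc N⟩
  · rintro ⟨t, ht, rfl⟩
    exact ⟨⟨S.mat t, (hT _).2 ⟨t, rfl⟩⟩, (hf₀ _ _ rfl).trans ht, rfl⟩

/-! ### Coordinates relative to the base point -/

section Coordinates

variable {G : Type*} [Group G]

/-- The coordinates of `y` relative to the base point `x`. -/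
def rd (x : CayleyTriple G) (i : Fin 3) (y : CayleyTriple G) : G := coord i x * coord i y

theorem commute_of_sq (hG : ∀ g : G, g * g = 1) (a b : G) : a * b = b * a := by
  have h : ∀ g : G, g⁻¹ = g := fun g => inv_eq_of_mul_eq_one_right (hG g)
  rw [← h (a * b), _root_.mul_inv_rev, h, h]

theorem mul_eq_one_iff_of_sq (hG : ∀ g : G, g * g = 1) (a b : G) : a * b = 1 ↔ a = b := by
  rw [mul_eq_one_iff_eq_inv, inv_eq_of_mul_eq_one_right (hG b)]

theorem rd_eq_one (hG : ∀ g : G, g * g = 1) (x y : CayleyTriple G) (i : Fin 3) :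
    rd x i y = 1 ↔ coord i x = coord i y :=
  mul_eq_one_iff_of_sq hG _ _

/-- With exponent two, `x₁ x₂ = x₃` becomes symmetric in the three coordinates, so later arguments
need not distinguish between them. -/
theorem coord_mul_coord (hG : ∀ g : G, g * g = 1) (y : CayleyTriple G) {i j k : Fin 3}
    (hij : i ≠ j) (hik : i ≠ k) (hjk : j ≠ k) : coord i y * coord j y = coord k y := by
  have h := y.2
  have hc := commute_of_sq hG
  have e : ∀ a b : G, a * (a * b) = b := fun a b => by rw [← mul_assoc, hG, one_mul]
  have e' : ∀ a b : G, a * (b * a) = b := fun a b => by rw [hc b, e]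
  fin_cases i <;> fin_cases j <;> fin_cases k <;>
    first
    | exact absurd rfl hij
    | exact absurd rfl hik
    | exact absurd rfl hjk
    | exact h
    | simp only [coord, ← h]
      first
      | exact hc _ _
      | exact e _ _
      | exact e' _ _
      | exact (hc _ _).trans (e _ _)
      | exact (hc _ _).trans (e' _ _)

theorem rd_mul_rd (hG : ∀ g : G, g * g = 1) (x y : CayleyTriple G) {i j k : Fin 3}
    (hij : i ≠ j) (hik : i ≠ k) (hjk : j ≠ k) : rd x i y * rd x j y = rd x k y := by
  rw [rd, rd, rd, ← coord_mul_coord hG x hij hik hjk, ← coord_mul_coord hG y hij hik hjk,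
    mul_assoc, mul_assoc, ← mul_assoc (coord i y), commute_of_sq hG (coord i y), mul_assoc]

theorem ne_add_one (i : Fin 3) : i ≠ i + 1 := by revert i; decide

theorem exists_third {i j : Fin 3} (hij : i ≠ j) : ∃ k : Fin 3, i ≠ k ∧ j ≠ k := by
  revert i j
  decide

theorem existsUnique_rd {x : CayleyTriple G} {i j : Fin 3} (hij : i ≠ j) (u v : G) :
    ∃! y : CayleyTriple G, rd x i y = u ∧ rd x j y = v := by
  have := existsUnique_coord hij ((coord i x)⁻¹ * u) ((coord j x)⁻¹ * v)
  simpa only [rd, eq_inv_mul_iff_mul_eq] using this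

/-- Two relative coordinates parametrize all points freely by `G × G`, so every count reduces to a
double sum over the group. -/
theorem sum_rd [Fintype G] [DecidableEq G] {F : Type*} [AddCommMonoid F] (x : CayleyTriple G)
    {i j : Fin 3} (hij : i ≠ j) (f : G → G → F) :
    ∑ y, f (rd x i y) (rd x j y) = ∑ u, ∑ v, f u v := by
  rw [← Fintype.sum_prod_type']
  refine Fintype.sum_bijective (fun y => (rd x i y, rd x j y)) ?_ _ _ fun y => rfl
  refine (Function.bijective_iff_existsUnique _).2 fun p => ?_
  simpa only [Prod.ext_iff] using existsUnique_rd hij p.1 p.2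

theorem rel_zero_iff (hG : ∀ g : G, g * g = 1) (x y : CayleyTriple G) {i j : Fin 3}
    (hij : i ≠ j) : rel G 0 x y ↔ rd x i y = 1 ∧ rd x j y = 1 := by
  rw [rd_eq_one hG, rd_eq_one hG]
  exact ⟨fun h => by rw [show x = y from h]; exact ⟨rfl, rfl⟩, fun h => eq_of_coord hij h.1 h.2⟩

theorem rel_succ_iff (hG : ∀ g : G, g * g = 1) (x y : CayleyTriple G) {i j : Fin 3}
    (hij : i ≠ j) : rel G (fib (.inl i)) x y ↔ rd x i y = 1 ∧ rd x j y ≠ 1 := by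
  have h1 : rel G (fib (.inl i)) x y ↔ coord i x = coord i y ∧ x ≠ y := by
    fin_cases i <;> rfl
  rw [h1, rd_eq_one hG, ne_eq (rd x j y), rd_eq_one hG]
  constructor
  · rintro ⟨h, h'⟩
    exact ⟨h, fun h'' => h' (eq_of_coord hij h h'')⟩
  · rintro ⟨h, h'⟩
    exact ⟨h, fun h'' => h' (by rw [h''])⟩

theorem rel_four_iff (hG : ∀ g : G, g * g = 1) (x y : CayleyTriple G) {i j : Fin 3}
    (hij : i ≠ j) : rel G 4 x y ↔ rd x i y ≠ 1 ∧ rd x j y ≠ 1 ∧ rd x i y ≠ rd x j y := by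
  have h1 : rel G 4 x y ↔ ∀ k, rd x k y ≠ 1 := by
    simp only [ne_eq, rd_eq_one hG]
    rw [Fin.forall_fin_succ, Fin.forall_fin_two]
    simp only [rel, coord]
    have : x = y → x.1.1 = y.1.1 ∧ x.1.2.1 = y.1.2.1 ∧ x.1.2.2 = y.1.2.2 := by
      rintro rfl
      exact ⟨rfl, rfl, rfl⟩
    tauto
  obtain ⟨k, hik, hjk⟩ := exists_third hij
  rw [h1, ne_eq (rd x i y) (rd x j y), ← mul_eq_one_iff_of_sq hG, rd_mul_rd hG x y hij hik hjk]
  constructor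
  · intro h
    exact ⟨h i, h j, h k⟩
  · rintro ⟨a, b, c⟩ l
    have : ∀ i j k l : Fin 3, i ≠ j → i ≠ k → j ≠ k → l = i ∨ l = j ∨ l = k := by decide
    rcases this i j k l hij hik hjk with rfl | rfl | rfl
    exacts [a, b, c]

end Coordinates

/-! ### Incidence matrices of the Cayley scheme and their Gram matrices -/

section FrameOf

variable {G : Type*} [Group G]

/-- The coordinate used for the copy `s`. -/
def copyCoord : Idx → Fin 3 := Sum.elim (fun i => i + 1) fun i => i

open Classical in
/-- The indicators of the fibres. -/
noncomputable def fibreMatrix (F : Type*) [Field F] (x : CayleyTriple G) : Matrix (CayleyTriple G) (Fin 5) F :=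
  of fun y a => if rel G a x y then 1 else 0

open Classical in
/-- The incidences of points and copies of `G \ {1}`. -/
noncomputable def copyMatrix (F : Type*) [Field F] (x : CayleyTriple G) :
    Matrix (CayleyTriple G) (Idx × {g : G // g ≠ 1}) F :=
  of fun y s => if rel G (fib s.1) x y ∧ rd x (copyCoord s.1) y = s.2 then 1 else 0

variable {F : Type*} [Field F] (x : CayleyTriple G)

theorem fibreMatrix_mul_of_ne {a b : Fin 5} (hab : a ≠ b) (y : CayleyTriple G) :
    fibreMatrix F x y a * fibreMatrix F x y b = 0 := by
  simp only [fibreMatrix, of_apply]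
  split_ifs with h h'
  · exact absurd ((rel_existsUnique x y).unique h h') hab
  all_goals simp

theorem fibreMatrix_mul_self (a : Fin 5) (y : CayleyTriple G) :
    fibreMatrix F x y a * fibreMatrix F x y a = fibreMatrix F x y a := by
  simp only [fibreMatrix, of_apply]
  split_ifs <;> simp

theorem fibreMatrix_mul_copyMatrix (y : CayleyTriple G) (a : Fin 5)
    (s : Idx × {g : G // g ≠ 1}) :
    fibreMatrix F x y a * copyMatrix F x y s = if a = fib s.1 then copyMatrix F x y s else 0 := by
  simp only [fibreMatrix, copyMatrix, of_apply]
  by_cases h : rel G (fib s.1) x y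
  · have : rel G a x y ↔ a = fib s.1 :=
      ⟨fun h' => (rel_existsUnique x y).unique h' h, fun e => e ▸ h⟩
    simp only [this]
    split_ifs <;> simp
  · simp [h]

/-- Where the `i`-th relative coordinate is `1`, the other two agree, so the coordinate fixed by
`copyCoord` may be replaced by any other one. -/
theorem copyMatrix_inl (hG : ∀ g : G, g * g = 1) (y : CayleyTriple G) {i j : Fin 3} (hij : i ≠ j)
    (h : {g : G // g ≠ 1}) [DecidableEq G] :
    copyMatrix F x y (.inl i, h) = if rd x i y = 1 ∧ rd x j y = h then 1 else 0 := by
  have h1 := ne_add_one i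
  simp only [copyMatrix, of_apply, rel_succ_iff hG x y h1, copyCoord, Sum.elim_inl]
  have h2 : rd x i y = 1 → rd x j y = rd x (i + 1) y := by
    intro h
    by_cases hj : j = i + 1
    · rw [hj]
    · rw [← rd_mul_rd hG x y hij h1 hj, h, one_mul]
  refine if_congr ?_ rfl rfl
  constructor
  · rintro ⟨⟨a, -⟩, b⟩
    exact ⟨a, (h2 a).trans b⟩
  · rintro ⟨a, b⟩
    have := (h2 a).symm.trans b
    exact ⟨⟨a, this ▸ h.2⟩, this⟩

theorem copyMatrix_inr (hG : ∀ g : G, g * g = 1) (y : CayleyTriple G) {i j : Fin 3} (hij : i ≠ j)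
    (h : {g : G // g ≠ 1}) [DecidableEq G] :
    copyMatrix F x y (.inr i, h) =
      if rd x i y = h ∧ rd x j y ≠ 1 ∧ rd x j y ≠ h then 1 else 0 := by
  have key : (rel G (fib (.inr i)) x y ∧ rd x (copyCoord (.inr i)) y = h) ↔
      rd x i y = h ∧ rd x j y ≠ 1 ∧ rd x j y ≠ h := by
    change rel G 4 x y ∧ rd x i y = h ↔ _
    rw [rel_four_iff hG x y hij]
    constructor
    · rintro ⟨⟨a, b, c⟩, d⟩
      exact ⟨d, b, d ▸ c.symm⟩
    · rintro ⟨d, b, c⟩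
      exact ⟨⟨d ▸ h.2, b, d ▸ c.symm⟩, d⟩
  simp only [copyMatrix, of_apply, key]

theorem sum_copyMatrix_row (hG : ∀ g : G, g * g = 1) [Fintype G] [DecidableEq G]
    (y : CayleyTriple G) (s : Idx) :
    ∑ h, copyMatrix F x y (s, h) = fibreMatrix F x y (fib s) := by
  simp only [copyMatrix, fibreMatrix, of_apply]
  by_cases hy : rel G (fib s) x y
  · have h1 : rd x (copyCoord s) y ≠ 1 := by
      rcases s with i | i
      · have h1 := ne_add_one i
        exact ((rel_succ_iff hG x y h1).1 hy).2
      · have h1 := ne_add_one i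
        exact ((rel_four_iff hG x y h1).1 hy).1
    simp only [hy, true_and, if_true]
    rw [Finset.sum_eq_single ⟨_, h1⟩]
    · simp
    · intro h _ hne
      rw [if_neg]
      intro e
      exact hne (Subtype.ext e.symm)
    · simp
  · simp [hy]

variable [Fintype G] [DecidableEq G]

theorem sum_indicator_ne_ne {h : G} (hh : h ≠ 1) :
    (∑ v : G, if v ≠ 1 ∧ v ≠ h then (1 : F) else 0) = Fintype.card G - 2 := by
  have h1 : ∀ v : G, (if v ≠ 1 ∧ v ≠ h then (1 : F) else 0)
      = 1 - (if v = 1 then 1 else 0) - (if v = h then 1 else 0) := by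
    intro v
    by_cases e : v = 1
    · simp [e, hh.symm]
    · by_cases e' : v = h <;> simp [e, e', hh]
  simp only [h1, Finset.sum_sub_distrib, Finset.sum_ite_eq', Finset.mem_univ, if_true,
    Finset.sum_const, Finset.card_univ, nsmul_eq_mul, mul_one]
  ring

theorem sum_copyMatrix_col (hG : ∀ g : G, g * g = 1) (s : Idx × {g : G // g ≠ 1}) :
    ∑ y, copyMatrix F x y s = mult (Fintype.card G : F) s.1 := by
  obtain ⟨i | i, h⟩ := s
  · have h1 := ne_add_one i
    simp only [copyMatrix_inl x hG _ h1]
    rw [sum_rd x h1 (fun u v => if u = 1 ∧ v = (h : G) then (1 : F) else 0)]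
    simp [ite_and, mult]
  · have h1 := ne_add_one i
    simp only [copyMatrix_inr x hG _ h1]
    rw [sum_rd x h1 (fun u v => if u = h ∧ v ≠ 1 ∧ v ≠ (h : G) then (1 : F) else 0)]
    simp only [ite_and (_ = _), Finset.sum_ite_irrel, Finset.sum_const_zero, Finset.sum_ite_eq',
      Finset.mem_univ, if_true]
    exact sum_indicator_ne_ne h.2

/-- Counting points: copies in different fibres are disjoint, and a copy of one of the fibres 1, 2,
3 has one point over each element. In the last fibre, one coordinate has `n - 2` points over each
element, while values `h`, `k` of two different coordinates determine one point, which lies in the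
fibre exactly if `h ≠ k`. The latter count, `1` minus a delta, produces `gramConst`. -/
theorem copyMatrix_gram (hG : ∀ g : G, g * g = 1) (s t : Idx × {g : G // g ≠ 1}) :
    ∑ y, copyMatrix F x y s * copyMatrix F x y t =
      gram (Fintype.card G : F) s.1 t.1 * (if s.2 = t.2 then 1 else 0) + gramConst F s.1 t.1 := by
  by_cases hst : fib s.1 = fib t.1
  · obtain ⟨i | i, h⟩ := s <;> obtain ⟨j | j, k⟩ := t
    · obtain rfl : i = j := by
        revert hst
        fin_cases i <;> fin_cases j <;> simp [fib]
      have h1 := ne_add_one i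
      simp only [copyMatrix_inl x hG _ h1]
      rw [sum_rd x h1 (fun u v => (if u = 1 ∧ v = (h : G) then (1 : F) else 0)
        * (if u = 1 ∧ v = (k : G) then (1 : F) else 0))]
      simp [ite_and, gram, gramConst, Subtype.ext_iff, eq_comm]
    · exfalso
      revert hst
      fin_cases i <;> simp [fib]
    · exfalso
      revert hst
      fin_cases j <;> simp [fib]
    · by_cases hij : i = j
      · subst hij
        have h1 := ne_add_one i
        by_cases hk : h = k
        · subst hk
          simp only [copyMatrix_inr x hG _ h1, ← ite_and, mul_ite, mul_one, mul_zero, and_self]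
          have := sum_copyMatrix_col (F := F) x hG (.inr i, h)
          simp only [copyMatrix_inr x hG _ h1] at this
          rw [this]
          simp [gram, gramConst, mult, ones]
          ring
        · have : ∀ y, copyMatrix F x y (.inr i, h) * copyMatrix F x y (.inr i, k) = 0 := by
            intro y
            simp only [copyMatrix, of_apply, ← ite_and, mul_ite, mul_one, mul_zero]
            rw [if_neg]
            rintro ⟨⟨-, a⟩, -, b⟩
            exact hk (Subtype.ext (b.symm.trans a))
          simp [this, hk, gramConst, ones]
      · simp only [copyMatrix_inr x hG _ hij, copyMatrix_inr x hG _ (Ne.symm hij)]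
        rw [sum_rd x hij (fun u v => (if u = h ∧ v ≠ 1 ∧ v ≠ (h : G) then (1 : F) else 0)
          * (if v = k ∧ u ≠ 1 ∧ u ≠ (k : G) then (1 : F) else 0))]
        rw [Finset.sum_eq_single (h : G), Finset.sum_eq_single (k : G)]
        · simp [gram, gramConst, ones, hij, h.2, k.2, Subtype.ext_iff]
          split_ifs <;> simp_all
        · intro v _ hv
          simp [hv]
        · simp
        · intro u _ hu
          simp [hu]
        · simp
  · have : ∀ y, copyMatrix F x y s * copyMatrix F x y t = 0 := by
      intro y
      have h1 := fibreMatrix_mul_copyMatrix (F := F) x y (fib s.1) s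
      have h2 := fibreMatrix_mul_copyMatrix (F := F) x y (fib s.1) t
      rw [if_pos rfl] at h1
      rw [if_neg hst] at h2
      rw [← h1, mul_assoc, mul_comm (copyMatrix F x y s), ← mul_assoc, h2, zero_mul]
    simp only [this, Finset.sum_const_zero]
    obtain ⟨i | i, h⟩ := s <;> obtain ⟨j | j, k⟩ := t
    · have hij : i ≠ j := fun e => hst (by rw [e])
      simp [gram, gramConst, hij]
    · simp [gram, gramConst]
    · simp [gram, gramConst]
    · exact absurd rfl hst

theorem fibreMatrix_gram (hG : ∀ g : G, g * g = 1) (a b : Fin 5) :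
    ∑ y, fibreMatrix F x y a * fibreMatrix F x y b =
      if a = b then val (Fintype.card G : F) a else 0 := by
  split_ifs with hab
  · subst hab
    simp only [fibreMatrix_mul_self]
    have h01 : (0 : Fin 3) ≠ 1 := by decide
    -- A fibre is the union of its parts over the `n - 1` elements of `H`, all of the same size.
    have hs : ∀ s : Idx, ∑ y, fibreMatrix F x y (fib s) =
        (Fintype.card G - 1) * mult (Fintype.card G : F) s := by
      intro s
      simp only [← sum_copyMatrix_row x hG]
      rw [Finset.sum_comm]
      simp only [sum_copyMatrix_col x hG, Finset.sum_const, Finset.card_univ, nsmul_eq_mul]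
      rw [Fintype.card_subtype_compl, Fintype.card_subtype_eq, Nat.cast_sub Fintype.card_pos,
        Nat.cast_one]
    have h0 : ∑ y, fibreMatrix F x y 0 = 1 := by
      simp only [fibreMatrix, of_apply, rel_zero_iff hG x _ h01]
      rw [sum_rd x h01 (fun u v => if u = 1 ∧ v = 1 then (1 : F) else 0)]
      simp [ite_and]
    have h1 := hs (.inl 0)
    have h2 := hs (.inl 1)
    have h3 := hs (.inl 2)
    have h4 := hs (.inr 0)
    simp only [fib, mult, Sum.elim_inl, Sum.elim_inr, mul_one] at h1 h2 h3 h4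
    fin_cases a
    · exact h0
    · exact h1
    · exact h2
    · exact h3
    · exact h4
  · simp [fibreMatrix_mul_of_ne x hab]

theorem fibreMatrix_mul_copyMatrix_sum (hG : ∀ g : G, g * g = 1) (a : Fin 5)
    (s : Idx × {g : G // g ≠ 1}) :
    ∑ y, fibreMatrix F x y a * copyMatrix F x y s = multMat (Fintype.card G : F) s.1 a := by
  simp only [fibreMatrix_mul_copyMatrix, multMat, of_apply]
  split_ifs with h
  · exact sum_copyMatrix_col x hG s
  · simp

theorem exists_rel (hG : ∀ g : G, g * g = 1) (hn : 3 ≤ Fintype.card G) (a : Fin 5) :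
    ∃ y, rel G a x y := by
  obtain ⟨u, v, hu, hv, huv⟩ : ∃ u v : G, u ≠ 1 ∧ v ≠ 1 ∧ u ≠ v := by
    obtain ⟨u, v, w, h1, h2, h3⟩ := Fintype.two_lt_card_iff.1 hn
    by_cases e1 : u = 1
    · exact ⟨v, w, fun h => h1 (e1.trans h.symm), fun h => h2 (e1.trans h.symm), h3⟩
    · by_cases e2 : v = 1
      · exact ⟨u, w, e1, fun h => h3 (e2.trans h.symm), h2⟩
      · exact ⟨u, v, e1, e2, h1⟩
  have h01 : (0 : Fin 3) ≠ 1 := by decide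
  have h20 : (2 : Fin 3) ≠ 0 := by decide
  have key : ∀ {i j : Fin 3} (hij : i ≠ j) (u v : G), ∃ y, rd x i y = u ∧ rd x j y = v :=
    fun hij u v => (existsUnique_rd hij u v).exists
  fin_cases a
  · exact ⟨x, rfl⟩
  · obtain ⟨y, h, h'⟩ := key h01 1 u
    exact ⟨y, (rel_succ_iff hG x y h01).2 ⟨h, h' ▸ hu⟩⟩
  · obtain ⟨y, h, h'⟩ := key h01.symm 1 u
    exact ⟨y, (rel_succ_iff hG x y h01.symm).2 ⟨h, h' ▸ hu⟩⟩
  · obtain ⟨y, h, h'⟩ := key h20 1 u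
    exact ⟨y, (rel_succ_iff hG x y h20).2 ⟨h, h' ▸ hu⟩⟩
  · obtain ⟨y, h, h'⟩ := key h01 u v
    exact ⟨y, (rel_four_iff hG x y h01).2 ⟨h ▸ hu, h' ▸ hv, by rw [h, h']; exact huv⟩⟩

theorem transpose_mulVec_alternating {X m : Type*} [Fintype X] [DecidableEq X] (M : Matrix X m F)
    (y₁ y₂ y₃ y₄ y₅ y₆ : X) :
    Mᵀ *ᵥ (Pi.single y₁ 1 + Pi.single y₂ 1 + Pi.single y₃ 1 - Pi.single y₄ 1
      - Pi.single y₅ 1 - Pi.single y₆ 1) = M y₁ + M y₂ + M y₃ - M y₄ - M y₅ - M y₆ := by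
  simp only [mulVec_sub, mulVec_add, mulVec_single_one]
  rfl

/-- Take `a`, `b`, `ab` distinct and different from `1`. Their six orderings are points of the last
fibre; weight them by the sign of the ordering. In each coordinate every value occurs once with each
sign, so all sums over copies vanish. -/
theorem exists_alternating (hG : ∀ g : G, g * g = 1) (hn : 3 ≤ Fintype.card G) :
    ∃ w : CayleyTriple G → F, w ≠ 0 ∧ (fibreMatrix F x)ᵀ *ᵥ w = 0 ∧ (copyMatrix F x)ᵀ *ᵥ w = 0 ∧
      ∀ y, ¬ rel G 4 x y → w y = 0 := by
  obtain ⟨y₀, hy₀⟩ := exists_rel x hG hn 4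
  have h01 : (0 : Fin 3) ≠ 1 := by decide
  obtain ⟨hu, hv, huv⟩ := (rel_four_iff hG x y₀ h01).1 hy₀
  set a := rd x 0 y₀
  set b := rd x 1 y₀
  have hc := commute_of_sq hG
  have e1 : a * (a * b) = b := by rw [← mul_assoc, hG, one_mul]
  have e2 : b * (a * b) = a := by rw [hc a b, ← mul_assoc, hG, one_mul]
  have e3 : a * b * a = b := by rw [hc, e1]
  have e4 : a * b * b = a := by rw [hc, e2]
  have h1 : a * b ≠ 1 := by rwa [ne_eq, mul_eq_one_iff_of_sq hG]
  have h2 : a * b ≠ a := by simpa using hv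
  have h3 : a * b ≠ b := by simpa using hu
  have pt : ∀ u v : G, u ≠ 1 → v ≠ 1 → u ≠ v → ∃ y, rel G 4 x y ∧
      rd x 0 y = u ∧ rd x 1 y = v ∧ rd x 2 y = u * v := by
    intro u v hu hv huv
    obtain ⟨y, hy, hy'⟩ := (existsUnique_rd (x := x) h01 u v).exists
    refine ⟨y, (rel_four_iff hG x y h01).2 ⟨hy ▸ hu, hy' ▸ hv, by rwa [hy, hy']⟩, hy, hy', ?_⟩
    rw [← hy, ← hy']
    exact (rd_mul_rd hG x y (by decide) (by decide) (by decide)).symm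
  -- The points `y₁`, `y₂`, `y₃` are the cyclic orderings of `(a, b, ab)`; `y₄`, `y₅`, `y₆` are the
  -- odd ones.
  obtain ⟨y₁, r₁, p₁, q₁, s₁⟩ := pt a b hu hv huv
  obtain ⟨y₂, r₂, p₂, q₂, s₂⟩ := pt b (a * b) hv h1 h3.symm
  obtain ⟨y₃, r₃, p₃, q₃, s₃⟩ := pt (a * b) a h1 hu h2
  obtain ⟨y₄, r₄, p₄, q₄, s₄⟩ := pt b a hv hu huv.symm
  obtain ⟨y₅, r₅, p₅, q₅, s₅⟩ := pt a (a * b) hu h1 h2.symm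
  obtain ⟨y₆, r₆, p₆, q₆, s₆⟩ := pt (a * b) b h1 hv h3
  rw [e2] at s₂
  rw [e3] at s₃
  rw [hc b a] at s₄
  rw [e1] at s₅
  rw [e4] at s₆
  have ne : ∀ {i : Fin 3} {y y' : CayleyTriple G} {u v : G}, rd x i y = u → rd x i y' = v →
      u ≠ v → y ≠ y' := by
    rintro i y y' u v rfl rfl h rfl
    exact h rfl
  refine ⟨Pi.single y₁ 1 + Pi.single y₂ 1 + Pi.single y₃ 1 - Pi.single y₄ 1 - Pi.single y₅ 1
    - Pi.single y₆ 1, fun h => ?_, ?_, ?_, ?_⟩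
  · have := congrFun h y₁
    simp only [Pi.sub_apply, Pi.add_apply, Pi.single_eq_same, Pi.zero_apply,
      Pi.single_eq_of_ne (ne p₁ p₂ huv), Pi.single_eq_of_ne (ne p₁ p₃ h2.symm),
      Pi.single_eq_of_ne (ne p₁ p₄ huv), Pi.single_eq_of_ne (ne q₁ q₅ h3.symm),
      Pi.single_eq_of_ne (ne p₁ p₆ h2.symm), add_zero, sub_zero, one_ne_zero] at this
  · rw [transpose_mulVec_alternating]
    have row : ∀ y, rel G 4 x y → fibreMatrix F x y = fun a => if a = 4 then 1 else 0 := by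
      intro y hy
      ext a
      simp only [fibreMatrix, of_apply]
      have : rel G a x y ↔ a = 4 :=
        ⟨fun h' => (rel_existsUnique x y).unique h' hy, fun e => e ▸ hy⟩
      simp only [this]
    rw [row y₁ r₁, row y₂ r₂, row y₃ r₃, row y₄ r₄, row y₅ r₅, row y₆ r₆]
    abel
  · rw [transpose_mulVec_alternating]
    have row : ∀ y, rel G 4 x y → copyMatrix F x y =
        fun s => if 4 = fib s.1 then if rd x (copyCoord s.1) y = s.2 then 1 else 0 else 0 := by
      intro y hy
      ext s
      simp only [copyMatrix, of_apply]
      have : rel G (fib s.1) x y ↔ 4 = fib s.1 :=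
        ⟨fun h' => (rel_existsUnique x y).unique hy h', fun e => e ▸ hy⟩
      simp only [this, ite_and]
    rw [row y₁ r₁, row y₂ r₂, row y₃ r₃, row y₄ r₄, row y₅ r₅, row y₆ r₆]
    ext ⟨s, h⟩
    rcases s with i | i
    · have : 4 ≠ fib (.inl i) := by
        revert i
        decide
      simp [this]
    · fin_cases i
      · simp [fib, copyCoord, p₁, p₂, p₃, p₄, p₅, p₆]
        ring
      · simp [fib, copyCoord, q₁, q₂, q₃, q₄, q₅, q₆]
      · simp [fib, copyCoord, s₁, s₂, s₃, s₄, s₅, s₆]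
        ring
  · intro y hy
    have : ∀ z, rel G 4 x z → (Pi.single z 1 : CayleyTriple G → F) y = 0 := by
      intro z hz
      refine Pi.single_eq_of_ne ?_ _
      rintro rfl
      exact hy hz
    simp only [Pi.sub_apply, Pi.add_apply, this _ r₁, this _ r₂, this _ r₃, this _ r₄, this _ r₅,
      this _ r₆]
    simp

/-- The frame of the Cayley table scheme with base point `x`. -/
noncomputable def frame (F : Type*) [Field F] (x : CayleyTriple G) (hG : ∀ g : G, g * g = 1)
    (hn : 3 ≤ Fintype.card G) :
    Frame F (CayleyTriple G) {g : G // g ≠ 1} (Fintype.card G : F) where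
  L := fibreMatrix F x
  Q := copyMatrix F x
  E := diagonal fun y => fibreMatrix F x y 4
  E_transpose := diagonal_transpose _
  E_mul_E := by
    rw [diagonal_mul_diagonal]
    simp only [fibreMatrix_mul_self]
  E_mul_L := by
    ext y a
    rw [Matrix.diagonal_mul]
    by_cases ha : 4 = a
    · subst ha
      simp [lastFib, fibreMatrix_mul_self]
    · rw [fibreMatrix_mul_of_ne x ha]
      simp [lastFib, Matrix.mul_apply, ha]
  E_mul_Q := by
    ext y ⟨s, h⟩
    rw [Matrix.diagonal_mul, fibreMatrix_mul_copyMatrix]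
    rcases s with i | i
    · have : 4 ≠ fib (.inl i) := by
        revert i
        decide
      simp [this, Matrix.mul_apply, lastIdx, Fintype.sum_prod_type]
    · simp [fib, Matrix.mul_apply, lastIdx, Fintype.sum_prod_type, Matrix.one_apply]
  L_gram := by
    ext a b
    rw [Matrix.mul_apply, diagonal_apply]
    exact fibreMatrix_gram x hG a b
  L_mul_Q := by
    ext a s
    exact fibreMatrix_mul_copyMatrix_sum x hG a s
  Q_gram := by
    ext s t
    exact copyMatrix_gram x hG s t
  Q_sum := sum_copyMatrix_row x hG
  L_surj a := by
    obtain ⟨y, hy⟩ := exists_rel x hG hn a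
    refine ⟨y, fun b => ?_⟩
    simp only [fibreMatrix, of_apply]
    have : rel G b x y ↔ a = b :=
      ⟨fun h' => (rel_existsUnique x y).unique hy h', fun e => e ▸ hy⟩
    simp only [this]
  pair := by
    obtain ⟨y, hy⟩ := exists_rel x hG hn 4
    have h01 : (0 : Fin 3) ≠ 1 := by decide
    obtain ⟨hu, hv, huv⟩ := (rel_four_iff hG x y h01).1 hy
    exact ⟨⟨_, hu⟩, ⟨_, hv⟩, fun h => huv (Subtype.ext_iff.1 h)⟩
  exists_alternating := by
    obtain ⟨w, h1, h2, h3, h4⟩ := exists_alternating (F := F) x hG hn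
    refine ⟨w, h1, h2, h3, ?_⟩
    ext y
    rw [mulVec_diagonal]
    by_cases hy : rel G 4 x y
    · simp [fibreMatrix, hy]
    · rw [h4 y hy, mul_zero]

end FrameOf

/-! ### The spanning matrices `J`, `N`, `E` -/

namespace Frame

variable {F : Type*} [Field F] {X H : Type*} [Fintype X] [DecidableEq X] [Fintype H]
    [DecidableEq H] {ν : F} (S : Frame F X H ν)

/-- The all-one block of two fibres. -/
def J (a b : Fin 5) : Matrix X X F := S.mat (single a b 1, 0, 0)

/-- The incidence matrix of two copies. -/
def N (s t : Idx) : Matrix X X F := S.mat (0, single s t 1, 0)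

theorem mat_E : S.mat (0, 0, 1) = S.E := by
  simp [mat_apply]

theorem J_apply (a b : Fin 5) (y z : X) : S.J a b y z = S.L y a * S.L z b := by
  simp [J, mat_apply, Matrix.mul_apply, single_apply, ite_and]

theorem N_apply (s t : Idx) (y z : X) : S.N s t y z = ∑ h, S.Q y (s, h) * S.Q z (t, h) := by
  simp only [N, mat_apply, Matrix.mul_zero, Matrix.zero_mul, zero_add, zero_smul, add_zero]
  rw [Matrix.mul_apply]
  simp only [Matrix.mul_apply, Fintype.sum_prod_type, kroneckerMap_apply, single_apply,
    Matrix.one_apply, transpose_apply]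
  simp [ite_and]

theorem mat_eq_sum (t : Coef F) : S.mat t =
    ∑ a, ∑ b, t.1 a b • S.J a b + ∑ s, ∑ r, t.2.1 s r • S.N s r + t.2.2 • S.E := by
  have h : t = ∑ a, ∑ b, t.1 a b • ((single a b 1, 0, 0) : Coef F)
      + ∑ s, ∑ r, t.2.1 s r • ((0, single s r 1, 0) : Coef F) + t.2.2 • ((0, 0, 1) : Coef F) := by
    refine Prod.ext ?_ (Prod.ext ?_ ?_)
    · simp only [Prod.fst_add, Prod.fst_sum, Prod.smul_fst, smul_zero, Finset.sum_const_zero,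
        add_zero, smul_single, smul_eq_mul, mul_one]
      exact matrix_eq_sum_single _
    · simp only [Prod.fst_add, Prod.snd_add, Prod.fst_sum, Prod.snd_sum, Prod.smul_fst,
        Prod.smul_snd, smul_zero, Finset.sum_const_zero, add_zero, zero_add, smul_single,
        smul_eq_mul, mul_one]
      exact matrix_eq_sum_single _
    · simp only [Prod.snd_add, Prod.snd_sum, Prod.smul_snd, Finset.sum_const_zero,
        zero_add, smul_eq_mul, mul_zero, mul_one]
  conv_lhs => rw [h]
  simp only [map_add, map_sum, map_smul, mat_E]
  rfl

/-- A copy `inl j` has exactly one point over each element of `H`, so composing through it loses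
nothing. This creates the incidences that no single relation provides. -/
theorem N_mul_N (s t : Idx) (j : Fin 3) : S.N s (.inl j) * S.N (.inl j) t = S.N s t := by
  rw [N, N, S.mat_mul_mat, N]
  congr 1
  refine Prod.ext ?_ (Prod.ext ?_ ?_)
  · have : single s (Sum.inl j) (1 : F) * gramConst F = 0 := by
      ext a b
      rcases b with b | b <;> simp [Matrix.mul_apply, single_apply, gramConst]
    simp only [Coef.mul, Matrix.mul_assoc, Matrix.zero_mul, Matrix.mul_zero, smul_zero, add_zero,
      zero_add]
    rw [← Matrix.mul_assoc (single s _ _), this, Matrix.zero_mul, Matrix.mul_zero]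
  · have : single s (Sum.inl j) (1 : F) * gram ν = single s (Sum.inl j) 1 := by
      ext a b
      rcases b with b | b <;>
        simp [Matrix.mul_apply, single_apply, gram, Matrix.one_apply, ite_and]
    simp only [Coef.mul, zero_smul, add_zero, this]
    simp
  · simp [Coef.mul]

end Frame

/-! ### Identification of the Terwilliger algebra -/

section Dictionary

variable {G : Type*} [Group G] {F : Type*} [Field F] {x : CayleyTriple G}

/-- The coordinate `i` distinguishes the points of the copy `s`. -/
def Sees (i : Fin 3) (s : Idx) : Prop := s = .inr i ∨ ∃ j, j ≠ i ∧ s = .inl j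

theorem rd_ne_one_of_sees (hG : ∀ g : G, g * g = 1) {i : Fin 3} {s : Idx} (hs : Sees i s)
    {y : CayleyTriple G}
    (hy : rel G (fib s) x y) : rd x i y ≠ 1 := by
  rcases hs with rfl | ⟨j, hj, rfl⟩
  · exact ((rel_four_iff hG x y (ne_add_one i)).1 hy).1
  · exact ((rel_succ_iff hG x y hj).1 hy).2

theorem rd_eq_rd (y z : CayleyTriple G) (i : Fin 3) :
    rd x i y = rd x i z ↔ coord i y = coord i z :=
  mul_right_inj _

variable [DecidableEq G]

theorem copyMatrix_apply_of_sees (hG : ∀ g : G, g * g = 1) {i : Fin 3} {s : Idx} (hs : Sees i s)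
    (y : CayleyTriple G) (h : {g : G // g ≠ 1}) : copyMatrix F x y (s, h) =
      if rd x i y = h then fibreMatrix F x y (fib s) else 0 := by
  rcases hs with rfl | ⟨j, hj, rfl⟩
  · simp only [copyMatrix, fibreMatrix, of_apply, copyCoord, Sum.elim_inr]
    by_cases h1 : rel G (fib (.inr i)) x y <;> by_cases h2 : rd x i y = h <;> simp [h1, h2]
  · rw [copyMatrix_inl x hG y hj]
    simp only [fibreMatrix, of_apply, rel_succ_iff hG x y hj]
    by_cases h2 : rd x i y = h
    · simp [h2, h.2]
    · simp [h2]

variable [Fintype G] (hG : ∀ g : G, g * g = 1) (hn : 3 ≤ Fintype.card G)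

/-- If both copies can be read through one coordinate, their incidence is equality in that
coordinate, which ties `N` to the relations of the scheme. -/
theorem N_apply_of_sees {i : Fin 3} {s t : Idx} (hs : Sees i s) (ht : Sees i t)
    (y z : CayleyTriple G) : (frame F x hG hn).N s t y z =
      if coord i y = coord i z then fibreMatrix F x y (fib s) * fibreMatrix F x z (fib t)
      else 0 := by
  rw [Frame.N_apply]
  simp only [frame, copyMatrix_apply_of_sees hG hs, copyMatrix_apply_of_sees hG ht]
  by_cases hy : rel G (fib s) x y
  · rw [Finset.sum_eq_single ⟨rd x i y, rd_ne_one_of_sees hG hs hy⟩]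
    · simp [rd_eq_rd, eq_comm]
    · intro h _ hne
      rw [if_neg, zero_mul]
      intro e
      exact hne (Subtype.ext e.symm)
    · simp
  · simp [fibreMatrix, hy]

theorem fib_cases (a : Fin 5) (i : Fin 3) : a = 0 ∨ a = fib (.inl i) ∨ ∃ s, Sees i s ∧ fib s = a := by
  have key : ∀ (a : Fin 5) (i : Fin 3), a = 0 ∨ a = fib (.inl i) ∨ a = fib (.inr i) ∨
      ∃ j, j ≠ i ∧ fib (.inl j) = a := by decide
  rcases key a i with h | h | h | ⟨j, hj, h⟩
  · exact .inl h
  · exact .inr (.inl h)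
  · exact .inr (.inr ⟨_, .inl rfl, h.symm⟩)
  · exact .inr (.inr ⟨_, .inr ⟨j, hj, rfl⟩, h⟩)

theorem dualIdem_eq (a : Fin 5) :
    (cayleyScheme G hn).dualIdem F x a = diagonal fun y => fibreMatrix F x y a := by
  ext y z
  simp only [AssociationScheme.dualIdem, diagonal_apply, fibreMatrix, cayleyScheme, of_apply]
  rcases eq_or_ne y z with rfl | h
  · by_cases h : rel G a x y <;> simp [h]
  · simp [h]

theorem dualIdem_mul_mul_apply (a b : Fin 5) (M : Matrix (CayleyTriple G) (CayleyTriple G) F)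
    (y z : CayleyTriple G) :
    ((cayleyScheme G hn).dualIdem F x a * M * (cayleyScheme G hn).dualIdem F x b) y z =
      fibreMatrix F x y a * M y z * fibreMatrix F x z b := by
  simp only [dualIdem_eq, mul_diagonal, Matrix.diagonal_mul]

theorem dualIdem_four : (cayleyScheme G hn).dualIdem F x 4 = (frame F x hG hn).E :=
  dualIdem_eq hn 4

theorem block_eq (a b : Fin 5) :
    (cayleyScheme G hn).block F x a b = (frame F x hG hn).J a b := by
  ext y z
  rw [AssociationScheme.block, dualIdem_mul_mul_apply, Frame.J_apply]
  simp [frame]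

theorem triple_eq {i : Fin 3} {s t : Idx} (hs : Sees i s) (ht : Sees i t) :
    (cayleyScheme G hn).triple F x (fib s) (fib (.inl i)) (fib t) =
      (frame F x hG hn).N s t
        - if fib s = fib t then (cayleyScheme G hn).dualIdem F x (fib s) else 0 := by
  ext y z
  rw [AssociationScheme.triple, dualIdem_mul_mul_apply, Matrix.sub_apply,
    N_apply_of_sees hG hn hs ht]
  have h1 : (cayleyScheme G hn).adj F (fib (.inl i)) y z =
      if coord i y = coord i z ∧ y ≠ z then 1 else 0 := by
    simp only [AssociationScheme.adj, of_apply]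
    have : (cayleyScheme G hn).R (fib (.inl i)) y z ↔ coord i y = coord i z ∧ y ≠ z := by
      fin_cases i <;> rfl
    simp only [this]
  rw [h1]
  by_cases hyz : y = z
  · subst hyz
    by_cases hst : fib s = fib t
    · simp [hst, dualIdem_eq, fibreMatrix_mul_self]
    · simp [hst, fibreMatrix_mul_of_ne x hst]
  · have h2 : (if fib s = fib t then (cayleyScheme G hn).dualIdem F x (fib s) else 0) y z = 0 := by
      split_ifs
      · rw [dualIdem_eq, diagonal_apply_ne _ hyz]
      · rfl
    rw [h2]
    by_cases h : coord i y = coord i z <;> simp [h, hyz]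

theorem quintuple_eq (a b c d e : Fin 5) :
    (cayleyScheme G hn).quintuple F x a b c d e =
      (cayleyScheme G hn).triple F x a b c * (cayleyScheme G hn).triple F x c d e := by
  have h : (cayleyScheme G hn).dualIdem F x c * (cayleyScheme G hn).dualIdem F x c =
      (cayleyScheme G hn).dualIdem F x c := by
    rw [dualIdem_eq, diagonal_mul_diagonal]
    simp only [fibreMatrix_mul_self]
  simp only [AssociationScheme.quintuple, AssociationScheme.triple]
  conv_lhs => rw [← h]
  simp only [Matrix.mul_assoc]

theorem dualIdem_inl (i : Fin 3) : (cayleyScheme G hn).dualIdem F x (fib (.inl i)) =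
    (frame F x hG hn).N (.inl i) (.inl i) := by
  have hs : Sees (i + 1) (.inl i) := .inr ⟨i, ne_add_one i, rfl⟩
  ext y z
  rw [N_apply_of_sees hG hn hs hs, dualIdem_eq, diagonal_apply]
  by_cases hyz : y = z
  · subst hyz
    simp [fibreMatrix_mul_self]
  · rw [if_neg hyz]
    split_ifs with h
    · simp only [fibreMatrix, of_apply, rel_succ_iff hG x _ (ne_add_one i)]
      split_ifs with h1 h2
      · refine absurd (eq_of_coord (ne_add_one i) ?_ h) hyz
        rw [← rd_eq_rd (x := x), h1.1, h2.1]
      all_goals simp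
    · rfl

theorem dualIdem_zero :
    (cayleyScheme G hn).dualIdem F x 0 = (frame F x hG hn).J 0 0 := by
  ext y z
  rw [Frame.J_apply, dualIdem_eq, diagonal_apply]
  simp only [frame, fibreMatrix, of_apply, rel]
  split_ifs <;> simp_all

theorem dualIdem_mem (a : Fin 5) :
    (cayleyScheme G hn).dualIdem F x a ∈ LinearMap.range (frame F x hG hn).mat := by
  have key : ∀ a : Fin 5, a = 0 ∨ a = 4 ∨ ∃ i, a = fib (.inl i) := by decide
  rcases key a with rfl | rfl | ⟨i, rfl⟩
  · rw [dualIdem_zero hG]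
    exact ⟨_, rfl⟩
  · rw [dualIdem_four hG, ← Frame.mat_E]
    exact ⟨_, rfl⟩
  · rw [dualIdem_inl hG]
    exact ⟨_, rfl⟩

theorem sum_dualIdem : ∑ a, (cayleyScheme G hn).dualIdem F x a = 1 := by
  ext y z
  simp only [dualIdem_eq, Matrix.sum_apply, diagonal_apply, Matrix.one_apply]
  split_ifs
  · obtain ⟨a, ha, hu⟩ := rel_existsUnique x y
    rw [Finset.sum_eq_single a]
    · simp [fibreMatrix, ha]
    · intro b _ hb
      simp only [fibreMatrix, of_apply]
      rw [if_neg fun h => hb (hu b h)]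
    · simp
  · simp

theorem sum_adj : ∑ b, (cayleyScheme G hn).adj F b = of fun _ _ => 1 := by
  ext y z
  simp only [Matrix.sum_apply, AssociationScheme.adj, of_apply]
  obtain ⟨a, ha, hu⟩ := (cayleyScheme G hn).rel_existsUnique y z
  rw [Finset.sum_eq_single a]
  · simp [ha]
  · intro b _ hb
    rw [if_neg fun h => hb (hu b h)]
  · simp

theorem mul_mem_range {M N : Matrix (CayleyTriple G) (CayleyTriple G) F}
    (hM : M ∈ LinearMap.range (frame F x hG hn).mat)
    (hN : N ∈ LinearMap.range (frame F x hG hn).mat) :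
    M * N ∈ LinearMap.range (frame F x hG hn).mat := by
  obtain ⟨t, rfl⟩ := hM
  obtain ⟨t', rfl⟩ := hN
  exact ⟨_, (Frame.mat_mul_mat _ t t').symm⟩

theorem one_mem_range : 1 ∈ LinearMap.range (frame F x hG hn).mat := by
  rw [← sum_dualIdem hn (x := x)]
  exact Submodule.sum_mem _ fun a _ => dualIdem_mem hG hn a

/-- Cut the matrix into blocks by the fibres. The `i`-th relative coordinate is constantly `1` on
the fibres 0 and `i + 1` and avoids `1` on the others, so a block is a `J`, zero or an `N`. -/
theorem line_mem (i : Fin 3) :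
    (of fun y z => if coord i y = coord i z then (1 : F) else 0 :
      Matrix (CayleyTriple G) (CayleyTriple G) F) ∈ LinearMap.range (frame F x hG hn).mat := by
  generalize hM : (of fun y z => if coord i y = coord i z then (1 : F) else 0 :
      Matrix (CayleyTriple G) (CayleyTriple G) F) = M
  have hM' : ∀ y z, M y z = if coord i y = coord i z then 1 else 0 := by simp [← hM]
  -- The dual idempotents sum to `1`, which gives the block decomposition.
  rw [← one_mul M, ← mul_one (1 * M), ← sum_dualIdem hn (x := x), Finset.sum_mul, Finset.sum_mul]
  refine Submodule.sum_mem _ fun a _ => ?_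
  rw [Finset.mul_sum]
  refine Submodule.sum_mem _ fun b _ => ?_
  have hz : ∀ a : Fin 5, (a = 0 ∨ a = fib (.inl i)) → ∀ y, rel G a x y → rd x i y = 1 := by
    rintro a (rfl | rfl) y hy
    · exact ((rel_zero_iff hG x y (ne_add_one i)).1 hy).1
    · exact ((rel_succ_iff hG x y (ne_add_one i)).1 hy).1
  have cases' : ∀ a, (∀ y, rel G a x y → rd x i y = 1) ∨ ∃ s, Sees i s ∧ fib s = a := by
    intro a
    rcases fib_cases a i with h | h | h
    · exact .inl (hz a (.inl h))
    · exact .inl (hz a (.inr h))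
    · exact .inr h
  have zero : ∀ a b, (∀ y, rel G a x y → rd x i y = 1) → (∀ y, rel G b x y → rd x i y ≠ 1) →
      ∀ y z, fibreMatrix F x y a * M y z * fibreMatrix F x z b = 0 ∧
        fibreMatrix F x z b * M z y * fibreMatrix F x y a = 0 := by
    intro a b ha hb y z
    simp only [fibreMatrix, of_apply, hM', ← rd_eq_rd (x := x)]
    split_ifs with h1 h2 h3 h4 h5 <;> simp
    all_goals
      have e1 := ha y ‹_›
      have e2 := hb z ‹_›
      simp_all
  rcases cases' a with ha | ⟨s, hs, rfl⟩ <;> rcases cases' b with hb | ⟨t, ht, rfl⟩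
  · refine ⟨(single a b 1, 0, 0), ?_⟩
    change (frame F x hG hn).J a b = _
    ext y z
    simp only [dualIdem_mul_mul_apply, Frame.J_apply, hM', ← rd_eq_rd (x := x), frame,
      fibreMatrix, of_apply]
    split_ifs with h1 h2 h3 h3 <;> simp
    exact h3 ((ha y h1).trans (hb z h2).symm)
  · convert Submodule.zero_mem _
    ext y z
    rw [dualIdem_mul_mul_apply]
    exact (zero _ _ ha (fun y hy => rd_ne_one_of_sees hG ht hy) y z).1
  · convert Submodule.zero_mem _
    ext y z
    rw [dualIdem_mul_mul_apply]
    exact (zero _ _ hb (fun y hy => rd_ne_one_of_sees hG hs hy) z y).2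
  · refine ⟨(0, single s t 1, 0), ?_⟩
    change (frame F x hG hn).N s t = _
    ext y z
    rw [dualIdem_mul_mul_apply, N_apply_of_sees hG hn hs ht, hM']
    split_ifs <;> simp

theorem adj_mem (b : Fin 5) :
    (cayleyScheme G hn).adj F b ∈ LinearMap.range (frame F x hG hn).mat := by
  have h0 : (cayleyScheme G hn).adj F 0 = 1 := by
    ext y z
    simp only [AssociationScheme.adj, of_apply, cayleyScheme, rel, Matrix.one_apply]
    congr
  have hi : ∀ i : Fin 3, (cayleyScheme G hn).adj F (fib (.inl i)) =
      (of fun y z => if coord i y = coord i z then (1 : F) else 0) - 1 := by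
    intro i
    ext y z
    have : (cayleyScheme G hn).R (fib (.inl i)) y z ↔ coord i y = coord i z ∧ y ≠ z := by
      fin_cases i <;> rfl
    simp only [AssociationScheme.adj, of_apply, Matrix.sub_apply, this, Matrix.one_apply]
    by_cases hyz : y = z
    · simp [hyz]
    · simp [hyz]
  have hi' : ∀ i : Fin 3, (cayleyScheme G hn).adj F (fib (.inl i)) ∈
      LinearMap.range (frame F x hG hn).mat := by
    intro i
    rw [hi]
    exact Submodule.sub_mem _ (line_mem hG hn i) (one_mem_range hG hn)
  have key : ∀ a : Fin 5, a = 0 ∨ a = 4 ∨ ∃ i, a = fib (.inl i) := by decide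
  rcases key b with rfl | rfl | ⟨i, rfl⟩
  · rw [h0]
    exact one_mem_range hG hn
  -- The last relation is the all-one matrix minus the other four.
  · have hJ : (of fun _ _ => 1 : Matrix (CayleyTriple G) (CayleyTriple G) F) ∈
        LinearMap.range (frame F x hG hn).mat := by
      have e : (of fun _ _ => 1 : Matrix (CayleyTriple G) (CayleyTriple G) F) =
          ∑ a, ∑ b, (cayleyScheme G hn).block F x a b := by
        calc (of fun _ _ => 1 : Matrix (CayleyTriple G) (CayleyTriple G) F)
            = (∑ a, (cayleyScheme G hn).dualIdem F x a) * (of fun _ _ => 1) *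
              ∑ a, (cayleyScheme G hn).dualIdem F x a := by
              rw [sum_dualIdem, Matrix.one_mul, Matrix.mul_one]
          _ = _ := by
              rw [Finset.sum_mul, Finset.sum_mul]
              simp only [Finset.mul_sum]
              rfl
      rw [e]
      refine Submodule.sum_mem _ fun a _ => Submodule.sum_mem _ fun b _ => ?_
      rw [block_eq hG]
      exact ⟨_, rfl⟩
    rw [← sum_adj hn, Fin.sum_univ_five] at hJ
    have h1 := hi' 0
    have h2 := hi' 1
    have h3 := hi' 2
    have h00 := one_mem_range (F := F) (x := x) hG hn
    rw [← h0] at h00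
    have := Submodule.sub_mem _ (Submodule.sub_mem _ (Submodule.sub_mem _ (Submodule.sub_mem _ hJ
      h00) h1) h2) h3
    convert this using 1
    simp only [fib, Sum.elim_inl]
    change _ = _ - _ - (cayleyScheme G hn).adj F 1 - (cayleyScheme G hn).adj F 2
      - (cayleyScheme G hn).adj F 3
    abel
  · exact hi' i

theorem triple_mem_terwilliger (a b c : Fin 5) :
    (cayleyScheme G hn).triple F x a b c ∈ (cayleyScheme G hn).terwilliger F x :=
  Algebra.subset_adjoin ⟨a, b, c, rfl⟩

theorem dualIdem_mem_terwilliger (a : Fin 5) :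
    (cayleyScheme G hn).dualIdem F x a ∈ (cayleyScheme G hn).terwilliger F x := by
  have h : (cayleyScheme G hn).dualIdem F x a = (cayleyScheme G hn).triple F x a 0 a := by
    ext y z
    rw [AssociationScheme.triple, dualIdem_mul_mul_apply, dualIdem_eq, diagonal_apply]
    simp only [AssociationScheme.adj, cayleyScheme, rel, of_apply]
    by_cases hyz : y = z
    · subst hyz
      simp [fibreMatrix_mul_self]
    · simp [hyz]
  rw [h]
  exact triple_mem_terwilliger hn a 0 a

theorem N_mem_terwilliger_of_sees {i : Fin 3} {s t : Idx} (hs : Sees i s) (ht : Sees i t) :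
    (frame F x hG hn).N s t ∈ (cayleyScheme G hn).terwilliger F x := by
  have h := triple_mem_terwilliger (F := F) (x := x) hn (fib s) (fib (.inl i)) (fib t)
  rw [triple_eq hG hn hs ht] at h
  have h2 : (if fib s = fib t then (cayleyScheme G hn).dualIdem F x (fib s) else 0) ∈
      (cayleyScheme G hn).terwilliger F x := by
    split_ifs
    · exact dualIdem_mem_terwilliger hn _
    · exact zero_mem _
  simpa using add_mem h h2

/-- Two copies that share no coordinate are connected through a copy `inl`, which has a common
coordinate with its neighbour on each side. -/
theorem N_mem_terwilliger (s t : Idx) :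
    (frame F x hG hn).N s t ∈ (cayleyScheme G hn).terwilliger F x := by
  have third : ∀ i j : Fin 3, ∃ k, i ≠ k ∧ j ≠ k := by decide
  have ll : ∀ i j : Fin 3, (frame F x hG hn).N (.inl i) (.inl j) ∈
      (cayleyScheme G hn).terwilliger F x := by
    intro i j
    obtain ⟨k, hi, hj⟩ := third i j
    exact N_mem_terwilliger_of_sees hG hn (i := k) (.inr ⟨i, hi, rfl⟩) (.inr ⟨j, hj, rfl⟩)
  have lr : ∀ i j : Fin 3, (frame F x hG hn).N (.inl i) (.inr j) ∈
      (cayleyScheme G hn).terwilliger F x := by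
    intro i j
    -- Any index other than `j` serves: that copy is distinguished by the coordinate `j`.
    rw [← Frame.N_mul_N _ _ _ (j + 1)]
    exact mul_mem (ll _ _) (N_mem_terwilliger_of_sees hG hn (i := j)
      (.inr ⟨_, (ne_add_one j).symm, rfl⟩) (.inl rfl))
  have rl : ∀ i j : Fin 3, (frame F x hG hn).N (.inr i) (.inl j) ∈
      (cayleyScheme G hn).terwilliger F x := by
    intro i j
    rw [← Frame.N_mul_N _ _ _ (i + 1)]
    exact mul_mem (N_mem_terwilliger_of_sees hG hn (i := i)
      (.inl rfl) (.inr ⟨_, (ne_add_one i).symm, rfl⟩)) (ll _ _)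
  rcases s with i | i <;> rcases t with j | j
  · exact ll i j
  · exact lr i j
  · exact rl i j
  · rw [← Frame.N_mul_N _ _ _ 0]
    exact mul_mem (rl _ _) (lr _ _)

theorem mem_terwilliger_iff (M : Matrix (CayleyTriple G) (CayleyTriple G) F) :
    M ∈ (cayleyScheme G hn).terwilliger F x ↔ ∃ t, (frame F x hG hn).mat t = M := by
  constructor
  · intro h
    change M ∈ LinearMap.range (frame F x hG hn).mat
    refine Algebra.adjoin_induction (p := fun M _ => M ∈ LinearMap.range (frame F x hG hn).mat)
      ?_ ?_ ?_ ?_ h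
    · rintro _ ⟨a, b, c, rfl⟩
      exact mul_mem_range hG hn (mul_mem_range hG hn (dualIdem_mem hG hn a) (adj_mem hG hn b))
        (dualIdem_mem hG hn c)
    · intro c
      rw [Algebra.algebraMap_eq_smul_one]
      exact Submodule.smul_mem _ c (one_mem_range hG hn)
    · intro M N _ _
      exact Submodule.add_mem _
    · intro M N _ _
      exact mul_mem_range hG hn
  · rintro ⟨t, rfl⟩
    rw [Frame.mat_eq_sum]
    refine add_mem (add_mem (sum_mem fun a _ => sum_mem fun b _ => Subalgebra.smul_mem _ ?_ _)
      (sum_mem fun s _ => sum_mem fun r _ => Subalgebra.smul_mem _ ?_ _))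
      (Subalgebra.smul_mem _ ?_ _)
    · rw [← block_eq, AssociationScheme.block, ← sum_adj hn, Finset.mul_sum, Finset.sum_mul]
      exact sum_mem fun c _ => triple_mem_terwilliger hn a c b
    · exact N_mem_terwilliger hG hn s r
    · rw [← dualIdem_four]
      exact dualIdem_mem_terwilliger hn 4

theorem valency_cast (x : CayleyTriple G) (hG : ∀ g : G, g * g = 1) (a : Fin 5) :
    ((cayleyScheme G hn).valency a : F) = val (Fintype.card G : F) a := by
  classical
  have h := fibreMatrix_gram (F := F) x hG a a
  rw [if_pos rfl] at h
  rw [← h, (cayleyScheme G hn).valency_eq a x]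
  simp only [fibreMatrix_mul_self]
  simp only [fibreMatrix, of_apply, Finset.sum_boole, Nat.card_eq_fintype_card,
    Fintype.card_subtype]
  congr

end Dictionary

/-! ### The radical as an image of the kernel on coefficients -/

namespace Frame

variable {F : Type*} [Field F] {X H : Type*} [Fintype X] [DecidableEq X] [Fintype H]
    [DecidableEq H] {ν : F} {σ ρ : Type*} [Fintype σ] [DecidableEq σ] [Fintype ρ] [DecidableEq ρ]
    (P : Splitting F ν σ ρ) (S : Frame F X H ν)

/-- The image of the kernel of the map to the semisimple quotient. -/
def kerImage : Submodule F (Matrix X X F) := (LinearMap.ker P.hom).map S.mat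

theorem mat_mem_kerImage {t : Coef F} (h0 : t.2.2 = 0) (h1 : gram ν * t.2.1 * gram ν = 0)
    (h2 : ∀ i j, t.act ν (P.ι i) (P.ι j) = 0) : S.mat t ∈ S.kerImage P :=
  ⟨t, (P.hom_eq_zero_iff t).2 ⟨h0, h1, h2⟩, rfl⟩

theorem J_mem_kerImage {a b : Fin 5} (h : val ν a * val ν b = 0) : S.J a b ∈ S.kerImage P := by
  refine mat_mem_kerImage P S rfl (by simp) fun i j => ?_
  simp only [Coef.act, Matrix.mul_zero, Matrix.zero_mul, zero_smul, add_zero, mul_diagonal,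
    single_apply]
  split_ifs with e
  · obtain ⟨rfl, rfl⟩ := e
    exact absurd h (mul_ne_zero (P.val_ne i) (P.val_ne j))
  · rw [zero_mul]

/-- A criterion for a space of matrices to be the image of the kernel. -/
theorem kerImage_eq {V : Submodule F (Matrix X X F)}
    (hJ : ∀ a b, val ν a * val ν b = 0 → S.J a b ∈ V)
    (hβ : ∀ β : Matrix Idx Idx F, gram ν * β * gram ν = 0 →
      ∃ t, P.hom t = 0 ∧ t.2.1 = β ∧ S.mat t ∈ V)
    (hV : V ≤ S.kerImage P) : S.kerImage P = V := by
  refine le_antisymm ?_ hV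
  rintro _ ⟨t, ht, rfl⟩
  rw [SetLike.mem_coe, LinearMap.mem_ker] at ht
  -- Subtracting a kernel element with the same `β` leaves only `α`, whose entries between fibres of
  -- nonzero valency must vanish.
  obtain ⟨t₀, h0, h1, h2⟩ := hβ t.2.1 ((P.hom_eq_zero_iff t).1 ht).2.1
  rw [← sub_add_cancel t t₀, map_add]
  refine Submodule.add_mem _ ?_ h2
  have h3 : P.hom (t - t₀) = 0 := by rw [map_sub, ht, h0, sub_zero]
  generalize ht' : t - t₀ = t' at h3
  have hb : t'.2.1 = 0 := by rw [← ht', Prod.snd_sub, Prod.fst_sub, h1, sub_self]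
  obtain ⟨h4, -, h5⟩ := (P.hom_eq_zero_iff t').1 h3
  rw [mat_eq_sum, hb, h4]
  simp only [Matrix.zero_apply, zero_smul, Finset.sum_const_zero, add_zero]
  refine Submodule.sum_mem _ fun a _ => Submodule.sum_mem _ fun b _ => ?_
  by_cases hab : val ν a * val ν b = 0
  · exact Submodule.smul_mem _ _ (hJ a b hab)
  · obtain ⟨i, rfl⟩ : ∃ i, P.ι i = a := by
      by_contra hc
      push Not at hc
      exact hab (by rw [P.val_eq a hc, zero_mul])
    obtain ⟨j, rfl⟩ : ∃ j, P.ι j = b := by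
      by_contra hc
      push Not at hc
      exact hab (by rw [P.val_eq b hc, mul_zero])
    have := h5 i j
    simp only [Coef.act, hb, h4, Matrix.mul_zero, Matrix.zero_mul, zero_smul, add_zero,
      mul_diagonal] at this
    rw [(mul_eq_zero.1 this).resolve_right (P.val_ne j), zero_smul]
    exact Submodule.zero_mem _

/-- The blocks of weight zero span the image of the kernel if the Gram matrix is regular. -/
theorem kerImage_eq_of_regular (hg : ∀ β : Matrix Idx Idx F, gram ν * β * gram ν = 0 → β = 0) :
    S.kerImage P = Submodule.span F {M | ∃ a b, val ν a * val ν b = 0 ∧ M = S.J a b} := by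
  refine kerImage_eq P S (fun a b h => Submodule.subset_span ⟨a, b, h, rfl⟩) ?_ ?_
  · intro β hβ
    exact ⟨0, map_zero _, (hg β hβ).symm, by rw [map_zero]; exact Submodule.zero_mem _⟩
  · rw [Submodule.span_le]
    rintro _ ⟨a, b, h, rfl⟩
    exact J_mem_kerImage P S h

end Frame

/-! ### Invertibility of the Gram matrix away from `ν = 1` and `ν = 4` -/

section Gram

variable {F : Type*} [Field F]

theorem gram_mul_mul_gram (ν : F) (β : Matrix Idx Idx F) :
    gram ν * β * gram ν = fromBlocks β.toBlocks₁₁ (β.toBlocks₁₂ * ((ν - 1) • 1 - ones F))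
      (((ν - 1) • 1 - ones F) * β.toBlocks₂₁)
      (((ν - 1) • 1 - ones F) * β.toBlocks₂₂ * ((ν - 1) • 1 - ones F)) := by
  conv_lhs => rw [← fromBlocks_toBlocks β]
  simp [gram, fromBlocks_multiply]

theorem ones_mul_apply (A : Matrix (Fin 3) (Fin 3) F) (i j : Fin 3) :
    (ones F * A) i j = A 0 j + A 1 j + A 2 j := by
  simp [Matrix.mul_apply, ones, Fin.sum_univ_three]

theorem mul_ones_apply (A : Matrix (Fin 3) (Fin 3) F) (i j : Fin 3) :
    (A * ones F) i j = A i 0 + A i 1 + A i 2 := by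
  simp [Matrix.mul_apply, ones, Fin.sum_univ_three]

/-- The inverse of the Gram matrix of the coordinates. -/
def gramInv (ν : F) : Matrix (Fin 3) (Fin 3) F := (ν - 1)⁻¹ • (1 + (ν - 4)⁻¹ • ones F)

theorem ones_mul_ones : ones F * ones F = (3 : F) • ones F := by
  ext i j
  rw [ones_mul_apply]
  simp [ones]
  norm_num

/-- Since `ones² = 3 • ones`, the coefficient of `ones` in the product, up to the factor `(ν -
1)⁻¹`, is `(ν - 1)/(ν - 4) - 1 - 3/(ν - 4) = 0`. -/
theorem mul_gramInv {ν : F} (h1 : ν ≠ 1) (h4 : ν ≠ 4) :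
    ((ν - 1) • 1 - ones F) * gramInv ν = 1 := by
  have h1' : ν - 1 ≠ 0 := sub_ne_zero.2 h1
  have h4' : ν - 4 ≠ 0 := sub_ne_zero.2 h4
  rw [gramInv, Matrix.mul_smul, Matrix.mul_add, Matrix.sub_mul, Matrix.sub_mul, Matrix.mul_smul,
    Matrix.mul_smul, ones_mul_ones]
  ext i j
  simp only [Matrix.smul_apply, Matrix.add_apply, Matrix.sub_apply, Matrix.mul_one, smul_eq_mul,
    Matrix.smul_mul, Matrix.one_mul]
  field_simp
  ring

theorem gramInv_mul {ν : F} (h1 : ν ≠ 1) (h4 : ν ≠ 4) :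
    gramInv ν * ((ν - 1) • 1 - ones F) = 1 :=
  mul_eq_one_comm.1 (mul_gramInv h1 h4)

theorem eq_zero_of_gram_mul_mul_gram {ν : F} (h1 : ν ≠ 1) (h4 : ν ≠ 4) {β : Matrix Idx Idx F}
    (h : gram ν * β * gram ν = 0) : β = 0 := by
  have hg : gram ν * fromBlocks 1 0 0 (gramInv ν) = 1 := by
    simp [gram, fromBlocks_multiply, mul_gramInv h1 h4]
  have hg' := mul_eq_one_comm.1 hg
  calc β = (fromBlocks 1 0 0 (gramInv ν) * gram ν) * β
        * (gram ν * fromBlocks 1 0 0 (gramInv ν)) := by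
        rw [hg, hg', Matrix.one_mul, Matrix.mul_one]
    _ = fromBlocks 1 0 0 (gramInv ν) * (gram ν * β * gram ν) * fromBlocks 1 0 0 (gramInv ν) := by
        simp only [Matrix.mul_assoc]
    _ = 0 := by rw [h, Matrix.mul_zero, Matrix.zero_mul]

end Gram

/-! ### Splittings for the five cases -/

section Splittings

variable {F : Type*} [Field F]

/-- The splitting in the semisimple case. -/
def splittingGeneric {ν : F} (h1 : ν ≠ 1) (h2 : ν ≠ 2) (h4 : ν ≠ 4) :
    Splitting F ν (Fin 5) (Fin 3) where
  u := (ν - 1) • 1 - ones F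
  v := 1
  u' := gramInv ν
  v' := 1
  u'_mul_u := gramInv_mul h1 h4
  v_mul_v' := one_mul 1
  u_mul_v := Matrix.mul_one _
  ι := id
  ι_inj := Function.injective_id
  val_ne i := by
    have h1' : ν - 1 ≠ 0 := sub_ne_zero.2 h1
    have h2' : ν - 2 ≠ 0 := sub_ne_zero.2 h2
    fin_cases i <;> simp [val, h1', h2']
  val_eq a ha := absurd rfl (ha a)
  mult_eq i s t _ h := absurd rfl (h (fib t))

/-- The splitting if the last valency is zero and the Gram matrix is regular. -/
def splittingTwo {ν : F} (h0 : (2 : F) ≠ 0) (h2 : ν = 2) : Splitting F ν (Fin 4) (Fin 3) where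
  u := (ν - 1) • 1 - ones F
  v := 1
  u' := gramInv ν
  v' := 1
  u'_mul_u := by
    refine gramInv_mul ?_ ?_
    · rw [h2]
      intro h
      exact one_ne_zero (α := F) (by linear_combination h)
    · rw [h2]
      intro h
      exact h0 (by linear_combination -h)
  v_mul_v' := one_mul 1
  u_mul_v := Matrix.mul_one _
  ι := Fin.castSucc
  ι_inj := Fin.castSucc_injective _
  val_ne i := by
    have h1 : (2 : F) - 1 ≠ 0 := by norm_num
    subst h2
    fin_cases i <;> simp [val, h1]
  val_eq a ha := by
    have : a = 4 := by
      revert ha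
      revert a
      decide
    subst this
    simp [val, h2]
  mult_eq i s t _ h := by
    rcases t with j | j
    · exfalso
      revert h
      revert j
      decide
    · simp [mult, h2]

/-- The left factor of the Gram matrix of rank two. -/
def rankTwoLeft (F : Type*) [Field F] : Matrix (Fin 3) (Fin 2) F := !![2, -1; -1, 2; -1, -1]

/-- The right factor of the Gram matrix of rank two. -/
def rankTwoRight (F : Type*) [Field F] : Matrix (Fin 2) (Fin 3) F := !![1, 0, -1; 0, 1, -1]

/-- At `ν = 4` the block `g = 3 • 1 - ones` satisfies `g² = 3g`, so its full rank factors multiply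
to `3` in the opposite order. This is where `3 ≠ 0` enters. -/
theorem rankTwo_left_inv (h3 : (3 : F) ≠ 0) :
    (3 : F)⁻¹ • rankTwoRight F * rankTwoLeft F = 1 := by
  have : rankTwoRight F * rankTwoLeft F = (3 : F) • 1 := by
    ext i j
    fin_cases i <;> fin_cases j <;>
      simp [rankTwoRight, rankTwoLeft, Matrix.mul_apply, Fin.sum_univ_three] <;> norm_num
  rw [Matrix.smul_mul, this, smul_smul, inv_mul_cancel₀ h3, one_smul]

theorem rankTwo_right_inv : rankTwoRight F * (!![1, 0; 0, 1; 0, 0] : Matrix (Fin 3) (Fin 2) F) = 1 := by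
  ext i j
  fin_cases i <;> fin_cases j <;> simp [rankTwoRight, Matrix.mul_apply, Fin.sum_univ_three]

theorem rankTwo_mul {ν : F} (h4 : ν = 4) :
    rankTwoLeft F * rankTwoRight F = (ν - 1) • 1 - ones F := by
  subst h4
  ext i j
  fin_cases i <;> fin_cases j <;>
    simp [rankTwoRight, rankTwoLeft, Matrix.mul_apply, Fin.sum_univ_two, ones] <;> norm_num

/-- The splitting in characteristic two. -/
def splittingCharTwo {ν : F} (h0 : (2 : F) = 0) (h4 : ν = 4) : Splitting F ν (Fin 4) (Fin 2) where
  u := rankTwoLeft F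
  v := rankTwoRight F
  u' := (3 : F)⁻¹ • rankTwoRight F
  v' := !![1, 0; 0, 1; 0, 0]
  u'_mul_u := rankTwo_left_inv fun h => one_ne_zero (α := F) (by linear_combination h - h0)
  v_mul_v' := rankTwo_right_inv
  u_mul_v := rankTwo_mul h4
  ι := Fin.castSucc
  ι_inj := Fin.castSucc_injective _
  val_ne i := by
    have h1 : ν - 1 ≠ 0 := fun h => one_ne_zero (α := F) (by linear_combination -h + h4 + 2 * h0)
    fin_cases i <;> simp [val, h1]
  val_eq a ha := by
    have : a = 4 := by
      revert ha
      revert a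
      decide
    subst this
    have : ν - 2 = 0 := by linear_combination h4 + h0
    simp [val, this]
  mult_eq i s t _ h := by
    rcases t with j | j
    · exfalso
      revert h
      revert j
      decide
    · have : ν - 2 = 0 := by linear_combination h4 + h0
      simp [mult, this]

/-- The splitting if the Gram matrix has rank two and all valencies are nonzero. -/
def splittingFour {ν : F} (h0 : (2 : F) ≠ 0) (h3 : (3 : F) ≠ 0) (h4 : ν = 4) :
    Splitting F ν (Fin 5) (Fin 2) where
  u := rankTwoLeft F
  v := rankTwoRight F
  u' := (3 : F)⁻¹ • rankTwoRight F
  v' := !![1, 0; 0, 1; 0, 0]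
  u'_mul_u := rankTwo_left_inv h3
  v_mul_v' := rankTwo_right_inv
  u_mul_v := rankTwo_mul h4
  ι := id
  ι_inj := Function.injective_id
  val_ne i := by
    have h1' : ν - 1 ≠ 0 := fun h => h3 (by linear_combination h - h4)
    have h2' : ν - 2 ≠ 0 := fun h => h0 (by linear_combination h - h4)
    fin_cases i <;> simp [val, h1', h2']
  val_eq a ha := absurd rfl (ha a)
  mult_eq i s t _ h := absurd rfl (h (fib t))

/-- The splitting if all nontrivial valencies are zero. -/
def splittingOne {ν : F} (h1 : ν = 1) : Splitting F ν (Fin 1) (Fin 1) where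
  -- At `ν = 1` the block is `-ones`, a column of `-1` times a row of `1`; the one-sided inverses
  -- pick out the first entry.
  u := of fun _ _ => -1
  v := of fun _ _ => 1
  u' := of fun _ j => if j = 0 then -1 else 0
  v' := of fun i _ => if i = 0 then 1 else 0
  u'_mul_u := by
    ext i j
    simp [Matrix.mul_apply, Matrix.one_apply, Subsingleton.elim i j]
  v_mul_v' := by
    ext i j
    simp [Matrix.mul_apply, Matrix.one_apply, Subsingleton.elim i j]
  u_mul_v := by
    ext i j
    simp [Matrix.mul_apply, ones, h1]
  ι := fun _ => 0
  ι_inj := Function.injective_of_subsingleton _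
  val_ne i := by simp [val]
  val_eq a ha := by
    have h := ha 0
    fin_cases a <;> simp [val, h1] at h ⊢
  mult_eq i s t hs := by
    exfalso
    revert hs
    revert s
    decide

end Splittings

/-! ### Explicit kernels when the Gram matrix is singular -/

section Gram

variable {F : Type*} [Field F]

/-- Entrywise form of the kernel condition: only row, column and total sums enter, because the
singular block is a scalar minus `ones`. -/
theorem gram_mul_mul_gram_eq_zero_iff {ν : F} {β : Matrix Idx Idx F} :
    gram ν * β * gram ν = 0 ↔ (∀ i j, β (.inl i) (.inl j) = 0) ∧
      (∀ i j, (ν - 1) * β (.inl i) (.inr j) = ∑ k, β (.inl i) (.inr k)) ∧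
      (∀ i j, (ν - 1) * β (.inr i) (.inl j) = ∑ k, β (.inr k) (.inl j)) ∧
      ∀ i j, (ν - 1) ^ 2 * β (.inr i) (.inr j) - (ν - 1) * ∑ k, β (.inr i) (.inr k)
        - (ν - 1) * ∑ k, β (.inr k) (.inr j) + ∑ k, ∑ l, β (.inr k) (.inr l) = 0 := by
  rw [gram_mul_mul_gram, ← fromBlocks_zero, fromBlocks_inj]
  refine and_congr ?_ (and_congr ?_ (and_congr ?_ ?_))
  · simp only [← Matrix.ext_iff, toBlocks₁₁, of_apply, Matrix.zero_apply]
  · simp only [← Matrix.ext_iff, toBlocks₁₂, of_apply, Matrix.mul_sub,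
      mul_ones_apply, Matrix.mul_smul, Matrix.mul_one, Matrix.smul_apply,
      smul_eq_mul, Fin.sum_univ_three, sub_eq_zero]
  · simp only [← Matrix.ext_iff, toBlocks₂₁, of_apply, Matrix.sub_mul,
      ones_mul_apply, Matrix.smul_mul, Matrix.one_mul, Matrix.smul_apply,
      smul_eq_mul, Fin.sum_univ_three, sub_eq_zero]
  · simp only [← Matrix.ext_iff, toBlocks₂₂, of_apply, Matrix.zero_apply, Matrix.sub_mul,
      Matrix.sub_apply, ones_mul_apply, Matrix.smul_mul, Matrix.one_mul, Matrix.smul_apply,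
      smul_eq_mul, Fin.sum_univ_three, Matrix.mul_sub, mul_ones_apply, Matrix.mul_smul,
      Matrix.mul_one]
    refine forall_congr' fun i => forall_congr' fun j => ?_
    ring_nf

end Gram

namespace Frame

variable {F : Type*} [Field F] {X H : Type*} [Fintype X] [DecidableEq X] [Fintype H]
    [DecidableEq H] {ν : F} {σ ρ : Type*} [Fintype σ] [DecidableEq σ] [Fintype ρ] [DecidableEq ρ]
    (P : Splitting F ν σ ρ) (S : Frame F X H ν)

/-- The incidences of the copy `s` with the three copies in the last fibre, minus a block. -/
def rowSum (s : Idx) : Matrix X X F := ∑ j, S.N s (.inr j) - S.J (fib s) 4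

/-- The incidences of the three copies in the last fibre with the copy `s`, minus a block. -/
def colSum (s : Idx) : Matrix X X F := ∑ j, S.N (.inr j) s - S.J 4 (fib s)

/-- The coefficients of the sum of incidences of a row. -/
def rowCoef (F : Type*) [Field F] (s : Idx) : Coef F :=
  (-single (fib s) 4 1, ∑ j, single s (.inr j) 1, 0)

/-- The coefficients of the sum of incidences of a column. -/
def colCoef (F : Type*) [Field F] (s : Idx) : Coef F :=
  (-single 4 (fib s) 1, ∑ j, single (.inr j) s 1, 0)

theorem mat_rowCoef (s : Idx) : S.mat (rowCoef F s) = S.rowSum s := by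
  have : rowCoef F s = ∑ j : Fin 3, ((0, single s (.inr j) 1, 0) : Coef F)
      - (single (fib s) 4 1, 0, 0) := by
    refine Prod.ext ?_ (Prod.ext ?_ ?_) <;> simp [rowCoef, Prod.fst_sum, Prod.snd_sum]
  rw [this, map_sub, map_sum]
  rfl

theorem mat_colCoef (s : Idx) : S.mat (colCoef F s) = S.colSum s := by
  have : colCoef F s = ∑ j : Fin 3, ((0, single (.inr j) s 1, 0) : Coef F)
      - (single 4 (fib s) 1, 0, 0) := by
    refine Prod.ext ?_ (Prod.ext ?_ ?_) <;> simp [colCoef, Prod.fst_sum, Prod.snd_sum]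
  rw [this, map_sub, map_sum]
  rfl

theorem fibMat_mul_single_mul_multMat (ν : F) (s t : Idx) :
    fibMat F * single s t (1 : F) * multMat ν = mult ν t • single (fib s) (fib t) (1 : F) := by
  ext a b
  rw [Matrix.mul_apply, Finset.sum_eq_single t, Matrix.mul_single_apply_same, Matrix.smul_apply,
    single_apply]
  · simp only [fibMat, multMat, of_apply, eq_comm (a := a), eq_comm (a := b), ite_and]
    split_ifs <;> simp
  · intro r _ hr
    rw [Matrix.mul_single_apply_of_ne _ _ _ _ _ hr, zero_mul]
  · simp

theorem single_mul_diagonal (ν : F) (a b : Fin 5) :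
    single a b (1 : F) * diagonal (val ν) = val ν b • single a b (1 : F) := by
  ext c d
  rw [mul_diagonal, Matrix.smul_apply, single_apply, smul_eq_mul]
  split_ifs with h
  · rw [h.2, mul_comm]
  · simp

theorem val_fib (ν : F) (s : Idx) : val ν (fib s) = (ν - 1) * mult ν s := by
  rcases s with i | i
  · fin_cases i <;> simp [val, fib, mult]
  · rfl

/-- At `ν = 4` the three copies in the last fibre contribute `3 · 2`, which is its valency, so the
block subtracted in `rowCoef` cancels the action exactly. -/
theorem act_rowCoef (s : Idx) : (rowCoef F s).act 4 = 0 := by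
  have h := val_fib (4 : F) (.inr 0)
  simp only [fib, Sum.elim_inr, mult] at h
  simp only [Coef.act, rowCoef, Matrix.mul_sum, Matrix.sum_mul, fibMat_mul_single_mul_multMat,
    Matrix.neg_mul, single_mul_diagonal, zero_smul, add_zero, fib, Sum.elim_inr, mult, h,
    Finset.sum_const, Finset.card_univ, Fintype.card_fin]
  module

theorem act_colCoef (s : Idx) : (colCoef F s).act 4 = 0 := by
  simp only [Coef.act, colCoef, Matrix.mul_sum, Matrix.sum_mul, fibMat_mul_single_mul_multMat,
    Matrix.neg_mul, single_mul_diagonal, zero_smul, add_zero, val_fib]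
  have h4 : ∀ j, fib (.inr j) = 4 := fun _ => rfl
  simp only [h4, Finset.sum_const, Finset.card_univ, Fintype.card_fin]
  module

theorem hom_rowCoef (h4 : ν = 4) (s : Idx) : P.hom (rowCoef F s) = 0 := by
  subst h4
  rw [P.hom_eq_zero_iff]
  refine ⟨rfl, ?_, by simp [act_rowCoef]⟩
  rw [gram_mul_mul_gram_eq_zero_iff]
  rcases s with s | s <;> simp [rowCoef, Matrix.sum_apply, single_apply, ite_and]
  · intro i
    split_ifs <;> norm_num
  · intro i
    split_ifs <;> norm_num

theorem hom_colCoef (h4 : ν = 4) (s : Idx) : P.hom (colCoef F s) = 0 := by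
  subst h4
  rw [P.hom_eq_zero_iff]
  refine ⟨rfl, ?_, by simp [act_colCoef]⟩
  rw [gram_mul_mul_gram_eq_zero_iff]
  rcases s with s | s <;> simp [colCoef, Matrix.sum_apply, single_apply, ite_and]
  · intro i
    split_ifs <;> norm_num
  · intro i
    split_ifs <;> norm_num

/-- The space spanned by the blocks of weight zero and the sums of rows and columns. -/
def spanFour : Submodule F (Matrix X X F) :=
  Submodule.span F ({M | ∃ a b, val ν a * val ν b = 0 ∧ M = S.J a b} ∪
    (Set.range S.rowSum ∪ Set.range S.colSum))

/-- The Gram block has kernel spanned by the all-one vector, so the solutions of `g β g = 0` are the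
sums of constant rows and constant columns in the last fibre. The blocks built into `rowCoef` and
`colCoef` lift these to the kernel, in characteristic 2 as well. -/
theorem kerImage_eq_spanFour (h3 : (3 : F) ≠ 0) (h4 : ν = 4) : S.kerImage P = S.spanFour := by
  refine kerImage_eq P S (fun a b h => Submodule.subset_span (.inl ⟨a, b, h, rfl⟩)) ?_ ?_
  · intro β hβ
    obtain ⟨e1, e2, e3, e4⟩ := gram_mul_mul_gram_eq_zero_iff.1 hβ
    have n1 : ν - 1 = 3 := by rw [h4]; norm_num
    rw [n1] at e2 e3 e4
    have f2 : ∀ i j, β (.inl i) (.inr j) = β (.inl i) (.inr 0) := fun i j =>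
      mul_left_cancel₀ h3 ((e2 i j).trans (e2 i 0).symm)
    have f3 : ∀ i j, β (.inr i) (.inl j) = β (.inr 0) (.inl j) := fun i j =>
      mul_left_cancel₀ h3 ((e3 i j).trans (e3 0 j).symm)
    -- In the mixed second difference of the equations all row, column and total sums cancel,
    -- leaving 9 times the mixed difference of `β`.
    have f4 : ∀ i j, β (.inr i) (.inr j) = β (.inr i) (.inr 0) +
        (β (.inr 0) (.inr j) - β (.inr 0) (.inr 0)) := fun i j =>
      mul_left_cancel₀ (mul_ne_zero h3 h3)
        (by linear_combination e4 i j - e4 i 0 - e4 0 j + e4 0 0)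
    -- Column coefficients normalized so that column `0` of the last fibre is accounted for by the
    -- rows alone.
    let c : Idx → F := Sum.elim (fun j => β (.inr 0) (.inl j))
      fun j => β (.inr 0) (.inr j) - β (.inr 0) (.inr 0)
    refine ⟨∑ s, β s (.inr 0) • rowCoef F s + ∑ s, c s • colCoef F s, ?_, ?_, ?_⟩
    · simp [hom_rowCoef P h4, hom_colCoef P h4]
    · ext s t
      simp only [Prod.snd_add, Prod.fst_add, Prod.snd_sum, Prod.fst_sum, Prod.smul_snd,
        Prod.smul_fst, rowCoef, colCoef, Matrix.add_apply, Matrix.sum_apply, Matrix.smul_apply,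
        single_apply, smul_eq_mul]
      rcases s with i | i <;> rcases t with j | j <;>
        simp [c, e1, f2 i j, f3 i j, f4 i j, ite_and]
    · rw [map_add, map_sum, map_sum]
      refine Submodule.add_mem _ (Submodule.sum_mem _ fun s _ => ?_)
        (Submodule.sum_mem _ fun s _ => ?_)
      · rw [map_smul, mat_rowCoef]
        exact Submodule.smul_mem _ _ (Submodule.subset_span (.inr (.inl ⟨s, rfl⟩)))
      · rw [map_smul, mat_colCoef]
        exact Submodule.smul_mem _ _ (Submodule.subset_span (.inr (.inr ⟨s, rfl⟩)))
  · rw [spanFour, Submodule.span_le]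
    rintro _ (⟨a, b, h, rfl⟩ | ⟨s, rfl⟩ | ⟨s, rfl⟩)
    · exact J_mem_kerImage P S h
    · exact ⟨_, hom_rowCoef P h4 s, S.mat_rowCoef s⟩
    · exact ⟨_, hom_colCoef P h4 s, S.mat_colCoef s⟩

/-- The space spanned by the blocks of weight zero and the differences of incidences between
the same fibres. -/
def spanOne : Submodule F (Matrix X X F) :=
  Submodule.span F ({M | ∃ a b, val ν a * val ν b = 0 ∧ M = S.J a b} ∪
    {M | ∃ i j, M = S.N (.inl i) (.inr j) - S.N (.inl i) (.inr 0)} ∪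
    {M | ∃ i j, M = S.N (.inr j) (.inl i) - S.N (.inr 0) (.inl i)} ∪
    {M | ∃ i j, M = S.N (.inr i) (.inr j) - S.N (.inr 0) (.inr 0)})

/-- At `ν = 1` only the fibre 0 has nonzero valency and no copy lies in it, so the action imposes no
condition on `β`. The Gram condition reduces to vanishing sums, and coefficients with zero sum are
spanned by differences. -/
theorem kerImage_eq_spanOne (h1 : ν = 1) : S.kerImage P = S.spanOne := by
  have hι : ∀ i, P.ι i = 0 := by
    intro i
    have := P.val_ne i
    generalize P.ι i = a at this
    fin_cases a <;> simp [val, h1] at this ⊢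
  have hact : ∀ β : Matrix Idx Idx F, Coef.act ν (0, β, 0) 0 0 = 0 := by
    intro β
    have : ∀ s : Idx, fibMat F 0 s = 0 := by
      intro s
      have : 0 ≠ fib s := by revert s; decide
      simp [fibMat, this]
    simp [Coef.act, Matrix.mul_apply, this, lastFib]
  have hker : ∀ β : Matrix Idx Idx F, gram ν * β * gram ν = 0 → P.hom (0, β, 0) = 0 := by
    intro β hβ
    rw [P.hom_eq_zero_iff]
    exact ⟨rfl, hβ, fun i j => by rw [hι, hι, hact]⟩
  refine kerImage_eq P S
    (fun a b h => Submodule.subset_span (.inl (.inl (.inl ⟨a, b, h, rfl⟩)))) ?_ ?_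
  · intro β hβ
    refine ⟨(0, β, 0), hker β hβ, rfl, ?_⟩
    obtain ⟨e1, e2, e3, e4⟩ := gram_mul_mul_gram_eq_zero_iff.1 hβ
    simp only [h1, sub_self, zero_mul, ne_eq, OfNat.ofNat_ne_zero, not_false_eq_true, zero_pow,
      zero_add] at e2 e3 e4
    have key : S.mat (0, β, 0) =
        ∑ i, ∑ j, β (.inl i) (.inr j) • (S.N (.inl i) (.inr j) - S.N (.inl i) (.inr 0)) +
        ∑ i, ∑ j, β (.inr j) (.inl i) • (S.N (.inr j) (.inl i) - S.N (.inr 0) (.inl i)) +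
        ∑ i, ∑ j, β (.inr i) (.inr j) • (S.N (.inr i) (.inr j) - S.N (.inr 0) (.inr 0)) := by
      rw [mat_eq_sum]
      simp only [Fintype.sum_sum_type, e1, smul_sub, Finset.sum_sub_distrib, ← Finset.sum_smul,
        Matrix.zero_apply, zero_smul, Finset.sum_const_zero, zero_add, add_zero,
        Finset.sum_add_distrib]
      -- The terms at the reference index collect into the sums that vanish.
      simp only [← e2 _ 0, ← e3 0 _]
      rw [e4 0 0]
      simp only [zero_smul, Finset.sum_const_zero, sub_zero]
      rw [Finset.sum_comm]
      abel
    rw [key]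
    refine Submodule.add_mem _ (Submodule.add_mem _ ?_ ?_) ?_ <;>
      refine Submodule.sum_mem _ fun i _ => Submodule.sum_mem _ fun j _ =>
        Submodule.smul_mem _ _ (Submodule.subset_span ?_)
    · exact .inl (.inl (.inr ⟨i, j, rfl⟩))
    · exact .inl (.inr ⟨i, j, rfl⟩)
    · exact .inr ⟨i, j, rfl⟩
  · have hN : ∀ s t s' t' : Idx, gram ν * (single s t 1 - single s' t' 1) * gram ν = 0 →
        S.N s t - S.N s' t' ∈ S.kerImage P := by
      intro s t s' t' h
      refine ⟨_, hker _ h, ?_⟩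
      rw [N, N, ← map_sub]
      simp
    rw [spanOne, Submodule.span_le]
    rintro _ (((⟨a, b, h, rfl⟩ | ⟨i, j, rfl⟩) | ⟨i, j, rfl⟩) | ⟨i, j, rfl⟩)
    · exact J_mem_kerImage P S h
    all_goals
      apply hN
      rw [gram_mul_mul_gram_eq_zero_iff]
      simp [h1, single_apply, ite_and]

end Frame

namespace Frame

variable {F : Type*} [Field F] {X H : Type*} [Fintype X] [DecidableEq X] [Fintype H]
    [DecidableEq H] {ν : F} (S : Frame F X H ν)

theorem N_transpose (s t : Idx) : (S.N s t)ᵀ = S.N t s := by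
  ext y z
  simp only [transpose_apply, N_apply, mul_comm]

theorem J_transpose (a b : Fin 5) : (S.J a b)ᵀ = S.J b a := by
  ext y z
  simp only [transpose_apply, J_apply, mul_comm]

end Frame

/-! ### Translation into the listed spanning sets -/

section Dictionary

variable {G : Type*} [Group G] [Fintype G] [DecidableEq G] {F : Type*} [Field F]
  {x : CayleyTriple G} (hG : ∀ g : G, g * g = 1) (hn : 3 ≤ Fintype.card G)

theorem triple_inl_inr {i j : Fin 3} (h : i ≠ j) :
    (cayleyScheme G hn).triple F x (fib (.inl i)) (fib (.inl j)) 4 =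
      (frame F x hG hn).N (.inl i) (.inr j) := by
  have h' : fib (.inl i) ≠ fib (.inr j) := by
    revert i j
    decide
  have := triple_eq (F := F) (x := x) hG hn (i := j) (.inr ⟨i, h, rfl⟩) (.inl rfl)
  rwa [if_neg h', sub_zero] at this

theorem triple_inr_inl {i j : Fin 3} (h : j ≠ i) :
    (cayleyScheme G hn).triple F x 4 (fib (.inl i)) (fib (.inl j)) =
      (frame F x hG hn).N (.inr i) (.inl j) := by
  have h' : fib (.inr i) ≠ fib (.inl j) := by
    revert i j
    decide
  have := triple_eq (F := F) (x := x) hG hn (i := i) (.inl rfl) (.inr ⟨j, h, rfl⟩)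
  rwa [if_neg h', sub_zero] at this

theorem triple_inl_inl {i j k : Fin 3} (hij : i ≠ j) (hik : i ≠ k) (hjk : j ≠ k) :
    (cayleyScheme G hn).triple F x (fib (.inl i)) (fib (.inl j)) (fib (.inl k)) =
      (frame F x hG hn).N (.inl i) (.inl k) := by
  have h' : fib (.inl i) ≠ fib (.inl k) := by
    clear hij hjk
    revert i k
    decide
  have := triple_eq (F := F) (x := x) hG hn (i := j) (.inr ⟨i, hij, rfl⟩) (.inr ⟨k, hjk.symm, rfl⟩)
  rwa [if_neg h', sub_zero] at this

theorem triple_inr_inr (i : Fin 3) : (cayleyScheme G hn).triple F x 4 (fib (.inl i)) 4 =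
    (frame F x hG hn).N (.inr i) (.inr i) - (frame F x hG hn).E := by
  have := triple_eq (F := F) (x := x) hG hn (i := i) (s := .inr i) (t := .inr i) (.inl rfl) (.inl rfl)
  rw [if_pos rfl] at this
  exact this.trans (by rw [← dualIdem_four]; rfl)

theorem quintuple_inr_inr {i j k : Fin 3} (hij : j ≠ i) (hjk : j ≠ k) :
    (cayleyScheme G hn).quintuple F x 4 (fib (.inl i)) (fib (.inl j)) (fib (.inl k)) 4 =
      (frame F x hG hn).N (.inr i) (.inr k) := by
  rw [quintuple_eq, triple_inr_inl hG hn hij, triple_inl_inr hG hn hjk, Frame.N_mul_N]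

theorem quintuple_inl_inr {i j k : Fin 3} (hij : i ≠ j) (hik : i ≠ k) (hjk : j ≠ k) :
    (cayleyScheme G hn).quintuple F x (fib (.inl i)) (fib (.inl j)) (fib (.inl k)) (fib (.inl i)) 4
      = (frame F x hG hn).N (.inl i) (.inr i) := by
  rw [quintuple_eq, triple_inl_inl hG hn hij hik hjk, triple_inl_inr hG hn hik.symm, Frame.N_mul_N]

theorem triple_table :
    let t := (cayleyScheme G hn).triple F x
    let N := (frame F x hG hn).N
    let E := (frame F x hG hn).E
    t 1 2 4 = N (.inl 0) (.inr 1) ∧ t 1 3 4 = N (.inl 0) (.inr 2) ∧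
    t 2 1 4 = N (.inl 1) (.inr 0) ∧ t 2 3 4 = N (.inl 1) (.inr 2) ∧
    t 3 1 4 = N (.inl 2) (.inr 0) ∧ t 3 2 4 = N (.inl 2) (.inr 1) ∧
    t 4 1 4 = N (.inr 0) (.inr 0) - E ∧ t 4 2 4 = N (.inr 1) (.inr 1) - E ∧
    t 4 3 4 = N (.inr 2) (.inr 2) - E :=
  ⟨triple_inl_inr hG hn (i := 0) (j := 1) (by decide),
    triple_inl_inr hG hn (i := 0) (j := 2) (by decide),
    triple_inl_inr hG hn (i := 1) (j := 0) (by decide),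
    triple_inl_inr hG hn (i := 1) (j := 2) (by decide),
    triple_inl_inr hG hn (i := 2) (j := 0) (by decide),
    triple_inl_inr hG hn (i := 2) (j := 1) (by decide),
    triple_inr_inr hG hn 0, triple_inr_inr hG hn 1, triple_inr_inr hG hn 2⟩

theorem quintuple_table :
    let q := (cayleyScheme G hn).quintuple F x
    let N := (frame F x hG hn).N
    q 1 2 3 1 4 = N (.inl 0) (.inr 0) ∧ q 2 1 3 2 4 = N (.inl 1) (.inr 1) ∧
    q 3 1 2 3 4 = N (.inl 2) (.inr 2) ∧
    q 4 1 2 3 4 = N (.inr 0) (.inr 2) ∧ q 4 1 3 2 4 = N (.inr 0) (.inr 1) ∧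
    q 4 2 1 3 4 = N (.inr 1) (.inr 2) ∧ q 4 2 3 1 4 = N (.inr 1) (.inr 0) ∧
    q 4 3 1 2 4 = N (.inr 2) (.inr 1) ∧ q 4 3 2 1 4 = N (.inr 2) (.inr 0) :=
  ⟨quintuple_inl_inr hG hn (i := 0) (j := 1) (k := 2) (by decide) (by decide) (by decide),
    quintuple_inl_inr hG hn (i := 1) (j := 0) (k := 2) (by decide) (by decide) (by decide),
    quintuple_inl_inr hG hn (i := 2) (j := 0) (k := 1) (by decide) (by decide) (by decide),
    quintuple_inr_inr hG hn (i := 0) (j := 1) (k := 2) (by decide) (by decide),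
    quintuple_inr_inr hG hn (i := 0) (j := 2) (k := 1) (by decide) (by decide),
    quintuple_inr_inr hG hn (i := 1) (j := 0) (k := 2) (by decide) (by decide),
    quintuple_inr_inr hG hn (i := 1) (j := 2) (k := 0) (by decide) (by decide),
    quintuple_inr_inr hG hn (i := 2) (j := 0) (k := 1) (by decide) (by decide),
    quintuple_inr_inr hG hn (i := 2) (j := 1) (k := 0) (by decide) (by decide)⟩

theorem setB4_eq (p : ℕ) [CharP F p] : (cayleyScheme G hn).setB4 F p x =
    {M | ∃ a b, val (Fintype.card G : F) a * val (Fintype.card G : F) b = 0 ∧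
      M = (frame F x hG hn).J a b} := by
  ext M
  simp only [AssociationScheme.setB4, Set.mem_ofPred_eq, block_eq hG, ← CharP.cast_eq_zero_iff F p,
    Nat.cast_mul, valency_cast hn x hG]

theorem forall_fin_three {P : Fin 3 → Prop} : (∀ i, P i) ↔ P 0 ∧ P 1 ∧ P 2 :=
  ⟨fun h => ⟨h 0, h 1, h 2⟩, fun ⟨h0, h1, h2⟩ i => by fin_cases i <;> assumption⟩

theorem mem_iff_mkQ_eq_zero {M : Type*} [AddCommGroup M] [Module F M] (V : Submodule F M) (m : M) :
    m ∈ V ↔ V.mkQ m = 0 := by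
  rw [Submodule.mkQ_apply, Submodule.Quotient.mk_eq_zero]

/-- Lets two spanning sets be compared by linear relations: modulo an arbitrary `V`, membership
becomes an equation in the quotient. -/
theorem span_eq_span_of_subset_iff {M : Type*} [AddCommGroup M] [Module F M] {A B : Set M}
    (h : ∀ V : Submodule F M, A ⊆ V ↔ B ⊆ V) : Submodule.span F A = Submodule.span F B :=
  le_antisymm (Submodule.span_le.2 ((h _).2 Submodule.subset_span))
    (Submodule.span_le.2 ((h _).1 Submodule.subset_span))

section Relations

variable {M : Type*} [AddCommGroup M] (a : Fin 3 → Fin 3 → M)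

theorem forall_sub_eq_zero_iff : (∀ i j, a i j - a i 0 = 0) ↔
    a 0 1 - a 0 2 = 0 ∧ a 1 0 - a 1 2 = 0 ∧ a 2 0 - a 2 1 = 0 ∧
      a 0 0 - a 0 2 = 0 ∧ a 1 1 - a 1 2 = 0 ∧ a 2 2 - a 2 1 = 0 := by
  simp only [forall_fin_three]
  generalize a 0 0 = a00, a 0 1 = a01, a 0 2 = a02, a 1 0 = a10, a 1 1 = a11, a 1 2 = a12,
    a 2 0 = a20, a 2 1 = a21, a 2 2 = a22
  constructor <;> rintro ⟨⟩ <;> and_intros <;> grind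

theorem forall_sub_corner_eq_zero_iff (e : M) : (∀ i j, a i j - a 0 0 = 0) ↔
    a 0 0 - e - (a 1 1 - e) = 0 ∧ a 0 0 - e - (a 2 2 - e) = 0 ∧ a 0 2 - e - (a 0 0 - e) = 0 ∧
      a 0 2 - a 0 1 = 0 ∧ a 0 2 - a 1 2 = 0 ∧ a 0 2 - a 1 0 = 0 ∧ a 0 2 - a 2 1 = 0 ∧
      a 0 2 - a 2 0 = 0 := by
  simp only [forall_fin_three]
  generalize a 0 0 = a00, a 0 1 = a01, a 0 2 = a02, a 1 0 = a10, a 1 1 = a11, a 1 2 = a12,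
    a 2 0 = a20, a 2 1 = a21, a 2 2 = a22
  constructor <;> rintro ⟨⟩ <;> and_intros <;> grind

/-- The first three equations are the column sums. Given these, the last two are the sums of rows 2
and 0; row 1 follows because rows and columns have the same total `3J`. The matrix `e` cancels
throughout. -/
theorem forall_row_col_eq_zero_iff (e J : M) :
    ((∀ i, a i 0 + a i 1 + a i 2 - J = 0) ∧ ∀ j, a 0 j + a 1 j + a 2 j - J = 0) ↔
    J - e - (a 0 0 - e) - a 1 0 - a 2 0 = 0 ∧ J - e - (a 1 1 - e) - a 0 1 - a 2 1 = 0 ∧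
      J - e - (a 2 2 - e) - a 0 2 - a 1 2 = 0 ∧ a 0 2 + a 1 2 - a 2 1 - a 2 0 = 0 ∧
      a 1 0 + a 2 0 - a 0 2 - a 0 1 = 0 := by
  simp only [forall_fin_three]
  generalize a 0 0 = a00, a 0 1 = a01, a 0 2 = a02, a 1 0 = a10, a 1 1 = a11, a 1 2 = a12,
    a 2 0 = a20, a 2 1 = a21, a 2 2 = a22
  constructor <;> rintro ⟨⟩ <;> and_intros <;> grind

theorem forall_row_col_eq_zero_iff_of_two (e : M) (h2 : ∀ m : M, m + m = 0) :
    ((∀ i, a i 0 + a i 1 + a i 2 = 0) ∧ ∀ j, a 0 j + a 1 j + a 2 j = 0) ↔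
    e + (a 0 0 - e) + a 1 0 + a 2 0 = 0 ∧ e + (a 1 1 - e) + a 0 1 + a 2 1 = 0 ∧
      e + (a 2 2 - e) + a 0 2 + a 1 2 = 0 ∧ a 0 2 + a 1 2 + a 2 1 + a 2 0 = 0 ∧
      a 1 0 + a 2 0 + a 0 2 + a 0 1 = 0 := by
  have hs (m n : M) : m - n = m + n := by
    rw [sub_eq_add_neg, neg_eq_of_add_eq_zero_left (h2 n)]
  simpa only [hs, zero_add, add_zero] using forall_row_col_eq_zero_iff a e 0

end Relations

theorem setOf_subset_iff {M : Type*} (f : Fin 3 → Fin 3 → M) (V : Set M) :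
    {m | ∃ i j, m = f i j} ⊆ V ↔ ∀ i j, f i j ∈ V :=
  ⟨fun h i j => h ⟨i, j, rfl⟩, by rintro h _ ⟨i, j, rfl⟩; exact h i j⟩

theorem spaceV1_eq (p : ℕ) [CharP F p] (h1 : (Fintype.card G : F) = 1) :
    (cayleyScheme G hn).spaceV1 F p x = (frame F x hG hn).spanOne := by
  obtain ⟨t12, t13, t21, t23, t31, t32, t1, t2, t3⟩ := triple_table (F := F) (x := x) hG hn
  obtain ⟨q1, q2, q3, q123, q132, q213, q231, q312, q321⟩ :=
    quintuple_table (F := F) (x := x) hG hn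
  have v4 : val (Fintype.card G : F) 4 = 0 := by simp [val, h1]
  refine span_eq_span_of_subset_iff fun V => ?_
  rw [setB4_eq hG]
  simp only [AssociationScheme.setC1, AssociationScheme.setD1, Set.image_insert_eq,
    Set.image_singleton, Set.union_subset_iff, Set.insert_subset_iff, Set.singleton_subset_iff,
    transpose_sub, Frame.N_transpose, t12, t13, t21, t23, t31, t32, t1, t2, t3, q1, q2, q3, q123,
    q132, q213, q231, q312, q321, SetLike.mem_coe, dualIdem_four hG, block_eq hG,
    setOf_subset_iff, mem_iff_mkQ_eq_zero V, map_sub]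
  rw [forall_sub_eq_zero_iff fun i j => V.mkQ ((frame F x hG hn).N (.inl i) (.inr j)),
    forall_sub_eq_zero_iff fun i j => V.mkQ ((frame F x hG hn).N (.inr j) (.inl i)),
    forall_sub_corner_eq_zero_iff (fun i j => V.mkQ ((frame F x hG hn).N (.inr i) (.inr j)))
      (V.mkQ (frame F x hG hn).E)]
  constructor
  · rintro ⟨⟨hB, -, hC⟩, hD, hD'⟩
    exact ⟨⟨⟨hB, hD⟩, hD'⟩, hC⟩
  · rintro ⟨⟨⟨hB, hD⟩, hD'⟩, hC⟩
    refine ⟨⟨hB, ?_, hC⟩, hD, hD'⟩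
    rw [← mem_iff_mkQ_eq_zero]
    exact hB ⟨4, 4, by rw [v4, mul_zero], rfl⟩

end Dictionary

section Relations

variable {M : Type*} [AddCommGroup M] (a : Fin 3 → Fin 3 → M)

theorem forall_row_eq_zero_iff (J : Fin 3 → M) : (∀ i, a i 0 + a i 1 + a i 2 - J i = 0) ↔
    J 0 - a 0 1 - a 0 2 - a 0 0 = 0 ∧ J 1 - a 1 0 - a 1 2 - a 1 1 = 0 ∧
      J 2 - a 2 0 - a 2 1 - a 2 2 = 0 := by
  rw [forall_fin_three]
  refine and_congr ?_ (and_congr ?_ ?_) <;> rw [← neg_eq_zero] <;> refine Eq.congr ?_ rfl <;> abel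

theorem forall_row_eq_zero_iff_of_two (h2 : ∀ m : M, m + m = 0) :
    (∀ i, a i 0 + a i 1 + a i 2 = 0) ↔
      a 0 1 + a 0 2 + a 0 0 = 0 ∧ a 1 0 + a 1 2 + a 1 1 = 0 ∧ a 2 0 + a 2 1 + a 2 2 = 0 := by
  have hs (m n : M) : m - n = m + n := by
    rw [sub_eq_add_neg, neg_eq_of_add_eq_zero_left (h2 n)]
  simpa only [hs, zero_add, add_zero, Pi.zero_apply] using forall_row_eq_zero_iff a 0

end Relations

theorem val_ne_zero {F : Type*} [Field F] {ν : F} (h1 : ν ≠ 1) (h2 : ν ≠ 2) (a : Fin 5) :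
    val ν a ≠ 0 := by
  have h1 := sub_ne_zero.2 h1
  have h2 := sub_ne_zero.2 h2
  fin_cases a <;> simp [val, h1, h2]

section Dictionary

variable {G : Type*} [Group G] [Fintype G] [DecidableEq G] {F : Type*} [Field F]
  {x : CayleyTriple G} (hG : ∀ g : G, g * g = 1) (hn : 3 ≤ Fintype.card G)

theorem idx_forall {P : Idx → Prop} : (∀ s, P s) ↔ (∀ i, P (.inl i)) ∧ ∀ i, P (.inr i) := Sum.forall

theorem spaceV3_eq (h2 : (2 : F) ≠ 0) (h3 : (3 : F) ≠ 0) (h4 : (Fintype.card G : F) = 4) :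
    (cayleyScheme G hn).spaceV3 F x = (frame F x hG hn).spanFour := by
  obtain ⟨t12, t13, t21, t23, t31, t32, t1, t2, t3⟩ := triple_table (F := F) (x := x) hG hn
  obtain ⟨q1, q2, q3, q123, q132, q213, q231, q312, q321⟩ :=
    quintuple_table (F := F) (x := x) hG hn
  -- No valency vanishes here, so there are no blocks of weight zero and `B₄` does not appear in
  -- `V₃`.
  have hB : {M | ∃ a b, val (Fintype.card G : F) a * val (Fintype.card G : F) b = 0 ∧
      M = (frame F x hG hn).J a b} = ∅ := by
    have hv := val_ne_zero (ν := (Fintype.card G : F))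
      (fun h => h3 (by linear_combination h - h4)) fun h => h2 (by linear_combination h - h4)
    refine Set.eq_empty_of_forall_notMem ?_
    rintro _ ⟨a, b, h, -⟩
    exact mul_ne_zero (hv a) (hv b) h
  refine span_eq_span_of_subset_iff fun V => ?_
  rw [hB, Set.empty_union]
  simp only [AssociationScheme.setC3, AssociationScheme.setD3, Set.image_insert_eq,
    Set.image_singleton, Set.union_subset_iff, Set.insert_subset_iff, Set.singleton_subset_iff,
    transpose_sub, Frame.N_transpose, t12, t13, t21, t23, t31, t32, t1, t2, t3, q1, q2, q3, q123,
    q132, q213, q231, q312, q321, SetLike.mem_coe, dualIdem_four hG, block_eq hG,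
    Frame.J_transpose, Set.range_subset_iff, idx_forall, Frame.rowSum, Frame.colSum,
    Fin.sum_univ_three, mem_iff_mkQ_eq_zero V, map_sub, map_add]
  have hr := forall_row_eq_zero_iff
    (fun i j => V.mkQ ((frame F x hG hn).N (.inl i) (.inr j)))
    fun i => V.mkQ ((frame F x hG hn).J (fib (.inl i)) 4)
  have hc := forall_row_eq_zero_iff
    (fun i j => V.mkQ ((frame F x hG hn).N (.inr j) (.inl i)))
    fun i => V.mkQ ((frame F x hG hn).J 4 (fib (.inl i)))
  have hrc := forall_row_col_eq_zero_iff
    (fun i j => V.mkQ ((frame F x hG hn).N (.inr i) (.inr j)))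
    (V.mkQ (frame F x hG hn).E) (V.mkQ ((frame F x hG hn).J 4 4))
  refine (and_congr hrc.symm (and_congr hr.symm hc.symm)).trans ?_
  exact ⟨fun ⟨⟨a, b⟩, c, d⟩ => ⟨⟨c, a⟩, d, b⟩, fun ⟨⟨c, a⟩, d, b⟩ => ⟨⟨a, b⟩, c, d⟩⟩

theorem spaceV2_eq_of_two [CharP F 2] (h4 : (Fintype.card G : F) = 4) :
    (cayleyScheme G hn).spaceV2 F 2 x = (frame F x hG hn).spanFour := by
  obtain ⟨t12, t13, t21, t23, t31, t32, t1, t2, t3⟩ := triple_table (F := F) (x := x) hG hn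
  obtain ⟨q1, q2, q3, q123, q132, q213, q231, q312, q321⟩ :=
    quintuple_table (F := F) (x := x) hG hn
  have h2 : (2 : F) = 0 := CharTwo.two_eq_zero
  have v4 : val (Fintype.card G : F) 4 = 0 := by
    have : (4 : F) - 2 = 0 := by linear_combination h2
    simp [val, h4, this]
  rw [AssociationScheme.spaceV2, if_pos rfl]
  refine span_eq_span_of_subset_iff fun V => ?_
  rw [setB4_eq hG, Set.union_assoc, Set.union_subset_iff]
  refine Iff.trans ?_ Set.union_subset_iff.symm
  refine and_congr_right fun hB => ?_
  -- The last fibre has zero valency, so every block that meets it is already in `B₄` and drops out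
  -- of the row and column sums.
  have hJ4 (b : Fin 5) : V.mkQ ((frame F x hG hn).J 4 b) = 0 :=
    (mem_iff_mkQ_eq_zero _ _).1 (hB ⟨4, b, by rw [v4, zero_mul], rfl⟩)
  have hJ (a : Fin 5) : V.mkQ ((frame F x hG hn).J a 4) = 0 :=
    (mem_iff_mkQ_eq_zero _ _).1 (hB ⟨a, 4, by rw [v4, mul_zero], rfl⟩)
  have hM (m : Matrix (CayleyTriple G) (CayleyTriple G) F ⧸ V) : m + m = 0 := by
    rw [← two_smul F, h2, zero_smul]
  simp only [AssociationScheme.setC2, AssociationScheme.setD2, Set.image_insert_eq,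
    Set.image_singleton, Set.union_subset_iff, Set.insert_subset_iff, Set.singleton_subset_iff,
    transpose_add, Frame.N_transpose, t12, t13, t21, t23, t31, t32, t1, t2, t3, q1, q2, q3, q123,
    q132, q213, q231, q312, q321, SetLike.mem_coe, dualIdem_four hG, block_eq hG,
    Set.range_subset_iff, idx_forall, Frame.rowSum, Frame.colSum,
    Fin.sum_univ_three, mem_iff_mkQ_eq_zero V, map_sub, map_add, hJ4, hJ, sub_zero, true_and]
  have hr := forall_row_eq_zero_iff_of_two
    (fun i j => V.mkQ ((frame F x hG hn).N (.inl i) (.inr j))) hM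
  have hc := forall_row_eq_zero_iff_of_two
    (fun i j => V.mkQ ((frame F x hG hn).N (.inr j) (.inl i))) hM
  have hrc := forall_row_col_eq_zero_iff_of_two
    (fun i j => V.mkQ ((frame F x hG hn).N (.inr i) (.inr j))) (V.mkQ (frame F x hG hn).E) hM
  refine (and_congr hrc.symm (and_congr hr.symm hc.symm)).trans ?_
  exact ⟨fun ⟨⟨a, b⟩, c, d⟩ => ⟨⟨c, a⟩, d, b⟩, fun ⟨⟨c, a⟩, d, b⟩ => ⟨⟨a, b⟩, c, d⟩⟩

end Dictionary
-- Assembly of the cases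
/-- The target of a splitting as a product of full matrix algebras. -/
def targetEquiv (F : Type*) [Field F] (m : ℕ) {k l : ℕ} (h : 3 + k = l) :
    Splitting.Target F (Fin m) (Fin k) ≃ₐ[F] FullMatrix m F × FullMatrix l F × FullMatrix 1 F :=
  AlgEquiv.prodCongr AlgEquiv.refl
    (AlgEquiv.prodCongr (Matrix.reindexAlgEquiv F F (finSumFinEquiv.trans (finCongr h))) AlgEquiv.refl)

/-- The target of a splitting as a product of full matrix algebras, the middle factor first. -/
def targetEquivSwap (F : Type*) [Field F] (m : ℕ) {k l : ℕ} (h : 3 + k = l) :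
    Splitting.Target F (Fin m) (Fin k) ≃ₐ[F] FullMatrix l F × FullMatrix m F × FullMatrix 1 F :=
  (targetEquiv F m h).trans
    { toFun A := (A.2.1, A.1, A.2.2)
      invFun A := (A.2.1, A.1, A.2.2)
      left_inv _ := rfl
      right_inv _ := rfl
      map_mul' _ _ := rfl
      map_add' _ _ := rfl
      commutes' _ := rfl }

section Dictionary

variable {G : Type*} [Group G] [Fintype G] [DecidableEq G] {F : Type*} [Field F]

theorem two_dvd_card {G : Type*} [Group G] [Fintype G] (hG : ∀ g : G, g * g = 1)
    (hn : 3 ≤ Fintype.card G) :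
    2 ∣ Fintype.card G := by
  have : Nontrivial G := Fintype.one_lt_card_iff_nontrivial.1 (by omega)
  obtain ⟨g, hg⟩ := exists_ne (1 : G)
  rw [← orderOf_eq_prime (p := 2) (by rw [pow_two, hG]) hg]
  exact orderOf_dvd_card

variable {x : CayleyTriple G}

theorem terwilligerModRad_equiv (hG : ∀ g : G, g * g = 1) (hn : 3 ≤ Fintype.card G) {m k : ℕ}
    (P : Splitting F (Fintype.card G : F) (Fin m) (Fin k)) {B : Type*} [Ring B] [Algebra F B]
    (e : Splitting.Target F (Fin m) (Fin k) ≃ₐ[F] B) :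
    Nonempty ((cayleyScheme G hn).terwilligerModRad F x ≃ₐ[F] B) :=
  (Frame.quotient_jacobson P (frame F x hG hn) _ (mem_terwilliger_iff hG hn)).1.map (·.trans e)

theorem radSpace_eq (hG : ∀ g : G, g * g = 1) (hn : 3 ≤ Fintype.card G) {m k : ℕ}
    (P : Splitting F (Fintype.card G : F) (Fin m) (Fin k)) :
    (cayleyScheme G hn).radSpace F x = (frame F x hG hn).kerImage P :=
  (Frame.quotient_jacobson P (frame F x hG hn) _ (mem_terwilliger_iff hG hn)).2

theorem radSpace_eq_spaceV1 (p : ℕ) [CharP F p] (hG : ∀ g : G, g * g = 1)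
    (hn : 3 ≤ Fintype.card G) (h1 : (Fintype.card G : F) = 1) :
    (cayleyScheme G hn).radSpace F x = (cayleyScheme G hn).spaceV1 F p x :=
  (radSpace_eq hG hn (splittingOne h1)).trans
    ((Frame.kerImage_eq_spanOne _ _ h1).trans (spaceV1_eq hG hn p h1).symm)

theorem radSpace_eq_spaceV2_of_two [CharP F 2] (hG : ∀ g : G, g * g = 1)
    (hn : 3 ≤ Fintype.card G) (h3 : (3 : F) ≠ 0) (h4 : (Fintype.card G : F) = 4) :
    (cayleyScheme G hn).radSpace F x = (cayleyScheme G hn).spaceV2 F 2 x :=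
  (radSpace_eq hG hn (splittingCharTwo CharTwo.two_eq_zero h4)).trans
    ((Frame.kerImage_eq_spanFour _ _ h3 h4).trans (spaceV2_eq_of_two hG hn h4).symm)

theorem radSpace_eq_spaceV2_of_ne_two (p : ℕ) [CharP F p] (hG : ∀ g : G, g * g = 1)
    (hn : 3 ≤ Fintype.card G) (hp : p ≠ 2) (h0 : (2 : F) ≠ 0) (h2 : (Fintype.card G : F) = 2) :
    (cayleyScheme G hn).radSpace F x = (cayleyScheme G hn).spaceV2 F p x := by
  rw [AssociationScheme.spaceV2, if_neg hp, setB4_eq hG]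
  refine (radSpace_eq hG hn (splittingTwo h0 h2)).trans
    (Frame.kerImage_eq_of_regular _ _ fun β => eq_zero_of_gram_mul_mul_gram ?_ ?_)
  · exact fun h => one_ne_zero (α := F) (by linear_combination h - h2)
  · exact fun h => h0 (by linear_combination h2 - h)

theorem radSpace_eq_spaceV3 (hG : ∀ g : G, g * g = 1) (hn : 3 ≤ Fintype.card G)
    (h2 : (2 : F) ≠ 0) (h3 : (3 : F) ≠ 0) (h4 : (Fintype.card G : F) = 4) :
    (cayleyScheme G hn).radSpace F x = (cayleyScheme G hn).spaceV3 F x :=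
  (radSpace_eq hG hn (splittingFour h2 h3 h4)).trans
    ((Frame.kerImage_eq_spanFour _ _ h3 h4).trans (spaceV3_eq hG hn h2 h3 h4).symm)

theorem radSpace_eq_bot (hG : ∀ g : G, g * g = 1) (hn : 3 ≤ Fintype.card G)
    (h1 : (Fintype.card G : F) ≠ 1) (h2 : (Fintype.card G : F) ≠ 2)
    (h4 : (Fintype.card G : F) ≠ 4) : (cayleyScheme G hn).radSpace F x = ⊥ := by
  refine (radSpace_eq hG hn (splittingGeneric h1 h2 h4)).trans
    ((Frame.kerImage_eq_of_regular _ _ fun β => eq_zero_of_gram_mul_mul_gram h1 h4).trans ?_)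
  rw [Submodule.span_eq_bot]
  rintro _ ⟨a, b, h, -⟩
  exact absurd h (mul_ne_zero (val_ne_zero h1 h2 a) (val_ne_zero h1 h2 b))

end Dictionary

theorem two_ne_zero_of_charP (F : Type*) [Field F] {p : ℕ} [CharP F p] (hp : p ≠ 2) :
    (2 : F) ≠ 0 := by
  have := CharP.cast_eq_zero_iff F p 2
  rcases CharP.char_is_prime_or_zero F p with h | h
  · intro h2
    exact hp ((Nat.prime_dvd_prime_iff_eq h Nat.prime_two).1 (this.1 (by exact_mod_cast h2)))
  · intro h2
    have := this.1 (by exact_mod_cast h2)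
    rw [h] at this
    omega

theorem three_ne_zero_of_charP (F : Type*) [Field F] {p : ℕ} [CharP F p] (hp : p ≠ 3) :
    (3 : F) ≠ 0 := by
  have := CharP.cast_eq_zero_iff F p 3
  rcases CharP.char_is_prime_or_zero F p with h | h
  · intro h3
    exact hp ((Nat.prime_dvd_prime_iff_eq h Nat.prime_three).1 (this.1 (by exact_mod_cast h3)))
  · intro h3
    have := this.1 (by exact_mod_cast h3)
    rw [h] at this
    omega

end CayleyTriple

end

open CayleyTriple in
theorem mainTheorem1 {F : Type*} [Field F] (p : ℕ) [CharP F p]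
    {G : Type*} [Group G] [Fintype G] [DecidableEq G]
    (hG : ∀ g : G, g * g = 1) (hn : 3 ≤ Fintype.card G) (x : CayleyTriple G) :
    ((Fintype.card G ≡ 1 [MOD p] →
        Nonempty ((cayleyScheme G hn).terwilligerModRad F x ≃ₐ[F]
          FullMatrix 4 F × FullMatrix 1 F × FullMatrix 1 F)) ∧
      (p ≠ 2 → Fintype.card G ≡ 2 [MOD p] →
        Nonempty ((cayleyScheme G hn).terwilligerModRad F x ≃ₐ[F]
          FullMatrix 6 F × FullMatrix 4 F × FullMatrix 1 F)) ∧
      (p = 2 →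
        Nonempty ((cayleyScheme G hn).terwilligerModRad F x ≃ₐ[F]
          FullMatrix 5 F × FullMatrix 4 F × FullMatrix 1 F)) ∧
      (p ≠ 2 → p ≠ 3 → Fintype.card G ≡ 4 [MOD p] →
        Nonempty ((cayleyScheme G hn).terwilligerModRad F x ≃ₐ[F]
          FullMatrix 5 F × FullMatrix 5 F × FullMatrix 1 F)) ∧
      (¬ Fintype.card G ≡ 1 [MOD p] → ¬ Fintype.card G ≡ 2 [MOD p] → ¬ Fintype.card G ≡ 4 [MOD p] →
        Nonempty ((cayleyScheme G hn).terwilligerModRad F x ≃ₐ[F]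
          FullMatrix 6 F × FullMatrix 5 F × FullMatrix 1 F))) ∧
    ((Fintype.card G ≡ 1 [MOD p] →
        (cayleyScheme G hn).radSpace F x = (cayleyScheme G hn).spaceV1 F p x) ∧
      (Fintype.card G ≡ 2 [MOD p] →
        (cayleyScheme G hn).radSpace F x = (cayleyScheme G hn).spaceV2 F p x) ∧
      (p ≠ 2 → p ≠ 3 → Fintype.card G ≡ 4 [MOD p] →
        (cayleyScheme G hn).radSpace F x = (cayleyScheme G hn).spaceV3 F x) ∧
      (¬ Fintype.card G ≡ 1 [MOD p] → ¬ Fintype.card G ≡ 2 [MOD p] → ¬ Fintype.card G ≡ 4 [MOD p] →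
        (cayleyScheme G hn).radSpace F x = ⊥)) := by
  -- This includes `p = 0`, where the congruence is equality.
  have hmod (k : ℕ) : Fintype.card G ≡ k [MOD p] ↔ (Fintype.card G : F) = (k : F) :=
    (CharP.natCast_eq_natCast F p).symm
  rw [hmod 1, hmod 2, hmod 4, Nat.cast_one, Nat.cast_ofNat, Nat.cast_ofNat]
  have h2 : p ≠ 2 → (2 : F) ≠ 0 := two_ne_zero_of_charP F
  have h3 : p ≠ 3 → (3 : F) ≠ 0 := three_ne_zero_of_charP F
  have h20 (hp : p = 2) : (2 : F) = 0 := by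
    subst hp
    exact CharTwo.two_eq_zero
  -- A nontrivial element has order two, so `n` is even and equals `4` in characteristic 2.
  have h24 (hp : p = 2) : (Fintype.card G : F) = 4 := by
    obtain ⟨m, hm⟩ := two_dvd_card hG hn
    rw [hm, Nat.cast_mul, Nat.cast_ofNat]
    linear_combination (m - 2 : F) * h20 hp
  refine ⟨⟨fun h1 => ?_, fun hp e2 => ?_, fun hp => ?_, fun hp hp3 e4 => ?_, fun n1 n2 n4 => ?_⟩,
    fun h1 => ?_, fun e2 => ?_, fun hp hp3 e4 => ?_, fun n1 n2 n4 => ?_⟩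
  · exact terwilligerModRad_equiv hG hn (splittingOne h1) (targetEquivSwap F 1 rfl)
  · exact terwilligerModRad_equiv hG hn (splittingTwo (h2 hp) e2) (targetEquivSwap F 4 rfl)
  · exact terwilligerModRad_equiv hG hn (splittingCharTwo (h20 hp) (h24 hp)) (targetEquivSwap F 4 rfl)
  · exact terwilligerModRad_equiv hG hn (splittingFour (h2 hp) (h3 hp3) e4) (targetEquiv F 5 rfl)
  · exact terwilligerModRad_equiv hG hn (splittingGeneric n1 n2 n4) (targetEquivSwap F 5 rfl)
  · exact radSpace_eq_spaceV1 p hG hn h1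
  · by_cases hp : p = 2
    · subst hp
      exact radSpace_eq_spaceV2_of_two hG hn (h3 (by decide)) (h24 rfl)
    · exact radSpace_eq_spaceV2_of_ne_two p hG hn hp (h2 hp) e2
  · exact radSpace_eq_spaceV3 hG hn (h2 hp) (h3 hp3) e4
  · exact radSpace_eq_bot hG hn n1 n2 n4
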